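/- **Setting.** Let $N\ge 0$ and let $\eta=\mathrm{diag}(-1,1,1,1,1)$ on $\mathbb R^{4,1}$. Consider fields $h^a_{\mu\nu\rho}$ (totally symmetric, even), ghosts $C^a_{\mu\nu}$ (symmetric, $\eta$-traceless, odd), and antifields $h^{*}_{a\,\mu\nu\rho}$ (totally symmetric, odd), $C^{*}_{a\,\mu\nu}$ (symmetric, traceless, even), $a=1,\dots,N$. Internal indices are raised and lowered with $\delta_{ab}$, and round (square) brackets denote strength-one symmetrization (antisymmetrization). Local functions are the elements of the graded commutative real algebra of polynomials in these variables and their derivatives of all orders. On it act the total derivatives $\partial_\mu$ and the odd left derivations $\gamma,\delta$ that commute with $\partial_\mu$, vanish on all variables not listed, and satisfy $$\gamma h_{\mu\nu\rho}=3\partial_{(\mu}C_{\nu\rho)},\qquad \delta h^{*}_{\mu\nu\rho}=G_{\mu\nu\rho},\qquad \delta C^{*}_{\mu\nu}=-3\big(\partial^\rho h^*_{\mu\nu\rho}-\tfrac15\eta_{\mu\nu}\partial^\rho h^*_\rho\big),$$ where $G_{\mu\nu\rho}=F_{\mu\nu\rho}-\frac32\eta_{(\mu\nu}F_{\rho)}$,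 $F_{\mu\nu\rho}=\Box h_{\mu\nu\rho}-3\partial^\sigma\partial_{(\mu}h_{\nu\rho)\sigma}+3\partial_{(\mu}\partial_\nu h_{\rho)}$, and a rank-three symmetric tensor written with a single index denotes its trace. Write $X\simeq 0$ if $X=\partial_\mu j^\mu$ for some local functions $j^\mu$. Let $g^a{}_{bc}=g^a{}_{cb}$ be real constants, $g_{abc}=\delta_{ad}g^d{}_{bc}$, and let $\mathcal B=\mathbb R^N$ be the commutative algebra with product $(x\cdot y)^a=g^a{}_{bc}x^by^c$. Put $$a_2=g^a{}_{bc}\,\varepsilon^{\mu\nu\rho\sigma\tau}C^{*\alpha}_{a}{}_{\mu}\,\partial_{[\nu}C^{b}_{\rho]}{}^{\beta}\,\partial_\alpha\partial_{[\sigma}C^c_{\tau]\beta},\qquad a_1=g^a{}_{bc}\,\varepsilon^{\mu\nu\rho\sigma\tau}h^{*\alpha\beta}_{a}{}_{\mu}\,\partial_{[\nu}C^{b}_{\rho]}{}^{\lambda}\,\Gamma^c_{\lambda[\sigma;\tau]\alpha\beta},$$ where $\Gamma$ is the second de Wit–Freedman connection $$\Gamma_{\lambda\sigma;\tau\alpha\beta}=3\partial_{(\tau}\partial_\alpha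 h_{\beta)\lambda\sigma}+\partial_\lambda\partial_\sigma h_{\tau\alpha\beta}-\tfrac32\big(\partial_\lambda\partial_{(\tau}h_{\alpha\beta)\sigma}+\partial_\sigma\partial_{(\tau}h_{\alpha\beta)\lambda}\big).$$ **Claim.** 1. $a_2$ lifts to $a_1$: $\gamma a_2=0$ and $\gamma a_1+\delta a_2\simeq0$. 2. $\gamma\Gamma^c_{\rho\sigma;\tau\alpha\beta}=3\,\partial_\tau\partial_\alpha\partial_\beta C^c_{\rho\sigma}$. 3. For every coupling constant $\kappa\in\mathbb R$, up to a total divergence, $3h_a^{*\mu\nu\rho}\partial_\mu C^a_{\nu\rho}+\kappa a_1= h_a^{*\mu\alpha\beta}R^a_{\mu\alpha\beta}$, with $R$ totally symmetric, free of antifields, and equal to the total symmetrization over $(\mu\alpha\beta)$ of $$3\,\partial_\mu C^a_{\alpha\beta}+\kappa\, g^a{}_{bc}\,\varepsilon_\mu{}^{\nu\rho\sigma\tau}\,\Gamma^b_{\gamma\nu;\rho\alpha\beta}\,\partial_\sigma C^{c}_{\tau}{}^{\gamma}.$$ That is, replacing $C$ by a traceless gauge parameter $\lambda$, the first-order deformed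 gauge transformation is $\delta_\lambda h^a_{\mu\alpha\beta}=R^a_{\mu\alpha\beta}$. 4. There is a Poincaré-invariant, parity-odd local function $a_0$ of the fields, cubic in $h$ and with four derivatives, such that $\gamma a_0+\delta a_1\simeq0$, if and only if $g_{abc}$ is totally symmetric. The same equivalence holds if $a_0$ is allowed to be an arbitrary local function of the fields $h$ and their derivatives. 5. $g_{abc}$ is totally symmetric if and only if the internal metric is invariant: $\langle x\cdot y,z\rangle=\langle x,y\cdot z\rangle$ for all $x,y,z\in\mathcal B$, with $\langle x,y\rangle=\delta_{ab}x^ay^b$. 6. If $g_{abc}$ is totally symmetric, a vertex as in 4 (Poincaré-invariant, parity-odd, cubic, four derivatives, $\gamma a_0+\delta a_1\simeq 0$) is $$\begin{aligned}a_0=\tfrac32 g_{abc}\varepsilon^{\mu\nu\rho\sigma\tau}\Big\{&-\tfrac18\partial_\mu\Box h^a_\nu\,\partial_\rho h^b_\sigma\, h^c_\tau+\tfrac12\partial_\mu\partial_\alpha\partial_\beta h^a_\nu\,\partial_\rho h^{b\,\alpha\beta}_\sigma h^c_\tau+\tfrac14\partial_\mu\Box h^{a\,\alpha\beta}_\nu\,\partial_\rho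 h^b_{\sigma\alpha\beta}h^c_\tau\\&+\tfrac38\partial_\mu\Box h^a_\nu\,\partial_\rho h^{b\,\alpha\beta}_\sigma h^c_{\tau\alpha\beta}-\tfrac12\partial_\mu\Box h^{a\,\alpha\beta}_\nu\,\partial_\rho h^b_{\sigma\alpha\gamma}h^{c}_{\tau\beta}{}^{\gamma}-\tfrac12\partial_\mu\partial^\alpha\partial^\beta h^a_\nu\,\partial_\rho h^b_{\sigma\alpha\gamma}h^{c}_{\tau\beta}{}^{\gamma}\\&-\tfrac12\partial_\mu\partial^\alpha\partial^\beta h^a_{\nu\alpha\gamma}\,\partial_\rho h^b_\sigma\, h^{c}_{\tau\beta}{}^{\gamma}-\tfrac14\partial_\mu\partial^\alpha\partial^\beta h^a_{\nu\alpha\beta}\,\partial_\rho h^{b\,\gamma\delta}_\sigma h^c_{\tau\gamma\delta}-\tfrac12\partial_\mu\partial^\alpha\partial^\beta h^a_{\nu\gamma\delta}\,\partial_\rho h^b_{\sigma\alpha\beta}h^{c\,\gamma\delta}_\tau\\&+\partial_\mu\partial^\alpha\partial^\beta h^a_{\nu\beta\gamma}\,\partial_\rho h^{b\,\gamma\delta}_\sigma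 h^c_{\tau\alpha\delta}+\tfrac12\partial_\mu\partial_\alpha h^{a\,\alpha\beta}_\nu\,\partial_\rho\partial^\gamma h^b_\sigma\, h^c_{\tau\beta\gamma}-\partial_\mu\partial_\alpha h^a_{\nu\beta\gamma}\,\partial_\rho\partial_\delta h^{b\,\alpha\beta}_\sigma h^{c\,\gamma\delta}_\tau\Big\}.\end{aligned}$$ -/

import Mathlib

open scoped BigOperators

noncomputable section

namespace Spin3

/-! # Conventions

Space-time is five-dimensional Minkowski space with indices in `Fin 5` (`0` is time) and the mostly
plus metric.  All components of fields, ghosts and antifields are components with *lower* indices;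
an index is raised by multiplying with `sgn μ = η^{μμ}`, so that the contraction `X^α Y_α` is
`∑ α, sgn α • (X α * Y α)`. -/

/-- Diagonal entries of the mostly plus Minkowski metric. -/
def sgn (μ : Fin 5) : ℝ := if μ = 0 then -1 else 1

/-- The Minkowski metric `η_{μν}`. -/
def eta (μ ν : Fin 5) : ℝ := if μ = ν then sgn μ else 0

/-- The Levi-Civita density `ε^{μνρστ}` (upper indices), with `ε^{01234} = 1`. -/
def eps (μ ν ρ σ τ : Fin 5) : ℝ :=
  Matrix.det (Matrix.of fun i j : Fin 5 => if ![μ, ν, ρ, σ, τ] i = j then (1 : ℝ) else 0)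

/-- Strength-one symmetrization `T_{(μνρ)}`. -/
def sym3 {M : Type*} [AddCommGroup M] [Module ℝ M] (T : Fin 5 → Fin 5 → Fin 5 → M)
    (μ ν ρ : Fin 5) : M :=
  (1 / 6 : ℝ) • (T μ ν ρ + T μ ρ ν + T ν μ ρ + T ν ρ μ + T ρ μ ν + T ρ ν μ)

/-! # The graded algebra of (polynomial) local functions -/

/-- Components of the fields `h^a_{μνρ}`, ghosts `C^a_{μν}`, and antifields `h^*`, `C^*`. -/
inductive Var (N : ℕ) : Type
  | h (a : Fin N) (μ ν ρ : Fin 5) : Var N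
  | C (a : Fin N) (μ ν : Fin 5) : Var N
  | hs (a : Fin N) (μ ν ρ : Fin 5) : Var N
  | Cs (a : Fin N) (μ ν : Fin 5) : Var N

/-- Grassmann parity: ghost number modulo two (`h : 0`, `C : 1`, `h^* : -1`, `C^* : -2`). -/
def Var.odd {N : ℕ} : Var N → Bool
  | .h _ _ _ _ => false
  | .C _ _ _ => true
  | .hs _ _ _ _ => true
  | .Cs _ _ _ => false

/-- `(m, f)` stands for the partial derivative `∂_m f`, where `m` is the multiset of derivative
indices. -/
abbrev Jet (N : ℕ) : Type := Multiset (Fin 5) × Var N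

/-- The sign `-1` for `true` and `1` for `false`. -/
def koszul (b : Bool) : ℝ := if b then -1 else 1

/-- A function on jets is compatible with the tensor symmetries: `h`, `h^*` are completely
symmetric, `C`, `C^*` are symmetric and traceless. -/
structure Respects {N : ℕ} {M : Type*} [AddCommGroup M] [Module ℝ M] (f : Jet N → M) :
    Prop where
  h₁₂ : ∀ m a μ ν ρ, f (m, .h a μ ν ρ) = f (m, .h a ν μ ρ)
  h₂₃ : ∀ m a μ ν ρ, f (m, .h a μ ν ρ) = f (m, .h a μ ρ ν)
  hs₁₂ : ∀ m a μ ν ρ, f (m, .hs a μ ν ρ) = f (m, .hs a ν μ ρ)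
  hs₂₃ : ∀ m a μ ν ρ, f (m, .hs a μ ν ρ) = f (m, .hs a μ ρ ν)
  C₁₂ : ∀ m a μ ν, f (m, .C a μ ν) = f (m, .C a ν μ)
  Cs₁₂ : ∀ m a μ ν, f (m, .Cs a μ ν) = f (m, .Cs a ν μ)
  C_trace : ∀ m a, ∑ μ, sgn μ • f (m, .C a μ μ) = 0
  Cs_trace : ∀ m a, ∑ μ, sgn μ • f (m, .Cs a μ μ) = 0

/-- Defining relations: tensor symmetries and graded commutativity. -/
inductive Rel (N : ℕ) : FreeAlgebra ℝ (Jet N) → FreeAlgebra ℝ (Jet N) → Prop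
  | h₁₂ (m : Multiset (Fin 5)) (a : Fin N) (μ ν ρ : Fin 5) :
      Rel N (FreeAlgebra.ι ℝ (m, .h a μ ν ρ)) (FreeAlgebra.ι ℝ (m, .h a ν μ ρ))
  | h₂₃ (m : Multiset (Fin 5)) (a : Fin N) (μ ν ρ : Fin 5) :
      Rel N (FreeAlgebra.ι ℝ (m, .h a μ ν ρ)) (FreeAlgebra.ι ℝ (m, .h a μ ρ ν))
  | hs₁₂ (m : Multiset (Fin 5)) (a : Fin N) (μ ν ρ : Fin 5) :
      Rel N (FreeAlgebra.ι ℝ (m, .hs a μ ν ρ)) (FreeAlgebra.ι ℝ (m, .hs a ν μ ρ))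
  | hs₂₃ (m : Multiset (Fin 5)) (a : Fin N) (μ ν ρ : Fin 5) :
      Rel N (FreeAlgebra.ι ℝ (m, .hs a μ ν ρ)) (FreeAlgebra.ι ℝ (m, .hs a μ ρ ν))
  | C₁₂ (m : Multiset (Fin 5)) (a : Fin N) (μ ν : Fin 5) :
      Rel N (FreeAlgebra.ι ℝ (m, .C a μ ν)) (FreeAlgebra.ι ℝ (m, .C a ν μ))
  | Cs₁₂ (m : Multiset (Fin 5)) (a : Fin N) (μ ν : Fin 5) :
      Rel N (FreeAlgebra.ι ℝ (m, .Cs a μ ν)) (FreeAlgebra.ι ℝ (m, .Cs a ν μ))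
  | C_trace (m : Multiset (Fin 5)) (a : Fin N) :
      Rel N (∑ μ, sgn μ • FreeAlgebra.ι ℝ (m, .C a μ μ)) 0
  | Cs_trace (m : Multiset (Fin 5)) (a : Fin N) :
      Rel N (∑ μ, sgn μ • FreeAlgebra.ι ℝ (m, .Cs a μ μ)) 0
  | comm (x y : Jet N) :
      Rel N (FreeAlgebra.ι ℝ x * FreeAlgebra.ι ℝ y)
        (koszul (x.2.odd && y.2.odd) • (FreeAlgebra.ι ℝ y * FreeAlgebra.ι ℝ x))

/-- The graded commutative algebra of local functions: polynomials in the fields, ghosts, antifields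
and their derivatives of all finite orders (no explicit dependence on the coordinates). -/
def BRST (N : ℕ) : Type := RingQuot (Rel N)

instance (N : ℕ) : Ring (BRST N) := inferInstanceAs (Ring (RingQuot (Rel N)))

instance (N : ℕ) : Algebra ℝ (BRST N) := inferInstanceAs (Algebra ℝ (RingQuot (Rel N)))

/-- The quotient map from the free algebra. -/
def BRST.mk (N : ℕ) : FreeAlgebra ℝ (Jet N) →ₐ[ℝ] BRST N := RingQuot.mkAlgHom ℝ (Rel N)

theorem BRST.mk_rel {N : ℕ} {x y : FreeAlgebra ℝ (Jet N)} (h : Rel N x y) :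
    BRST.mk N x = BRST.mk N y := RingQuot.mkAlgHom_rel ℝ h

variable {N : ℕ}

/-- The generator `∂_m f`. -/
def gen (x : Jet N) : BRST N := BRST.mk N (FreeAlgebra.ι ℝ x)

theorem gen_respects : Respects (gen : Jet N → BRST N) where
  h₁₂ m a μ ν ρ := BRST.mk_rel (Rel.h₁₂ m a μ ν ρ)
  h₂₃ m a μ ν ρ := BRST.mk_rel (Rel.h₂₃ m a μ ν ρ)
  hs₁₂ m a μ ν ρ := BRST.mk_rel (Rel.hs₁₂ m a μ ν ρ)
  hs₂₃ m a μ ν ρ := BRST.mk_rel (Rel.hs₂₃ m a μ ν ρ)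
  C₁₂ m a μ ν := BRST.mk_rel (Rel.C₁₂ m a μ ν)
  Cs₁₂ m a μ ν := BRST.mk_rel (Rel.Cs₁₂ m a μ ν)
  C_trace m a := by
    have := BRST.mk_rel (Rel.C_trace m a)
    simpa only [map_sum, map_smul, map_zero, gen] using this
  Cs_trace m a := by
    have := BRST.mk_rel (Rel.Cs_trace m a)
    simpa only [map_sum, map_smul, map_zero, gen] using this

theorem gen_comm (x y : Jet N) :
    gen x * gen y = koszul (x.2.odd && y.2.odd) • (gen y * gen x) := by
  have := BRST.mk_rel (Rel.comm x y)
  simpa only [map_mul, map_smul, gen] using this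

/-- Universal property: algebra homomorphisms out of `BRST N`. -/
def liftHom {B : Type*} [Ring B] [Algebra ℝ B] (f : Jet N → B) (hf : Respects f)
    (hc : ∀ x y, f x * f y = koszul (x.2.odd && y.2.odd) • (f y * f x)) : BRST N →ₐ[ℝ] B :=
  (RingQuot.liftAlgHom ℝ (s := Rel N) ⟨FreeAlgebra.lift ℝ f, by
    intro x y hxy
    cases hxy with
    | h₁₂ => simpa using hf.h₁₂ _ _ _ _ _
    | h₂₃ => simpa using hf.h₂₃ _ _ _ _ _
    | hs₁₂ => simpa using hf.hs₁₂ _ _ _ _ _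
    | hs₂₃ => simpa using hf.hs₂₃ _ _ _ _ _
    | C₁₂ => simpa using hf.C₁₂ _ _ _ _
    | Cs₁₂ => simpa using hf.Cs₁₂ _ _ _ _
    | C_trace => simpa only [map_sum, map_smul, map_zero, FreeAlgebra.lift_ι_apply] using hf.C_trace _ _
    | Cs_trace => simpa only [map_sum, map_smul, map_zero, FreeAlgebra.lift_ι_apply] using hf.Cs_trace _ _
    | comm x y => simpa only [map_mul, map_smul, FreeAlgebra.lift_ι_apply] using hc x y⟩ : RingQuot (Rel N) →ₐ[ℝ] B)

@[simp] theorem liftHom_gen {B : Type*} [Ring B] [Algebra ℝ B] (f : Jet N → B) (hf : Respects f)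
    (hc : ∀ x y, f x * f y = koszul (x.2.odd && y.2.odd) • (f y * f x)) (x : Jet N) :
    liftHom f hf hc (gen x) = f x := by
  have := RingQuot.liftAlgHom_mkAlgHom_apply ℝ (FreeAlgebra.lift ℝ f) (s := Rel N)
  exact (this _ _).trans (by simp)

theorem Respects.map {M M' : Type*} [AddCommGroup M] [Module ℝ M] [AddCommGroup M'] [Module ℝ M']
    {f : Jet N → M} (hf : Respects f) (L : M →ₗ[ℝ] M') : Respects fun x => L (f x) where
  h₁₂ m a μ ν ρ := congrArg L (hf.h₁₂ m a μ ν ρ)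
  h₂₃ m a μ ν ρ := congrArg L (hf.h₂₃ m a μ ν ρ)
  hs₁₂ m a μ ν ρ := congrArg L (hf.hs₁₂ m a μ ν ρ)
  hs₂₃ m a μ ν ρ := congrArg L (hf.hs₂₃ m a μ ν ρ)
  C₁₂ m a μ ν := congrArg L (hf.C₁₂ m a μ ν)
  Cs₁₂ m a μ ν := congrArg L (hf.Cs₁₂ m a μ ν)
  C_trace m a := by simpa only [map_sum, map_smul, map_zero] using congrArg L (hf.C_trace m a)
  Cs_trace m a := by simpa only [map_sum, map_smul, map_zero] using congrArg L (hf.Cs_trace m a)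

theorem Respects.add {M : Type*} [AddCommGroup M] [Module ℝ M] {f k : Jet N → M}
    (hf : Respects f) (hk : Respects k) : Respects fun x => f x + k x where
  h₁₂ m a μ ν ρ := congrArg₂ (· + ·) (hf.h₁₂ m a μ ν ρ) (hk.h₁₂ m a μ ν ρ)
  h₂₃ m a μ ν ρ := congrArg₂ (· + ·) (hf.h₂₃ m a μ ν ρ) (hk.h₂₃ m a μ ν ρ)
  hs₁₂ m a μ ν ρ := congrArg₂ (· + ·) (hf.hs₁₂ m a μ ν ρ) (hk.hs₁₂ m a μ ν ρ)
  hs₂₃ m a μ ν ρ := congrArg₂ (· + ·) (hf.hs₂₃ m a μ ν ρ) (hk.hs₂₃ m a μ ν ρ)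
  C₁₂ m a μ ν := congrArg₂ (· + ·) (hf.C₁₂ m a μ ν) (hk.C₁₂ m a μ ν)
  Cs₁₂ m a μ ν := congrArg₂ (· + ·) (hf.Cs₁₂ m a μ ν) (hk.Cs₁₂ m a μ ν)
  C_trace m a := by
    simp only [smul_add, Finset.sum_add_distrib, hf.C_trace, hk.C_trace, add_zero]
  Cs_trace m a := by
    simp only [smul_add, Finset.sum_add_distrib, hf.Cs_trace, hk.Cs_trace, add_zero]

/-- The parity involution: it multiplies every odd generator by `-1`. -/
def parityInv : BRST N →ₐ[ℝ] BRST N :=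
  liftHom (fun x => koszul x.2.odd • gen x)
    { h₁₂ := fun m a μ ν ρ => by simp only [Var.odd, gen_respects.h₁₂ m a μ ν ρ]
      h₂₃ := fun m a μ ν ρ => by simp only [Var.odd, gen_respects.h₂₃ m a μ ν ρ]
      hs₁₂ := fun m a μ ν ρ => by simp only [Var.odd, gen_respects.hs₁₂ m a μ ν ρ]
      hs₂₃ := fun m a μ ν ρ => by simp only [Var.odd, gen_respects.hs₂₃ m a μ ν ρ]
      C₁₂ := fun m a μ ν => by simp only [Var.odd, gen_respects.C₁₂ m a μ ν]
      Cs₁₂ := fun m a μ ν => by simp only [Var.odd, gen_respects.Cs₁₂ m a μ ν]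
      C_trace := fun m a => by
        simp only [Var.odd, smul_comm (sgn _) (koszul _), ← Finset.smul_sum,
          gen_respects.C_trace m a, smul_zero]
      Cs_trace := fun m a => by
        simp only [Var.odd, smul_comm (sgn _) (koszul _), ← Finset.smul_sum,
          gen_respects.Cs_trace m a, smul_zero] }
    (fun x y => by
      simp only [smul_mul_smul_comm]
      rw [gen_comm x y, smul_smul, smul_smul]
      congr 1; ring)

@[simp] theorem parityInv_gen (x : Jet N) : parityInv (gen x) = koszul x.2.odd • gen x := by
  simp [parityInv]

/-! # Graded derivations -/

/-- Elements that commute with every generator with the sign appropriate for parity `q`. -/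
def parityPart (N : ℕ) (q : Bool) : Submodule ℝ (BRST N) where
  carrier := {z | ∀ x : Jet N, gen x * z = koszul (x.2.odd && q) • (z * gen x)}
  add_mem' hu hv x := by rw [mul_add, hu x, hv x, add_mul, smul_add]
  zero_mem' x := by simp
  smul_mem' c z hz x := by
    rw [mul_smul_comm, hz x, smul_mul_assoc, smul_comm]

theorem gen_mem_parityPart (x : Jet N) : gen x ∈ parityPart N x.2.odd := fun y => gen_comm y x

/-- `d` sends generators of parity `p` to elements of parity `p + t`. -/
def HasParity (t : Bool) (d : Jet N → BRST N) : Prop :=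
  ∀ x, d x ∈ parityPart N (xor x.2.odd t)

/-- The matrix `[[τ x, d x], [0, x]]`; multiplying such matrices encodes the graded Leibniz rule. -/
def derMatrix (t : Bool) (d : Jet N → BRST N) (x : Jet N) : Matrix (Fin 2) (Fin 2) (BRST N) :=
  !![koszul (t && x.2.odd) • gen x, d x; 0, gen x]

theorem derMatrix_respects (t : Bool) (d : Jet N → BRST N) (hd : Respects d) :
    Respects (derMatrix t d) where
  h₁₂ m a μ ν ρ := by
    simp only [derMatrix, Var.odd, gen_respects.h₁₂ m a μ ν ρ, hd.h₁₂ m a μ ν ρ]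
  h₂₃ m a μ ν ρ := by
    simp only [derMatrix, Var.odd, gen_respects.h₂₃ m a μ ν ρ, hd.h₂₃ m a μ ν ρ]
  hs₁₂ m a μ ν ρ := by
    simp only [derMatrix, Var.odd, gen_respects.hs₁₂ m a μ ν ρ, hd.hs₁₂ m a μ ν ρ]
  hs₂₃ m a μ ν ρ := by
    simp only [derMatrix, Var.odd, gen_respects.hs₂₃ m a μ ν ρ, hd.hs₂₃ m a μ ν ρ]
  C₁₂ m a μ ν := by
    simp only [derMatrix, Var.odd, gen_respects.C₁₂ m a μ ν, hd.C₁₂ m a μ ν]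
  Cs₁₂ m a μ ν := by
    simp only [derMatrix, Var.odd, gen_respects.Cs₁₂ m a μ ν, hd.Cs₁₂ m a μ ν]
  C_trace m a := by
    ext i j
    fin_cases i <;> fin_cases j <;>
      simp [derMatrix, Matrix.sum_apply, Var.odd, smul_comm (sgn _) (koszul _), ← Finset.smul_sum,
        gen_respects.C_trace m a, hd.C_trace m a]
  Cs_trace m a := by
    ext i j
    fin_cases i <;> fin_cases j <;>
      simp [derMatrix, Matrix.sum_apply, Var.odd, smul_comm (sgn _) (koszul _), ← Finset.smul_sum,
        gen_respects.Cs_trace m a, hd.Cs_trace m a]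

theorem derMatrix_comm (t : Bool) (d : Jet N → BRST N)
    (hp : HasParity t d) (x y : Jet N) :
    derMatrix t d x * derMatrix t d y =
      koszul (x.2.odd && y.2.odd) • (derMatrix t d y * derMatrix t d x) := by
  have h1 := hp y x
  have h2 := hp x y
  have h3 := gen_comm x y
  ext i j
  fin_cases i <;> fin_cases j
  · simp only [derMatrix, Matrix.mul_apply, Fin.sum_univ_two, Matrix.smul_apply]
    simp [smul_smul, h3]
    congr 1; ring
  · simp only [derMatrix, Matrix.mul_apply, Fin.sum_univ_two, Matrix.smul_apply]
    simp [smul_smul, h1, h2]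
    generalize x.2.odd = p
    generalize y.2.odd = q
    cases p <;> cases q <;> cases t <;> simp [koszul] <;> abel
  · simp [derMatrix, Matrix.mul_apply, Fin.sum_univ_two]
  · simpa [derMatrix, Matrix.mul_apply, Fin.sum_univ_two] using h3

theorem BRST.induction {p : BRST N → Prop} (hc : ∀ r : ℝ, p (algebraMap ℝ (BRST N) r))
    (hg : ∀ x, p (gen x)) (hm : ∀ u v, p u → p v → p (u * v))
    (ha : ∀ u v, p u → p v → p (u + v)) (z : BRST N) : p z := by
  obtain ⟨w, rfl⟩ : ∃ w, BRST.mk N w = z := RingQuot.mkAlgHom_surjective ℝ (Rel N) z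
  induction w using FreeAlgebra.induction with
  | grade0 r => simpa using hc r
  | grade1 x => exact hg x
  | mul u v hu hv => simpa using hm _ _ hu hv
  | add u v hu hv => simpa using ha _ _ hu hv

/-- The algebra homomorphism given by `derMatrix`. -/
def derHom (t : Bool) (d : Jet N → BRST N) (hd : Respects d)
    (hp : HasParity t d) :
    BRST N →ₐ[ℝ] Matrix (Fin 2) (Fin 2) (BRST N) :=
  liftHom (derMatrix t d) (derMatrix_respects t d hd) (derMatrix_comm t d hp)

theorem derHom_apply (t : Bool) (d : Jet N → BRST N) (hd : Respects d)
    (hp : HasParity t d) (z : BRST N) :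
    derHom t d hd hp z 1 0 = 0 ∧ derHom t d hd hp z 1 1 = z ∧
      derHom t d hd hp z 0 0 = if t then parityInv z else z := by
  induction z using BRST.induction with
  | hc r =>
    rw [AlgHom.commutes, AlgHom.commutes]
    simp [Matrix.algebraMap_matrix_apply]
  | hg x =>
    rw [derHom, liftHom_gen, parityInv_gen]
    cases t <;> simp [derMatrix, koszul]
  | hm u v hu hv =>
    obtain ⟨h1, h2, h3⟩ := hu
    obtain ⟨k1, k2, k3⟩ := hv
    rw [map_mul, map_mul]
    simp only [Matrix.mul_apply, Fin.sum_univ_two, h1, h2, h3, k1, k2, k3]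
    refine ⟨by simp, by simp, ?_⟩
    cases t <;> simp
  | ha u v hu hv =>
    obtain ⟨h1, h2, h3⟩ := hu
    obtain ⟨k1, k2, k3⟩ := hv
    rw [map_add, map_add]
    simp only [Matrix.add_apply, h1, h2, h3, k1, k2, k3]
    refine ⟨by simp, trivial, ?_⟩
    cases t <;> simp

/-- The left graded derivation of parity `t` with prescribed values `d` on the generators. -/
def gradedDer (t : Bool) (d : Jet N → BRST N) (hd : Respects d)
    (hp : HasParity t d) : BRST N →ₗ[ℝ] BRST N :=
  (Matrix.entryLinearMap ℝ (BRST N) (0 : Fin 2) (1 : Fin 2)) ∘ₗ (derHom t d hd hp).toLinearMap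

/-- Values of a graded derivation on generators. -/
theorem gradedDer_gen (t : Bool) (d : Jet N → BRST N) (hd : Respects d)
    (hp : HasParity t d) (x : Jet N) :
    gradedDer t d hd hp (gen x) = d x := by
  change derHom t d hd hp (gen x) 0 1 = _
  rw [derHom, liftHom_gen]
  rfl

/-- The graded Leibniz rule. -/
theorem gradedDer_mul (t : Bool) (d : Jet N → BRST N) (hd : Respects d)
    (hp : HasParity t d) (u v : BRST N) :
    gradedDer t d hd hp (u * v) =
      gradedDer t d hd hp u * v + (if t then parityInv u else u) * gradedDer t d hd hp v := by
  change derHom t d hd hp (u * v) 0 1 =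
    derHom t d hd hp u 0 1 * v + _ * derHom t d hd hp v 0 1
  obtain ⟨-, -, h3⟩ := derHom_apply t d hd hp u
  obtain ⟨-, k2, -⟩ := derHom_apply t d hd hp v
  rw [map_mul, Matrix.mul_apply, Fin.sum_univ_two, h3, k2, add_comm]

/-! # Fields, and the differentials of the free theory -/

/-- `∂_m h^a_{μνρ}` -/
def hJet (m : Multiset (Fin 5)) (a : Fin N) (μ ν ρ : Fin 5) : BRST N := gen (m, .h a μ ν ρ)

/-- `∂_m C^a_{μν}` -/
def CJet (m : Multiset (Fin 5)) (a : Fin N) (μ ν : Fin 5) : BRST N := gen (m, .C a μ ν)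

/-- `∂_m h^*_{aμνρ}` -/
def hsJet (m : Multiset (Fin 5)) (a : Fin N) (μ ν ρ : Fin 5) : BRST N := gen (m, .hs a μ ν ρ)

/-- `∂_m C^*_{aμν}` -/
def CsJet (m : Multiset (Fin 5)) (a : Fin N) (μ ν : Fin 5) : BRST N := gen (m, .Cs a μ ν)

/-- The trace `∂_m h^a_μ`, `h_μ = η^{νρ} h_{μνρ}`. -/
def hTr (m : Multiset (Fin 5)) (a : Fin N) (μ : Fin 5) : BRST N :=
  ∑ α, sgn α • hJet m a μ α α

/-- The Fronsdal tensor
`F_{μνρ} = □ h_{μνρ} - 3 ∂^σ ∂_{(μ} h_{νρ)σ} + 3 ∂_{(μ} ∂_ν h_{ρ)}`, differentiated by `∂_m`. -/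
def fronsdal (m : Multiset (Fin 5)) (a : Fin N) (μ ν ρ : Fin 5) : BRST N :=
  (∑ σ, sgn σ • hJet (σ ::ₘ σ ::ₘ m) a μ ν ρ)
    - (3 : ℝ) • sym3 (fun μ ν ρ => ∑ σ, sgn σ • hJet (σ ::ₘ μ ::ₘ m) a ν ρ σ) μ ν ρ
    + (3 : ℝ) • sym3 (fun μ ν ρ => hTr (μ ::ₘ ν ::ₘ m) a ρ) μ ν ρ

/-- The left-hand side of the free field equations,
`G_{μνρ} = F_{μνρ} - (3/2) η_{(μν} F_{ρ)}`, differentiated by `∂_m`. -/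
def eom (m : Multiset (Fin 5)) (a : Fin N) (μ ν ρ : Fin 5) : BRST N :=
  fronsdal m a μ ν ρ
    - (3 / 2 : ℝ) • sym3 (fun μ ν ρ => eta μ ν • ∑ α, sgn α • fronsdal m a ρ α α) μ ν ρ

theorem sym3_swap₁₂ {M : Type*} [AddCommGroup M] [Module ℝ M] (T : Fin 5 → Fin 5 → Fin 5 → M)
    (μ ν ρ : Fin 5) : sym3 T μ ν ρ = sym3 T ν μ ρ := by
  unfold sym3; congr 1; abel

theorem sym3_swap₂₃ {M : Type*} [AddCommGroup M] [Module ℝ M] (T : Fin 5 → Fin 5 → Fin 5 → M)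
    (μ ν ρ : Fin 5) : sym3 T μ ν ρ = sym3 T μ ρ ν := by
  unfold sym3; congr 1; abel

theorem sym3_mem {M : Type*} [AddCommGroup M] [Module ℝ M] (S : Submodule ℝ M)
    {T : Fin 5 → Fin 5 → Fin 5 → M} (hT : ∀ μ ν ρ, T μ ν ρ ∈ S) (μ ν ρ : Fin 5) :
    sym3 T μ ν ρ ∈ S := by
  unfold sym3
  exact S.smul_mem _ (S.add_mem (S.add_mem (S.add_mem (S.add_mem (S.add_mem (hT _ _ _) (hT _ _ _))
    (hT _ _ _)) (hT _ _ _)) (hT _ _ _)) (hT _ _ _))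

theorem eom_swap₁₂ (m : Multiset (Fin 5)) (a : Fin N) (μ ν ρ : Fin 5) :
    eom m a μ ν ρ = eom m a ν μ ρ := by
  have h : fronsdal m a μ ν ρ = fronsdal m a ν μ ρ := by
    rw [fronsdal, sym3_swap₁₂ _ μ ν ρ, sym3_swap₁₂ _ μ ν ρ]
    simp only [hJet, fun m => gen_respects.h₁₂ m a μ ν ρ, fronsdal]
  rw [eom, h, sym3_swap₁₂ _ μ ν ρ, eom]

theorem eom_swap₂₃ (m : Multiset (Fin 5)) (a : Fin N) (μ ν ρ : Fin 5) :
    eom m a μ ν ρ = eom m a μ ρ ν := by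
  have h : fronsdal m a μ ν ρ = fronsdal m a μ ρ ν := by
    rw [fronsdal, sym3_swap₂₃ _ μ ν ρ, sym3_swap₂₃ _ μ ν ρ]
    simp only [hJet, fun m => gen_respects.h₂₃ m a μ ν ρ, fronsdal]
  rw [eom, h, sym3_swap₂₃ _ μ ν ρ, eom]

theorem hJet_mem (m : Multiset (Fin 5)) (a : Fin N) (μ ν ρ : Fin 5) :
    hJet m a μ ν ρ ∈ parityPart N false := gen_mem_parityPart (m, Var.h a μ ν ρ)

theorem fronsdal_mem (m : Multiset (Fin 5)) (a : Fin N) (μ ν ρ : Fin 5) :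
    fronsdal m a μ ν ρ ∈ parityPart N false := by
  refine add_mem (sub_mem (sum_mem fun σ _ => Submodule.smul_mem _ _ (hJet_mem _ _ _ _ _))
    (Submodule.smul_mem _ _ (sym3_mem _ (fun μ ν ρ => sum_mem fun σ _ =>
      Submodule.smul_mem _ _ (hJet_mem _ _ _ _ _)) _ _ _)))
    (Submodule.smul_mem _ _ (sym3_mem _ (fun μ ν ρ => sum_mem fun σ _ =>
      Submodule.smul_mem _ _ (hJet_mem _ _ _ _ _)) _ _ _))

theorem eom_mem (m : Multiset (Fin 5)) (a : Fin N) (μ ν ρ : Fin 5) :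
    eom m a μ ν ρ ∈ parityPart N false := by
  refine sub_mem (fronsdal_mem _ _ _ _ _) (Submodule.smul_mem _ _ (sym3_mem _ (fun μ ν ρ =>
    Submodule.smul_mem _ _ (sum_mem fun σ _ =>
      Submodule.smul_mem _ _ (fronsdal_mem _ _ _ _ _))) _ _ _))

/-- The total derivative `∂_κ`. -/
def totalDeriv (κ : Fin 5) : BRST N →ₗ[ℝ] BRST N :=
  gradedDer false (fun x => gen (κ ::ₘ x.1, x.2))
    { h₁₂ := fun m a μ ν ρ => gen_respects.h₁₂ _ a μ ν ρ
      h₂₃ := fun m a μ ν ρ => gen_respects.h₂₃ _ a μ ν ρ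
      hs₁₂ := fun m a μ ν ρ => gen_respects.hs₁₂ _ a μ ν ρ
      hs₂₃ := fun m a μ ν ρ => gen_respects.hs₂₃ _ a μ ν ρ
      C₁₂ := fun m a μ ν => gen_respects.C₁₂ _ a μ ν
      Cs₁₂ := fun m a μ ν => gen_respects.Cs₁₂ _ a μ ν
      C_trace := fun m a => gen_respects.C_trace _ a
      Cs_trace := fun m a => gen_respects.Cs_trace _ a }
    (fun x => by simpa using gen_mem_parityPart (κ ::ₘ x.1, x.2))

/-- Values of `γ` on generators: `γ h_{μνρ} = 3 ∂_{(μ} C_{νρ)}`, zero on `C`, `h^*`, `C^*`. -/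
def gammaGen : Jet N → BRST N
  | (m, .h a μ ν ρ) => (3 : ℝ) • sym3 (fun μ ν ρ => CJet (μ ::ₘ m) a ν ρ) μ ν ρ
  | (_, .C _ _ _) => 0
  | (_, .hs _ _ _ _) => 0
  | (_, .Cs _ _ _) => 0

/-- The differential `γ` along the gauge orbits. -/
def gamma : BRST N →ₗ[ℝ] BRST N :=
  gradedDer true gammaGen
    { h₁₂ := fun m a μ ν ρ => by simp only [gammaGen, sym3_swap₁₂ _ μ ν ρ]
      h₂₃ := fun m a μ ν ρ => by simp only [gammaGen, sym3_swap₂₃ _ μ ν ρ]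
      hs₁₂ := fun _ _ _ _ _ => rfl
      hs₂₃ := fun _ _ _ _ _ => rfl
      C₁₂ := fun _ _ _ _ => rfl
      Cs₁₂ := fun _ _ _ _ => rfl
      C_trace := fun _ _ => by simp [gammaGen]
      Cs_trace := fun _ _ => by simp [gammaGen] }
    (by
      rintro ⟨m, f⟩
      cases f with
      | h a μ ν ρ =>
        exact Submodule.smul_mem _ _ (sym3_mem _ (fun μ ν ρ =>
          gen_mem_parityPart (μ ::ₘ m, Var.C a ν ρ)) _ _ _)
      | C => exact Submodule.zero_mem _
      | hs => exact Submodule.zero_mem _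
      | Cs => exact Submodule.zero_mem _)

/-- Values of the Koszul–Tate differential on generators: `δ h^*_{μνρ} = G_{μνρ}`,
`δ C^*_{μν} = -3 (∂^ρ h^*_{μνρ} - (1/5) η_{μν} ∂^ρ h^*_ρ)`, zero on `h`, `C`. -/
def deltaGen : Jet N → BRST N
  | (_, .h _ _ _ _) => 0
  | (_, .C _ _ _) => 0
  | (m, .hs a μ ν ρ) => eom m a μ ν ρ
  | (m, .Cs a μ ν) => (-3 : ℝ) • (∑ ρ, sgn ρ • hsJet (ρ ::ₘ m) a μ ν ρ
      - ((1 / 5 : ℝ) * eta μ ν) • ∑ ρ, sgn ρ • ∑ α, sgn α • hsJet (ρ ::ₘ m) a ρ α α)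

theorem deltaGen_trace (m : Multiset (Fin 5)) (a : Fin N) :
    ∑ μ, sgn μ • deltaGen (m, .Cs a μ μ) = 0 := by
  have h1 : ∑ μ, sgn μ • ∑ ρ, sgn ρ • hsJet (ρ ::ₘ m) a μ μ ρ =
      ∑ ρ, sgn ρ • ∑ α, sgn α • hsJet (ρ ::ₘ m) a ρ α α := by
    simp only [Finset.smul_sum]
    rw [Finset.sum_comm]
    refine Finset.sum_congr rfl fun ρ _ => Finset.sum_congr rfl fun μ _ => ?_
    rw [smul_comm, hsJet, hsJet, gen_respects.hs₂₃, gen_respects.hs₁₂]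
  have h2 : ∑ μ, sgn μ * ((1 / 5 : ℝ) * eta μ μ) = 1 := by
    simp [Fin.sum_univ_succ, sgn, eta]; norm_num
  simp only [deltaGen, smul_comm (sgn _) (-3 : ℝ), ← Finset.smul_sum, smul_sub,
    Finset.sum_sub_distrib]
  rw [h1]
  simp only [smul_smul (sgn _) ((1 / 5 : ℝ) * eta _ _)]
  rw [← Finset.sum_smul, h2, one_smul, sub_self]

/-- The Koszul–Tate differential `δ`. -/
def delta : BRST N →ₗ[ℝ] BRST N :=
  gradedDer true deltaGen
    { h₁₂ := fun _ _ _ _ _ => rfl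
      h₂₃ := fun _ _ _ _ _ => rfl
      hs₁₂ := fun m a μ ν ρ => eom_swap₁₂ m a μ ν ρ
      hs₂₃ := fun m a μ ν ρ => eom_swap₂₃ m a μ ν ρ
      C₁₂ := fun _ _ _ _ => rfl
      Cs₁₂ := fun m a μ ν => by
        have h : eta μ ν = eta ν μ := by
          by_cases hμ : μ = ν
          · rw [hμ]
          · simp [eta, hμ, Ne.symm hμ]
        simp only [deltaGen, hsJet, h, fun m ρ => gen_respects.hs₁₂ m a μ ν ρ]
      C_trace := fun _ _ => by simp [deltaGen]
      Cs_trace := deltaGen_trace }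
    (by
      rintro ⟨m, f⟩
      cases f with
      | h => exact Submodule.zero_mem _
      | C => exact Submodule.zero_mem _
      | hs a μ ν ρ => exact eom_mem m a μ ν ρ
      | Cs a μ ν =>
        have hh : ∀ m μ ν ρ, hsJet m a μ ν ρ ∈ parityPart N true := fun m μ ν ρ =>
          gen_mem_parityPart (m, Var.hs a μ ν ρ)
        exact Submodule.smul_mem _ _ (sub_mem
          (sum_mem fun ρ _ => Submodule.smul_mem _ _ (hh _ _ _ _))
          (Submodule.smul_mem _ _ (sum_mem fun ρ _ => Submodule.smul_mem _ _
            (sum_mem fun α _ => Submodule.smul_mem _ _ (hh _ _ _ _))))))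

/-- `x d^5x` is `d`-exact: `x = ∂_μ j^μ` for some local current `j`. -/
def IsTotalDiv (x : BRST N) : Prop :=
  ∃ j : Fin 5 → BRST N, x = ∑ μ, totalDeriv μ (j μ)

/-! # Local functions of the fields, Lorentz invariance and parity -/

/-- Local functions of the fields `h` alone (no ghosts, no antifields). -/
def localFunctions (N : ℕ) : Subalgebra ℝ (BRST N) :=
  Algebra.adjoin ℝ {x | ∃ m a μ ν ρ, x = hJet m a μ ν ρ}

/-- Local functions of fields and ghosts (no antifields). -/
def ghostFunctions (N : ℕ) : Subalgebra ℝ (BRST N) :=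
  Algebra.adjoin ℝ ({x | ∃ m a μ ν ρ, x = hJet m a μ ν ρ} ∪ {x | ∃ m a μ ν, x = CJet m a μ ν})

/-- Local functions that are cubic in `h` and contain four derivatives. -/
def cubicFour (N : ℕ) : Submodule ℝ (BRST N) :=
  Submodule.span ℝ {x | ∃ (m₁ m₂ m₃ : Multiset (Fin 5)) (a b c : Fin N)
    (μ ν ρ μ' ν' ρ' μ'' ν'' ρ'' : Fin 5), m₁.card + m₂.card + m₃.card = 4 ∧
    x = hJet m₁ a μ ν ρ * hJet m₂ b μ' ν' ρ' * hJet m₃ c μ'' ν'' ρ''}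

/-- `w μ ν` are the components `w_μ^ν` of an infinitesimal Lorentz transformation. -/
def IsLorentz (w : Fin 5 → Fin 5 → ℝ) : Prop := ∀ μ ν, w μ ν * sgn ν = -(w ν μ * sgn μ)

/-- Action of `w` on the tensor indices of a jet. -/
def rotIndex (w : Fin 5 → Fin 5 → ℝ) (m : Multiset (Fin 5)) : Var N → BRST N
  | .h a μ ν ρ => ∑ κ, (w μ κ • hJet m a κ ν ρ + w ν κ • hJet m a μ κ ρ + w ρ κ • hJet m a μ ν κ)
  | .C a μ ν => ∑ κ, (w μ κ • CJet m a κ ν + w ν κ • CJet m a μ κ)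
  | .hs a μ ν ρ =>
      ∑ κ, (w μ κ • hsJet m a κ ν ρ + w ν κ • hsJet m a μ κ ρ + w ρ κ • hsJet m a μ ν κ)
  | .Cs a μ ν => ∑ κ, (w μ κ • CsJet m a κ ν + w ν κ • CsJet m a μ κ)

/-- Action of `w` on the derivative indices of a jet (`m.count μ` is the number of `μ`'s). -/
def rotDeriv (w : Fin 5 → Fin 5 → ℝ) (x : Jet N) : BRST N :=
  ∑ μ, ∑ κ, ((x.1.count μ : ℝ) * w μ κ) • gen (κ ::ₘ x.1.erase μ, x.2)

theorem rotDeriv_respects (w : Fin 5 → Fin 5 → ℝ) : Respects (rotDeriv w : Jet N → BRST N) where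
  h₁₂ m a μ ν ρ := by simp only [rotDeriv, fun m => gen_respects.h₁₂ m a μ ν ρ]
  h₂₃ m a μ ν ρ := by simp only [rotDeriv, fun m => gen_respects.h₂₃ m a μ ν ρ]
  hs₁₂ m a μ ν ρ := by simp only [rotDeriv, fun m => gen_respects.hs₁₂ m a μ ν ρ]
  hs₂₃ m a μ ν ρ := by simp only [rotDeriv, fun m => gen_respects.hs₂₃ m a μ ν ρ]
  C₁₂ m a μ ν := by simp only [rotDeriv, fun m => gen_respects.C₁₂ m a μ ν]
  Cs₁₂ m a μ ν := by simp only [rotDeriv, fun m => gen_respects.Cs₁₂ m a μ ν]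
  C_trace m a := by
    simp only [rotDeriv, Finset.smul_sum]
    rw [Finset.sum_comm]
    refine Finset.sum_eq_zero fun μ _ => ?_
    rw [Finset.sum_comm]
    refine Finset.sum_eq_zero fun κ _ => ?_
    simp only [smul_comm (sgn _) (_ * _ : ℝ)]
    rw [← Finset.smul_sum, gen_respects.C_trace, smul_zero]
  Cs_trace m a := by
    simp only [rotDeriv, Finset.smul_sum]
    rw [Finset.sum_comm]
    refine Finset.sum_eq_zero fun μ _ => ?_
    rw [Finset.sum_comm]
    refine Finset.sum_eq_zero fun κ _ => ?_
    simp only [smul_comm (sgn _) (_ * _ : ℝ)]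
    rw [← Finset.smul_sum, gen_respects.Cs_trace, smul_zero]

theorem rot_trace {w : Fin 5 → Fin 5 → ℝ} (hw : IsLorentz w) (X : Fin 5 → Fin 5 → BRST N)
    (hX : ∀ μ ν, X μ ν = X ν μ) :
    ∑ μ, sgn μ • ∑ κ, (w μ κ • X κ μ + w μ κ • X μ κ) = 0 := by
  have hs : ∀ μ, sgn μ * sgn μ = 1 := fun μ => by by_cases h : μ = 0 <;> simp [sgn, h]
  have hA : ∀ μ κ, sgn μ * w μ κ = -(sgn κ * w κ μ) := fun μ κ => by
    have h := congrArg (fun x => sgn μ * sgn κ * x) (hw μ κ)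
    have h1 := hs μ
    have h2 := hs κ
    linear_combination h - sgn μ * w μ κ * h2 - sgn κ * w κ μ * h1
  have hS : ∑ μ, ∑ κ, (sgn μ * w μ κ) • X μ κ = -∑ μ, ∑ κ, (sgn μ * w μ κ) • X μ κ := by
    conv_lhs => rw [Finset.sum_comm]
    rw [← Finset.sum_neg_distrib]
    refine Finset.sum_congr rfl fun μ _ => ?_
    rw [← Finset.sum_neg_distrib]
    refine Finset.sum_congr rfl fun κ _ => ?_
    rw [hA κ μ, neg_smul, hX]
  have h0 : (2 : ℝ) • ∑ μ, ∑ κ, (sgn μ * w μ κ) • X μ κ = 0 := by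
    rw [two_smul]
    nth_rewrite 1 [hS]
    exact neg_add_cancel _
  calc ∑ μ, sgn μ • ∑ κ, (w μ κ • X κ μ + w μ κ • X μ κ)
      = (2 : ℝ) • ∑ μ, ∑ κ, (sgn μ * w μ κ) • X μ κ := by
        simp only [Finset.smul_sum]
        refine Finset.sum_congr rfl fun μ _ => Finset.sum_congr rfl fun κ _ => ?_
        rw [hX κ μ, ← two_smul ℝ, smul_smul, smul_smul, smul_smul]
        congr 1; ring
    _ = 0 := h0

theorem rotIndex_respects (w : Fin 5 → Fin 5 → ℝ) (hw : IsLorentz w) :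
    Respects (fun x : Jet N => rotIndex w x.1 x.2) where
  h₁₂ m a μ ν ρ := by
    refine Finset.sum_congr rfl fun κ _ => ?_
    rw [hJet, hJet, hJet, gen_respects.h₁₂ m a κ ν ρ, gen_respects.h₁₂ m a μ κ ρ,
      gen_respects.h₁₂ m a μ ν κ, ← hJet, ← hJet, ← hJet]
    abel
  h₂₃ m a μ ν ρ := by
    refine Finset.sum_congr rfl fun κ _ => ?_
    rw [hJet, hJet, hJet, gen_respects.h₂₃ m a κ ν ρ, gen_respects.h₂₃ m a μ κ ρ,
      gen_respects.h₂₃ m a μ ν κ, ← hJet, ← hJet, ← hJet]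
    abel
  hs₁₂ m a μ ν ρ := by
    refine Finset.sum_congr rfl fun κ _ => ?_
    rw [hsJet, hsJet, hsJet, gen_respects.hs₁₂ m a κ ν ρ, gen_respects.hs₁₂ m a μ κ ρ,
      gen_respects.hs₁₂ m a μ ν κ, ← hsJet, ← hsJet, ← hsJet]
    abel
  hs₂₃ m a μ ν ρ := by
    refine Finset.sum_congr rfl fun κ _ => ?_
    rw [hsJet, hsJet, hsJet, gen_respects.hs₂₃ m a κ ν ρ, gen_respects.hs₂₃ m a μ κ ρ,
      gen_respects.hs₂₃ m a μ ν κ, ← hsJet, ← hsJet, ← hsJet]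
    abel
  C₁₂ m a μ ν := by
    refine Finset.sum_congr rfl fun κ _ => ?_
    rw [CJet, CJet, gen_respects.C₁₂ m a κ ν, gen_respects.C₁₂ m a μ κ, ← CJet, ← CJet]
    abel
  Cs₁₂ m a μ ν := by
    refine Finset.sum_congr rfl fun κ _ => ?_
    rw [CsJet, CsJet, gen_respects.Cs₁₂ m a κ ν, gen_respects.Cs₁₂ m a μ κ, ← CsJet, ← CsJet]
    abel
  C_trace m a := rot_trace hw (CJet m a) (gen_respects.C₁₂ m a)
  Cs_trace m a := rot_trace hw (CsJet m a) (gen_respects.Cs₁₂ m a)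

theorem rotIndex_mem (w : Fin 5 → Fin 5 → ℝ) (m : Multiset (Fin 5)) (f : Var N) :
    rotIndex w m f ∈ parityPart N f.odd := by
  cases f with
  | h a μ ν ρ =>
    exact sum_mem fun κ _ => add_mem (add_mem
      (Submodule.smul_mem _ _ (gen_mem_parityPart (m, Var.h a κ ν ρ)))
      (Submodule.smul_mem _ _ (gen_mem_parityPart (m, Var.h a μ κ ρ))))
      (Submodule.smul_mem _ _ (gen_mem_parityPart (m, Var.h a μ ν κ)))
  | C a μ ν =>
    exact sum_mem fun κ _ => add_mem
      (Submodule.smul_mem _ _ (gen_mem_parityPart (m, Var.C a κ ν)))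
      (Submodule.smul_mem _ _ (gen_mem_parityPart (m, Var.C a μ κ)))
  | hs a μ ν ρ =>
    exact sum_mem fun κ _ => add_mem (add_mem
      (Submodule.smul_mem _ _ (gen_mem_parityPart (m, Var.hs a κ ν ρ)))
      (Submodule.smul_mem _ _ (gen_mem_parityPart (m, Var.hs a μ κ ρ))))
      (Submodule.smul_mem _ _ (gen_mem_parityPart (m, Var.hs a μ ν κ)))
  | Cs a μ ν =>
    exact sum_mem fun κ _ => add_mem
      (Submodule.smul_mem _ _ (gen_mem_parityPart (m, Var.Cs a κ ν)))
      (Submodule.smul_mem _ _ (gen_mem_parityPart (m, Var.Cs a μ κ)))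

theorem rotDeriv_mem (w : Fin 5 → Fin 5 → ℝ) (x : Jet N) :
    rotDeriv w x ∈ parityPart N x.2.odd :=
  sum_mem fun μ _ => sum_mem fun κ _ =>
    Submodule.smul_mem _ _ (gen_mem_parityPart (κ ::ₘ x.1.erase μ, x.2))

/-- The infinitesimal Lorentz transformation `w`, acting as a derivation on local functions. -/
def lorentz (w : Fin 5 → Fin 5 → ℝ) (hw : IsLorentz w) : BRST N →ₗ[ℝ] BRST N :=
  gradedDer false (fun x => rotDeriv w x + rotIndex w x.1 x.2)
    ((rotDeriv_respects w).add (rotIndex_respects w hw))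
    (fun x => by simpa using add_mem (rotDeriv_mem w x) (rotIndex_mem w x.1 x.2))

/-- Number of tensor indices equal to `1`. -/
def Var.ones : Var N → ℕ
  | .h _ μ ν ρ => [μ, ν, ρ].count 1
  | .C _ μ ν => [μ, ν].count 1
  | .hs _ μ ν ρ => [μ, ν, ρ].count 1
  | .Cs _ μ ν => [μ, ν].count 1

/-- The space reflection `x^1 ↦ -x^1`: each index equal to `1` gives a factor `-1`. -/
def reflection : BRST N →ₐ[ℝ] BRST N :=
  liftHom (fun x => ((-1 : ℝ) ^ (x.1.count 1 + x.2.ones)) • gen x)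
    { h₁₂ := fun m a μ ν ρ => by
        simp only [Var.ones, gen_respects.h₁₂ m a μ ν ρ, (List.Perm.swap ν μ [ρ]).count_eq]
      h₂₃ := fun m a μ ν ρ => by
        simp only [Var.ones, gen_respects.h₂₃ m a μ ν ρ,
          ((List.Perm.swap ρ ν []).cons μ).count_eq]
      hs₁₂ := fun m a μ ν ρ => by
        simp only [Var.ones, gen_respects.hs₁₂ m a μ ν ρ, (List.Perm.swap ν μ [ρ]).count_eq]
      hs₂₃ := fun m a μ ν ρ => by
        simp only [Var.ones, gen_respects.hs₂₃ m a μ ν ρ,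
          ((List.Perm.swap ρ ν []).cons μ).count_eq]
      C₁₂ := fun m a μ ν => by
        simp only [Var.ones, gen_respects.C₁₂ m a μ ν, (List.Perm.swap ν μ []).count_eq]
      Cs₁₂ := fun m a μ ν => by
        simp only [Var.ones, gen_respects.Cs₁₂ m a μ ν, (List.Perm.swap ν μ []).count_eq]
      C_trace := fun m a => by
        have h : ∀ μ : Fin 5, (-1 : ℝ) ^ (m.count 1 + (Var.C a μ μ).ones) = (-1) ^ m.count 1 :=
          fun μ => by by_cases h : μ = 1 <;> simp [Var.ones, h, pow_add]
        simp only [h, smul_comm (sgn _) ((-1 : ℝ) ^ _), ← Finset.smul_sum,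
          gen_respects.C_trace m a, smul_zero]
      Cs_trace := fun m a => by
        have h : ∀ μ : Fin 5, (-1 : ℝ) ^ (m.count 1 + (Var.Cs a μ μ).ones) = (-1) ^ m.count 1 :=
          fun μ => by by_cases h : μ = 1 <;> simp [Var.ones, h, pow_add]
        simp only [h, smul_comm (sgn _) ((-1 : ℝ) ^ _), ← Finset.smul_sum,
          gen_respects.Cs_trace m a, smul_zero] }
    (fun x y => by
      simp only [smul_mul_smul_comm]
      rw [gen_comm x y, smul_smul, smul_smul]
      congr 1; ring)

/-- Local functions of `h` that are Poincaré invariant (no explicit coordinate dependence, and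
annihilated by all infinitesimal Lorentz transformations) and odd under space reflection. -/
def IsPoincareInvariantParityOdd (x : BRST N) : Prop :=
  (∀ w (hw : IsLorentz w), lorentz w hw x = 0) ∧ reflection x = -x

/-! # The deformation in five dimensions -/

/-- The second de Wit–Freedman connection
`Γ_{λσ;ταβ} = 3 ∂_{(τ}∂_α h_{β)λσ} + ∂_λ∂_σ h_{ταβ}
  - (3/2) (∂_λ ∂_{(τ} h_{αβ)σ} + ∂_σ ∂_{(τ} h_{αβ)λ})`. -/
def conn (c : Fin N) (l σ τ α β : Fin 5) : BRST N :=
  (3 : ℝ) • sym3 (fun τ α β => hJet {τ, α} c β l σ) τ α β + hJet {l, σ} c τ α β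
    - (3 / 2 : ℝ) • (sym3 (fun τ α β => hJet {l, τ} c α β σ) τ α β
        + sym3 (fun τ α β => hJet {σ, τ} c α β l) τ α β)

/-- `∂_m ∂_{[ν} C_{ρ]β}` -/
def curlC (m : Multiset (Fin 5)) (b : Fin N) (ν ρ β : Fin 5) : BRST N :=
  (1 / 2 : ℝ) • (CJet (ν ::ₘ m) b ρ β - CJet (ρ ::ₘ m) b ν β)

/-- `a_2 = g^a_{bc} ε^{μνρστ} C^{*α}_{a μ} ∂_{[ν} C_{ρ]}^{b β} ∂_{α[σ} C^c_{τ]β}` -/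
def a2 (g : Fin N → Fin N → Fin N → ℝ) : BRST N :=
  ∑ a, ∑ b, ∑ c, g a b c • ∑ μ, ∑ ν, ∑ ρ, ∑ σ, ∑ τ, eps μ ν ρ σ τ •
    ∑ α, ∑ β, (sgn α * sgn β) • (CsJet 0 a α μ * curlC 0 b ν ρ β * curlC {α} c σ τ β)

/-- `a_1 = g^a_{bc} ε^{μνρστ} h^{*αβ}_{a μ} ∂_{[ν} C_{ρ]}^{b λ} Γ^c_{λ[σ;τ]αβ}` -/
def a1 (g : Fin N → Fin N → Fin N → ℝ) : BRST N :=
  ∑ a, ∑ b, ∑ c, g a b c • ∑ μ, ∑ ν, ∑ ρ, ∑ σ, ∑ τ, eps μ ν ρ σ τ •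
    ∑ α, ∑ β, ∑ l, (sgn α * sgn β * sgn l) • (hsJet 0 a α β μ * curlC 0 b ν ρ l *
      ((1 / 2 : ℝ) • (conn c l σ τ α β - conn c l τ σ α β)))

/-- The antifield-number-one part `3 h^{*μνρ}_a ∂_μ C^a_{νρ}` of the free functional `W_0`. -/
def w1 (N : ℕ) : BRST N :=
  ∑ a, ∑ μ, ∑ ν, ∑ ρ, (3 * (sgn μ * sgn ν * sgn ρ)) • (hsJet 0 a μ ν ρ * CJet {μ} a ν ρ)

/-- The antifield-number-one term `x` is `h^{*μνρ}_a R^a_{μνρ}` up to a total divergence, with `R`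
completely symmetric and free of antifields; then `δ h^a_{μνρ} = R^a_{μνρ}`, with the ghosts
replaced by gauge parameters, is the gauge transformation that `x` generates. -/
def GeneratesGauge (x : BRST N) (R : Fin N → Fin 5 → Fin 5 → Fin 5 → BRST N) : Prop :=
  (∀ a μ ν ρ, R a μ ν ρ ∈ ghostFunctions N) ∧
  (∀ a μ ν ρ, R a μ ν ρ = R a ν μ ρ ∧ R a μ ν ρ = R a μ ρ ν) ∧
  IsTotalDiv (x - ∑ a, ∑ μ, ∑ ν, ∑ ρ, (sgn μ * sgn ν * sgn ρ) • (hsJet 0 a μ ν ρ * R a μ ν ρ))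

/-- `g^a_{bc} ε_μ^{νρστ} Γ^b_{γν;ραβ} ∂_σ C^{c γ}_τ`, not yet symmetrized over `(μαβ)`. -/
def gaugeTerm (g : Fin N → Fin N → Fin N → ℝ) (a : Fin N) (μ α β : Fin 5) : BRST N :=
  ∑ b, ∑ c, g a b c • ∑ ν, ∑ ρ, ∑ σ, ∑ τ, (sgn μ * eps μ ν ρ σ τ) •
    ∑ γ, sgn γ • (conn b γ ν ρ α β * CJet {σ} c τ γ)

/-- The first-order deformed gauge transformation
`3 ∂_{(μ} C_{αβ)} + κ g^a_{bc} ε_{(μ|}^{νρστ} Γ^b_{γν;ρ|αβ)} ∂_σ C^{c γ}_τ`, where `κ` is the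
coupling constant. -/
def gaugeTransf (g : Fin N → Fin N → Fin N → ℝ) (κ : ℝ) (a : Fin N) (μ α β : Fin 5) : BRST N :=
  (3 : ℝ) • sym3 (fun μ α β => CJet {μ} a α β) μ α β + κ • sym3 (gaugeTerm g a) μ α β

/-- `∂_m □ h_{μνρ}` -/
def boxH (m : Multiset (Fin 5)) (a : Fin N) (μ ν ρ : Fin 5) : BRST N :=
  ∑ κ, sgn κ • hJet (κ ::ₘ κ ::ₘ m) a μ ν ρ

/-- `∂_m □ h_μ` -/
def boxTr (m : Multiset (Fin 5)) (a : Fin N) (μ : Fin 5) : BRST N :=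
  ∑ κ, sgn κ • hTr (κ ::ₘ κ ::ₘ m) a μ

/-- The integrand of the cubic vertex for fixed values of the indices contracted with `ε`. -/
def vertexTerm (a b c : Fin N) (μ ν ρ σ τ : Fin 5) : BRST N :=
  -(1 / 8 : ℝ) • (boxTr {μ} a ν * hTr {ρ} b σ * hTr 0 c τ)
  + (1 / 2 : ℝ) • ∑ α, ∑ β, (sgn α * sgn β) •
      (hTr {μ, α, β} a ν * hJet {ρ} b σ α β * hTr 0 c τ)
  + (1 / 4 : ℝ) • ∑ α, ∑ β, (sgn α * sgn β) •
      (boxH {μ} a ν α β * hJet {ρ} b σ α β * hTr 0 c τ)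
  + (3 / 8 : ℝ) • ∑ α, ∑ β, (sgn α * sgn β) •
      (boxTr {μ} a ν * hJet {ρ} b σ α β * hJet 0 c τ α β)
  - (1 / 2 : ℝ) • ∑ α, ∑ β, ∑ γ, (sgn α * sgn β * sgn γ) •
      (boxH {μ} a ν α β * hJet {ρ} b σ α γ * hJet 0 c τ β γ)
  - (1 / 2 : ℝ) • ∑ α, ∑ β, ∑ γ, (sgn α * sgn β * sgn γ) •
      (hTr {μ, α, β} a ν * hJet {ρ} b σ α γ * hJet 0 c τ β γ)
  - (1 / 2 : ℝ) • ∑ α, ∑ β, ∑ γ, (sgn α * sgn β * sgn γ) •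
      (hJet {μ, α, β} a ν α γ * hTr {ρ} b σ * hJet 0 c τ β γ)
  - (1 / 4 : ℝ) • ∑ α, ∑ β, ∑ γ, ∑ δ, (sgn α * sgn β * sgn γ * sgn δ) •
      (hJet {μ, α, β} a ν α β * hJet {ρ} b σ γ δ * hJet 0 c τ γ δ)
  - (1 / 2 : ℝ) • ∑ α, ∑ β, ∑ γ, ∑ δ, (sgn α * sgn β * sgn γ * sgn δ) •
      (hJet {μ, α, β} a ν γ δ * hJet {ρ} b σ α β * hJet 0 c τ γ δ)
  + ∑ α, ∑ β, ∑ γ, ∑ δ, (sgn α * sgn β * sgn γ * sgn δ) •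
      (hJet {μ, α, β} a ν β γ * hJet {ρ} b σ γ δ * hJet 0 c τ α δ)
  + (1 / 2 : ℝ) • ∑ α, ∑ β, ∑ γ, (sgn α * sgn β * sgn γ) •
      (hJet {μ, α} a ν α β * hTr {ρ, γ} b σ * hJet 0 c τ β γ)
  - ∑ α, ∑ β, ∑ γ, ∑ δ, (sgn α * sgn β * sgn γ * sgn δ) •
      (hJet {μ, α} a ν β γ * hJet {ρ, δ} b σ α β * hJet 0 c τ γ δ)

/-- The cubic vertex `a_0`. -/
def a0 (g : Fin N → Fin N → Fin N → ℝ) : BRST N :=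
  (3 / 2 : ℝ) • ∑ a, ∑ b, ∑ c, g a b c • ∑ μ, ∑ ν, ∑ ρ, ∑ σ, ∑ τ,
    eps μ ν ρ σ τ • vertexTerm a b c μ ν ρ σ τ

/-! # The internal algebra -/

/-- `g_{abc} = δ_{ad} g^d_{bc}` is totally symmetric. -/
def TotallySymmetric (g : Fin N → Fin N → Fin N → ℝ) : Prop :=
  ∀ a b c, g a b c = g b a c ∧ g a b c = g a c b

/-- The product `(x · y)^a = g^a_{bc} x^b y^c` of the internal algebra `ℬ` on `ℝ^N`. -/
def algMul (g : Fin N → Fin N → Fin N → ℝ) (x y : Fin N → ℝ) : Fin N → ℝ :=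
  fun a => ∑ b, ∑ c, g a b c * x b * y c

/-- The internal metric `δ_{ab}` is invariant for the algebra `ℬ`:
`⟨x · y, z⟩ = ⟨x, y · z⟩`. -/
def HasInvariantNorm (g : Fin N → Fin N → Fin N → ℝ) : Prop :=
  ∀ x y z : Fin N → ℝ, algMul g x y ⬝ᵥ z = x ⬝ᵥ algMul g y z

end Spin3

end

set_option linter.unusedSimpArgs false

set_option linter.unusedSectionVars false

open scoped BigOperators

noncomputable section

namespace Spin3

variable {N : ℕ}

/-! Trilinear local functions are studied through their symbols. A jet `∂_m h_{μνρ}` becomes the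
monomial `p_m a_μ a_ν a_ρ` in a momentum `p` and a polarization `a`, and a product of three jets
becomes an element of the tensor cube `Poly₃`, which `quantize` turns back into a local function. A
total derivative is multiplication by the total momentum (`totalDeriv_quantize`), so symbols in the
ideal `momIdeal` quantize to divergences. On fields `γ` is the derivation `a ↦ p` (`gamma_hMap`),
and `δ h^*` is multiplication by the symbol of the field equations. Consistency conditions become
polynomial identities between scalar products `dot` and determinants `eps5` of the vectors `p, a, q,
b, r, c`, subject to `p + q + r = 0`.

Lift of `a_2`: modulo momentum conservation, the symbol of `γ a_1 + δ a_2` is `3 (a·q)(a·r)(b·c)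
ε(a,q,b,r,c)`. This is symmetric under exchange of the two ghosts, which anticommute, while
`g^a_{bc}` is symmetric; the sum is therefore a divergence (`lift_identity`, `lift_mem_totalDivs`).

Sufficiency: in five dimensions, five independent vectors remain after momentum conservation, so
every term of `γ a_0 + δ a_1` is a scalar times one determinant `ε(p,a,q,b,c)`. Contraction with `ε`
removes most of `δ a_1` (`sourceSymbol_eq`). The remaining scalars cancel once the symbol is
symmetrized in the two fields that accompany the ghost (`variationSymbol_symm`). Total symmetry of
`g` is used twice: to rename internal labels so that the ghost always carries the first one, and to
justify that symmetrization.

Necessity does not classify vertices. If the ghost is a Killing tensor, then `γ x` vanishes for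
every function `x` of the fields, so the integral of `δ a_1` must vanish by itself. With the ghost
carrying label `b` and plane waves carrying labels `a` and `c`, that integral is `24 (g_{abc} -
g_{cba})`. Together with `g_{abc} = g_{acb}` this forces total symmetry. The test is made algebraic
in a tower of dual numbers (`TestRing`): a Killing tensor polynomial in the coordinates becomes an
exponential with nilpotent momentum, derivatives become derivations `E κ`, and integration becomes
extraction of the top coefficient, which annihilates the image of every `E κ`.

Lorentz invariance and parity of the vertex follow from the invariance of `dot` and from `eps5`
being a determinant; the number of derivatives is the degree of the symbol in the momenta. -/

theorem totalDeriv_gen (κ : Fin 5) (x : Jet N) :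
    totalDeriv κ (gen x) = gen (κ ::ₘ x.1, x.2) := gradedDer_gen _ _ _ _ _

theorem totalDeriv_mul (κ : Fin 5) (u v : BRST N) :
    totalDeriv κ (u * v) = totalDeriv κ u * v + u * totalDeriv κ v := by
  exact gradedDer_mul (N := N) false _ _ _ u v

theorem gamma_mul (u v : BRST N) : gamma (u * v) = gamma u * v + parityInv u * gamma v := by
  exact gradedDer_mul (N := N) true _ _ _ u v

theorem delta_mul (u v : BRST N) : delta (u * v) = delta u * v + parityInv u * delta v := by
  exact gradedDer_mul (N := N) true _ _ _ u v

theorem lorentz_mul (w : Fin 5 → Fin 5 → ℝ) (hw : IsLorentz w) (u v : BRST N) :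
    lorentz w hw (u * v) = lorentz w hw u * v + u * lorentz w hw v := by
  exact gradedDer_mul (N := N) false _ _ _ u v

/-! ### Values of the differentials and of the parity involution on jets -/

@[simp] theorem gamma_hJet (m : Multiset (Fin 5)) (a : Fin N) (μ ν ρ : Fin 5) :
    gamma (hJet m a μ ν ρ) = (3 : ℝ) • sym3 (fun μ ν ρ => CJet (μ ::ₘ m) a ν ρ) μ ν ρ :=
  gradedDer_gen _ _ _ _ _

@[simp] theorem gamma_CJet (m : Multiset (Fin 5)) (a : Fin N) (μ ν : Fin 5) :
    gamma (CJet m a μ ν) = 0 := gradedDer_gen _ _ _ _ _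

@[simp] theorem gamma_hsJet (m : Multiset (Fin 5)) (a : Fin N) (μ ν ρ : Fin 5) :
    gamma (hsJet m a μ ν ρ) = 0 := gradedDer_gen _ _ _ _ _

@[simp] theorem gamma_CsJet (m : Multiset (Fin 5)) (a : Fin N) (μ ν : Fin 5) :
    gamma (CsJet m a μ ν) = 0 := gradedDer_gen _ _ _ _ _

@[simp] theorem delta_hJet (m : Multiset (Fin 5)) (a : Fin N) (μ ν ρ : Fin 5) :
    delta (hJet m a μ ν ρ) = 0 := gradedDer_gen _ _ _ _ _

@[simp] theorem delta_CJet (m : Multiset (Fin 5)) (a : Fin N) (μ ν : Fin 5) :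
    delta (CJet m a μ ν) = 0 := gradedDer_gen _ _ _ _ _

@[simp] theorem delta_hsJet (m : Multiset (Fin 5)) (a : Fin N) (μ ν ρ : Fin 5) :
    delta (hsJet m a μ ν ρ) = eom m a μ ν ρ := gradedDer_gen _ _ _ _ _

@[simp] theorem delta_CsJet (m : Multiset (Fin 5)) (a : Fin N) (μ ν : Fin 5) :
    delta (CsJet m a μ ν) = deltaGen (m, .Cs a μ ν) := gradedDer_gen _ _ _ _ _

@[simp] theorem parityInv_hJet (m : Multiset (Fin 5)) (a : Fin N) (μ ν ρ : Fin 5) :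
    parityInv (hJet m a μ ν ρ) = hJet m a μ ν ρ := by simp [hJet, Var.odd, koszul]

@[simp] theorem parityInv_CJet (m : Multiset (Fin 5)) (a : Fin N) (μ ν : Fin 5) :
    parityInv (CJet m a μ ν) = -CJet m a μ ν := by simp [CJet, Var.odd, koszul]

@[simp] theorem parityInv_hsJet (m : Multiset (Fin 5)) (a : Fin N) (μ ν ρ : Fin 5) :
    parityInv (hsJet m a μ ν ρ) = -hsJet m a μ ν ρ := by simp [hsJet, Var.odd, koszul]

@[simp] theorem parityInv_CsJet (m : Multiset (Fin 5)) (a : Fin N) (μ ν : Fin 5) :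
    parityInv (CsJet m a μ ν) = CsJet m a μ ν := by simp [CsJet, Var.odd, koszul]

theorem map_sym3 {M M' : Type*} [AddCommGroup M] [Module ℝ M] [AddCommGroup M'] [Module ℝ M']
    (L : M →ₗ[ℝ] M') (T : Fin 5 → Fin 5 → Fin 5 → M) (μ ν ρ : Fin 5) :
    L (sym3 T μ ν ρ) = sym3 (fun μ ν ρ => L (T μ ν ρ)) μ ν ρ := by
  simp only [sym3, map_smul, map_add]

@[simp] theorem delta_curlC (m : Multiset (Fin 5)) (b : Fin N) (ν ρ β : Fin 5) :
    delta (curlC m b ν ρ β) = 0 := by simp [curlC]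

@[simp] theorem gamma_curlC (m : Multiset (Fin 5)) (b : Fin N) (ν ρ β : Fin 5) :
    gamma (curlC m b ν ρ β) = 0 := by simp [curlC]

@[simp] theorem delta_conn (c : Fin N) (l σ τ α β : Fin 5) : delta (conn c l σ τ α β) = 0 := by
  simp [conn, sym3]

@[simp] theorem parityInv_curlC (m : Multiset (Fin 5)) (b : Fin N) (ν ρ β : Fin 5) :
    parityInv (curlC m b ν ρ β) = -curlC m b ν ρ β := by
  simp only [curlC, map_smul, map_sub, parityInv_CJet]; module

theorem CJet_swap (m : Multiset (Fin 5)) (a : Fin N) (μ ν : Fin 5) :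
    CJet m a μ ν = CJet m a ν μ := gen_respects.C₁₂ m a μ ν

theorem gamma_a2 (g : Fin N → Fin N → Fin N → ℝ) : gamma (a2 g) = 0 := by
  simp [a2, gamma_mul]

theorem gen_commute_of_even (x y : Jet N) (h : (x.2.odd && y.2.odd) = false) :
    gen x * gen y = gen y * gen x := by
  rw [gen_comm, h]; simp [koszul]

/-- On basis vectors, invariance of the metric reads `g_{abc} = g_{bca}`. Cyclic symmetry and
symmetry in the last two indices together generate all permutations. -/
theorem totallySymmetric_iff_invariant (g : Fin N → Fin N → Fin N → ℝ)
    (hg : ∀ a b c, g a b c = g a c b) : TotallySymmetric g ↔ HasInvariantNorm g := by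
  constructor
  · intro h x y z
    have e : ∀ a b c, g a b c = g b c a := fun a b c => by rw [(h a b c).1, hg b a c]
    simp only [algMul, dotProduct, Finset.mul_sum, Finset.sum_mul]
    rw [Finset.sum_comm]
    refine Finset.sum_congr rfl fun b _ => ?_
    rw [Finset.sum_comm]
    refine Finset.sum_congr rfl fun c _ => Finset.sum_congr rfl fun a _ => ?_
    rw [e a b c]; ring
  · intro h
    have key : ∀ a b c, g a b c = g b c a := by
      intro a b c
      have := h (Pi.single b 1) (Pi.single c 1) (Pi.single a 1)
      simpa [algMul, dotProduct, Pi.single_apply] using this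
    intro a b c
    exact ⟨by rw [key a b c, hg b c a], hg a b c⟩

/-! # Levi-Civita density -/

theorem eps_comp_perm (e : Fin 5 → Fin 5) (s : Equiv.Perm (Fin 5)) :
    Matrix.det (Matrix.of fun i j : Fin 5 => if (e ∘ s) i = j then (1 : ℝ) else 0) =
      Equiv.Perm.sign s * Matrix.det (Matrix.of fun i j : Fin 5 => if e i = j then (1 : ℝ) else 0) :=
  Matrix.det_permute s (Matrix.of fun i j : Fin 5 => if e i = j then (1 : ℝ) else 0)

theorem eps_swap_of {e e' : Fin 5 → Fin 5} {i j : Fin 5} (hij : i ≠ j)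
    (h : e' = e ∘ Equiv.swap i j) :
    Matrix.det (Matrix.of fun i j : Fin 5 => if e' i = j then (1 : ℝ) else 0) =
      -Matrix.det (Matrix.of fun i j : Fin 5 => if e i = j then (1 : ℝ) else 0) := by
  rw [h, eps_comp_perm, Equiv.Perm.sign_swap hij]; simp

theorem eps_swap₁₂ (μ ν ρ σ τ : Fin 5) : eps ν μ ρ σ τ = -eps μ ν ρ σ τ :=
  eps_swap_of (i := 0) (j := 1) (by decide) (by ext i; fin_cases i <;> rfl)

theorem eps_swap₂₃ (μ ν ρ σ τ : Fin 5) : eps μ ρ ν σ τ = -eps μ ν ρ σ τ :=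
  eps_swap_of (i := 1) (j := 2) (by decide) (by ext i; fin_cases i <;> rfl)

theorem eps_swap₃₄ (μ ν ρ σ τ : Fin 5) : eps μ ν σ ρ τ = -eps μ ν ρ σ τ :=
  eps_swap_of (i := 2) (j := 3) (by decide) (by ext i; fin_cases i <;> rfl)

theorem eps_swap₄₅ (μ ν ρ σ τ : Fin 5) : eps μ ν ρ τ σ = -eps μ ν ρ σ τ :=
  eps_swap_of (i := 3) (j := 4) (by decide) (by ext i; fin_cases i <;> rfl)

theorem sgn_mul_self (μ : Fin 5) : sgn μ * sgn μ = 1 := by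
  by_cases h : μ = 0 <;> simp [sgn, h]

/-! # Vector algebra over a commutative algebra -/

section Vector
variable {Q : Type*} [CommRing Q] [Algebra ℝ Q]

/-- The Minkowski product of two vectors. -/
def dot (u v : Fin 5 → Q) : Q := ∑ μ, sgn μ • (u μ * v μ)

/-- The contraction of the Levi-Civita density with five vectors. -/
def eps5 (u v w x y : Fin 5 → Q) : Q :=
  ∑ μ, ∑ ν, ∑ ρ, ∑ σ, ∑ τ, eps μ ν ρ σ τ • (u μ * v ν * w ρ * x σ * y τ)

theorem dot_comm (u v : Fin 5 → Q) : dot u v = dot v u := by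
  simp only [dot, mul_comm]

theorem dot_add_left (u v w : Fin 5 → Q) : dot (u + v) w = dot u w + dot v w := by
  simp only [dot, Pi.add_apply, add_mul, smul_add, Finset.sum_add_distrib]

theorem dot_add_right (u v w : Fin 5 → Q) : dot w (u + v) = dot w u + dot w v := by
  simp only [dot, Pi.add_apply, mul_add, smul_add, Finset.sum_add_distrib]

theorem dot_neg_left (u w : Fin 5 → Q) : dot (-u) w = -dot u w := by
  simp only [dot, Pi.neg_apply, neg_mul, smul_neg, Finset.sum_neg_distrib]

theorem dot_neg_right (u w : Fin 5 → Q) : dot w (-u) = -dot w u := by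
  simp only [dot, Pi.neg_apply, mul_neg, smul_neg, Finset.sum_neg_distrib]

theorem dot_map {Q' : Type*} [CommRing Q'] [Algebra ℝ Q'] (π : Q →ₐ[ℝ] Q') (u v : Fin 5 → Q) :
    π (dot u v) = dot (fun μ => π (u μ)) (fun μ => π (v μ)) := by
  simp only [dot, map_sum, map_smul, map_mul]

theorem eps5_map {Q' : Type*} [CommRing Q'] [Algebra ℝ Q'] (π : Q →ₐ[ℝ] Q')
    (u v w x y : Fin 5 → Q) :
    π (eps5 u v w x y) = eps5 (fun μ => π (u μ)) (fun μ => π (v μ)) (fun μ => π (w μ))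
      (fun μ => π (x μ)) (fun μ => π (y μ)) := by
  simp only [eps5, map_sum, map_smul, map_mul]

theorem derivation_dot (D : Derivation ℝ Q Q) (u v : Fin 5 → Q) :
    D (dot u v) = dot (fun μ => D (u μ)) v + dot u (fun μ => D (v μ)) := by
  simp only [dot, map_sum, Derivation.map_smul, Derivation.leibniz, smul_eq_mul, smul_add,
    Finset.sum_add_distrib]
  rw [add_comm]
  simp only [mul_comm]

theorem derivation_eps5 (D : Derivation ℝ Q Q) (u v w x y : Fin 5 → Q) :
    D (eps5 u v w x y) = eps5 (fun μ => D (u μ)) v w x y + eps5 u (fun μ => D (v μ)) w x y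
      + eps5 u v (fun μ => D (w μ)) x y + eps5 u v w (fun μ => D (x μ)) y
      + eps5 u v w x (fun μ => D (y μ)) := by
  simp only [eps5, map_sum, Derivation.map_smul, Derivation.leibniz, smul_eq_mul,
    ← Finset.sum_add_distrib, ← smul_add]
  refine Finset.sum_congr rfl fun μ _ => Finset.sum_congr rfl fun ν _ => Finset.sum_congr rfl
    fun ρ _ => Finset.sum_congr rfl fun σ _ => Finset.sum_congr rfl fun τ _ => ?_
  congr 1; ring

theorem eps5_swap₁₂ (u v w x y : Fin 5 → Q) : eps5 v u w x y = -eps5 u v w x y := by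
  unfold eps5
  rw [Finset.sum_comm]
  simp only [← Finset.sum_neg_distrib]
  refine Finset.sum_congr rfl fun μ _ => Finset.sum_congr rfl fun ν _ => Finset.sum_congr rfl
    fun ρ _ => Finset.sum_congr rfl fun σ _ => Finset.sum_congr rfl fun τ _ => ?_
  rw [eps_swap₁₂, neg_smul]; congr 2; ring

theorem eps5_swap₂₃ (u v w x y : Fin 5 → Q) : eps5 u w v x y = -eps5 u v w x y := by
  unfold eps5
  simp only [← Finset.sum_neg_distrib]
  refine Finset.sum_congr rfl fun μ _ => ?_
  rw [Finset.sum_comm]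
  refine Finset.sum_congr rfl fun ν _ => Finset.sum_congr rfl
    fun ρ _ => Finset.sum_congr rfl fun σ _ => Finset.sum_congr rfl fun τ _ => ?_
  rw [eps_swap₂₃, neg_smul]; congr 2; ring

theorem eps5_swap₃₄ (u v w x y : Fin 5 → Q) : eps5 u v x w y = -eps5 u v w x y := by
  unfold eps5
  simp only [← Finset.sum_neg_distrib]
  refine Finset.sum_congr rfl fun μ _ => Finset.sum_congr rfl fun ν _ => ?_
  rw [Finset.sum_comm]
  refine Finset.sum_congr rfl
    fun ρ _ => Finset.sum_congr rfl fun σ _ => Finset.sum_congr rfl fun τ _ => ?_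
  rw [eps_swap₃₄, neg_smul]; congr 2; ring

theorem eps5_swap₄₅ (u v w x y : Fin 5 → Q) : eps5 u v w y x = -eps5 u v w x y := by
  unfold eps5
  simp only [← Finset.sum_neg_distrib]
  refine Finset.sum_congr rfl fun μ _ => Finset.sum_congr rfl fun ν _ => Finset.sum_congr rfl
    fun ρ _ => ?_
  rw [Finset.sum_comm]
  refine Finset.sum_congr rfl fun σ _ => Finset.sum_congr rfl fun τ _ => ?_
  rw [eps_swap₄₅, neg_smul]; congr 2; ring

theorem eq_zero_of_eq_neg {x : Q} (h : x = -x) : x = 0 := by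
  have h2 : (2 : ℝ) • x = 0 := by rw [two_smul]; nth_rewrite 1 [h]; exact neg_add_cancel x
  have := congrArg (fun z => (1 / 2 : ℝ) • z) h2
  simpa [smul_smul] using this

theorem eps5_eq₁₂ (u w x y : Fin 5 → Q) : eps5 u u w x y = 0 :=
  eq_zero_of_eq_neg (eps5_swap₁₂ u u w x y)
theorem eps5_eq₃₄ (u v w y : Fin 5 → Q) : eps5 u v w w y = 0 :=
  eq_zero_of_eq_neg (eps5_swap₃₄ u v w w y)

theorem eps5_eq₁₃ (u v x y : Fin 5 → Q) : eps5 u v u x y = 0 := by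
  rw [eps5_swap₂₃, eps5_eq₁₂, neg_zero]
theorem eps5_eq₁₄ (u v w y : Fin 5 → Q) : eps5 u v w u y = 0 := by
  rw [eps5_swap₃₄, eps5_eq₁₃, neg_zero]
theorem eps5_eq₁₅ (u v w x : Fin 5 → Q) : eps5 u v w x u = 0 := by
  rw [eps5_swap₄₅, eps5_eq₁₄, neg_zero]

theorem eps5_add₁ (u u' v w x y : Fin 5 → Q) :
    eps5 (u + u') v w x y = eps5 u v w x y + eps5 u' v w x y := by
  simp only [eps5, Pi.add_apply, add_mul, smul_add, Finset.sum_add_distrib]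

theorem eps5_neg₁ (u v w x y : Fin 5 → Q) : eps5 (-u) v w x y = -eps5 u v w x y := by
  simp only [eps5, Pi.neg_apply, neg_mul, smul_neg, Finset.sum_neg_distrib]

theorem eps5_rotate (u v w x y : Fin 5 → Q) : eps5 y u v w x = eps5 u v w x y := by
  rw [eps5_swap₁₂, eps5_swap₂₃, eps5_swap₃₄, eps5_swap₄₅]; ring

end Vector

/-! ### Symbols of the field equations, of the connection and of `δ a₁` -/

section Symbol
variable {Q : Type*} [CommRing Q] [Algebra ℝ Q]

/-- Symbol of the Fronsdal tensor of `h = a³` with momentum `p`. -/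
def fronsdalSymbol (p a : Fin 5 → Q) (μ ν ρ : Fin 5) : Q :=
  (∑ σ, sgn σ • (p σ * p σ * (a μ * a ν * a ρ)))
    - (3 : ℝ) • sym3 (fun μ ν ρ => ∑ σ, sgn σ • (p σ * p μ * (a ν * a ρ * a σ))) μ ν ρ
    + (3 : ℝ) • sym3 (fun μ ν ρ => ∑ α, sgn α • (p μ * p ν * (a ρ * a α * a α))) μ ν ρ

/-- Symbol of the field equations. -/
def eomSymbol (p a : Fin 5 → Q) (μ ν ρ : Fin 5) : Q :=
  fronsdalSymbol p a μ ν ρ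
    - (3 / 2 : ℝ) • sym3 (fun μ ν ρ => eta μ ν • ∑ α, sgn α • fronsdalSymbol p a ρ α α) μ ν ρ

/-- Symbol of the second de Wit–Freedman connection. -/
def connSymbol (p a : Fin 5 → Q) (l σ τ α β : Fin 5) : Q :=
  (3 : ℝ) • sym3 (fun τ α β => p τ * p α * (a β * a l * a σ)) τ α β
    + p l * p σ * (a τ * a α * a β)
    - (3 / 2 : ℝ) • (sym3 (fun τ α β => p l * p τ * (a α * a β * a σ)) τ α β
        + sym3 (fun τ α β => p σ * p τ * (a α * a β * a l)) τ α β)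

/-- Symbol of the curl of the ghost `C = a²`. -/
def curlSymbol (p a : Fin 5 → Q) (ν ρ β : Fin 5) : Q :=
  (1 / 2 : ℝ) • (p ν * (a ρ * a β) - p ρ * (a ν * a β))

/-- Symbol of `ε · (eom) · (curl C) · Γ`. -/
def sourceSymbol (p a q b r c : Fin 5 → Q) : Q :=
  ∑ μ, ∑ ν, ∑ ρ, ∑ σ, ∑ τ, eps μ ν ρ σ τ • ∑ α, ∑ β, ∑ l, (sgn α * sgn β * sgn l) •
    (curlSymbol p a ν ρ l * eomSymbol q b α β μ *
      ((1 / 2 : ℝ) • (connSymbol r c l σ τ α β - connSymbol r c l τ σ α β)))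

theorem fronsdalSymbol_eq (p a : Fin 5 → Q) (μ ν ρ : Fin 5) :
    fronsdalSymbol p a μ ν ρ = dot p p * (a μ * a ν * a ρ)
      - dot p a * (p μ * a ν * a ρ + p ν * a μ * a ρ + p ρ * a μ * a ν)
      + dot a a * (p μ * p ν * a ρ + p μ * p ρ * a ν + p ν * p ρ * a μ) := by
  have h1 : ∀ x : Q, ∑ σ, sgn σ • (p σ * p σ * x) = dot p p * x := fun x => by
    simp only [dot, Finset.sum_mul, smul_mul_assoc]
  have h2 : ∀ x y z : Q, ∑ σ, sgn σ • (p σ * x * (y * z * a σ)) = dot p a * (x * y * z) :=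
    fun x y z => by
      simp only [dot, Finset.sum_mul]
      exact Finset.sum_congr rfl fun σ _ => by algebra
  have h3 : ∀ x y z : Q, ∑ α, sgn α • (x * y * (z * a α * a α)) = dot a a * (x * y * z) :=
    fun x y z => by
      simp only [dot, Finset.sum_mul]
      exact Finset.sum_congr rfl fun σ _ => by algebra
  simp only [fronsdalSymbol, h1, sym3, h2, h3]
  algebra

theorem fronsdalSymbol_trace (p a : Fin 5 → Q) (ρ : Fin 5) :
    ∑ α, sgn α • fronsdalSymbol p a ρ α α =
      (2 * dot a a * dot p p - 2 * dot p a ^ 2) * a ρ + dot a a * dot p a * p ρ := by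
  have h : ∀ α, sgn α • fronsdalSymbol p a ρ α α =
      sgn α • (a α * a α) * (dot p p * a ρ - dot p a * p ρ)
      + sgn α • (p α * a α) * (-2 * dot p a * a ρ + 2 * dot a a * p ρ)
      + sgn α • (p α * p α) * (dot a a * a ρ) := fun α => by
    rw [fronsdalSymbol_eq]; algebra
  simp only [h, Finset.sum_add_distrib, ← Finset.sum_mul]
  change dot a a * _ + dot p a * _ + dot p p * _ = _
  ring

theorem eomSymbol_eq (p a : Fin 5 → Q) (μ ν ρ : Fin 5) :
    eomSymbol p a μ ν ρ = fronsdalSymbol p a μ ν ρ - (1 / 2 : ℝ) •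
      (eta μ ν • ((2 * dot a a * dot p p - 2 * dot p a ^ 2) * a ρ + dot a a * dot p a * p ρ)
      + eta μ ρ • ((2 * dot a a * dot p p - 2 * dot p a ^ 2) * a ν + dot a a * dot p a * p ν)
      + eta ν ρ • ((2 * dot a a * dot p p - 2 * dot p a ^ 2) * a μ + dot a a * dot p a * p μ)) := by
  have e : ∀ μ ν, eta μ ν = eta ν μ := fun μ ν => by
    by_cases h : μ = ν
    · rw [h]
    · simp [eta, h, Ne.symm h]
  simp only [eomSymbol, sym3, fronsdalSymbol_trace, e ν μ, e ρ μ, e ρ ν]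
  algebra

theorem sum_eta (x : Fin 5 → Q) (f : Q) (α : Fin 5) :
    ∑ β, sgn β • (eta α β • f * x β) = f * x α := by
  simp [eta, smul_smul, sgn_mul_self]

/-- The four vectors `b`, `q`, `x`, `y` are kept apart because `sourceSymbol_eq` applies this with
`x` and `y` among `r` and `c`, where `ε` annihilates every component except the one along `b`. -/
theorem eomSymbol_contract (q b x y : Fin 5 → Q) (μ : Fin 5) :
    ∑ α, ∑ β, (sgn α * sgn β) • (eomSymbol q b α β μ * (x α * y β)) =
      (dot q q * dot b x * dot b y - dot q b * (dot q x * dot b y + dot b x * dot q y)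
        + dot b b * dot q x * dot q y
        - dot x y * (dot b b * dot q q - dot q b ^ 2)) * b μ
      + (- dot q b * dot b x * dot b y + dot b b * (dot q x * dot b y + dot b x * dot q y)
        - (1 / 2 : ℝ) • (dot x y * dot b b * dot q b)) * q μ
      - (1 / 2 : ℝ) • ((2 * dot b b * dot q q - 2 * dot q b ^ 2) * dot b y
          + dot b b * dot q b * dot q y) * x μ
      - (1 / 2 : ℝ) • ((2 * dot b b * dot q q - 2 * dot q b ^ 2) * dot b x
          + dot b b * dot q b * dot q x) * y μ := by
  have e : ∀ μ ν, eta μ ν = eta ν μ := fun μ ν => by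
    by_cases h : μ = ν
    · rw [h]
    · simp [eta, h, Ne.symm h]
  set A := (2 * dot b b * dot q q - 2 * dot q b ^ 2) with hA
  set B := dot b b * dot q b with hB
  -- The double sum is carried out one index at a time: each summand is sorted so that the summed
  -- index occurs only in a scalar product or in a contraction with `eta`, times a factor
  -- independent of it.
  have h1 : ∀ α, ∑ β, (sgn α * sgn β) • (eomSymbol q b α β μ * (x α * y β)) =
      sgn α • (b α * x α) * (dot q q * b μ * dot b y - dot q b * (q μ * dot b y + b μ * dot q y)
          + dot b b * (q μ * dot q y) - (1 / 2 : ℝ) • (A * y μ))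
      + sgn α • (q α * x α) * (- dot q b * b μ * dot b y + dot b b * (b μ * dot q y + q μ * dot b y)
          - (1 / 2 : ℝ) • (B * y μ))
      - sgn α • (x α * y α) * ((1 / 2 : ℝ) • (A * b μ + B * q μ))
      - sgn α • (eta μ α • (1 : Q) * x α) * ((1 / 2 : ℝ) • (A * dot b y + B * dot q y)) := by
    intro α
    have h2 : ∀ β, (sgn α * sgn β) • (eomSymbol q b α β μ * (x α * y β)) =
      sgn β • (b β * y β) * (sgn α • (x α * (dot q q * b α * b μ
        - dot q b * (q α * b μ + q μ * b α) + dot b b * q α * q μ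
        - (1 / 2 : ℝ) • (eta μ α • A))))
      + sgn β • (q β * y β) * (sgn α • (x α * (- dot q b * b α * b μ +
          dot b b * (q α * b μ + q μ * b α) - (1 / 2 : ℝ) • (eta μ α • B))))
      - sgn β • (eta α β • (1 : Q) * y β) * ((1 / 2 : ℝ) • sgn α • (x α * (A * b μ + B * q μ)))
      - sgn β • (eta μ β • (1 : Q) * y β) * ((1 / 2 : ℝ) • sgn α • (x α * (A * b α + B * q α))) := by
      intro β
      rw [eomSymbol_eq, fronsdalSymbol_eq, ← hA, ← hB, e β μ, e α μ]
      algebra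
    simp only [h2, Finset.sum_add_distrib, Finset.sum_sub_distrib, ← Finset.sum_mul, sum_eta]
    change dot b y * _ + dot q y * _ - _ - _ = _
    algebra
  simp only [h1, Finset.sum_add_distrib, Finset.sum_sub_distrib, ← Finset.sum_mul, sum_eta]
  change dot b x * _ + dot q x * _ - dot x y * _ - _ = _
  rw [hA, hB]
  algebra

/-- Antisymmetrizing the connection in `σ τ` leaves only the bivector `r ∧ c`, times a tensor in `α
β`. This is what lets the `ε`-contraction of the source become a determinant of vectors. -/
theorem conn_contract (a r c : Fin 5 → Q) (σ τ α β : Fin 5) :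
    ∑ l, sgn l • (a l * ((1 / 2 : ℝ) • (connSymbol r c l σ τ α β - connSymbol r c l τ σ α β))) =
      (1 / 2 : ℝ) • (r σ * c τ - r τ * c σ) * ((3 / 2 : ℝ) • (dot a r * (c α * c β))
        - (3 / 2 : ℝ) • (dot a c * (r α * c β + c α * r β))) := by
  have h : ∀ l, sgn l • (a l * ((1 / 2 : ℝ) •
        (connSymbol r c l σ τ α β - connSymbol r c l τ σ α β))) =
      sgn l • (a l * r l) * ((3 / 4 : ℝ) • ((r σ * c τ - r τ * c σ) * (c α * c β)))
      - sgn l • (a l * c l) * ((3 / 4 : ℝ) • ((r σ * c τ - r τ * c σ) *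
          (r α * c β + c α * r β))) := fun l => by
    simp only [connSymbol, sym3]
    algebra
  simp only [h, Finset.sum_sub_distrib, ← Finset.sum_mul]
  change dot a r * _ - dot a c * _ = _
  algebra

/-- The two explicit antisymmetrizations are redundant under `ε`: all four terms contribute equally,
with total weight one. -/
theorem eps5_antisymm (m p a r c : Fin 5 → Q) :
    ∑ μ, ∑ ν, ∑ ρ, ∑ σ, ∑ τ, eps μ ν ρ σ τ • (m μ * ((1 / 2 : ℝ) • (p ν * a ρ - p ρ * a ν)) *
      ((1 / 2 : ℝ) • (r σ * c τ - r τ * c σ))) = eps5 m p a r c := by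
  have h : ∀ μ ν ρ σ τ, eps μ ν ρ σ τ • (m μ * ((1 / 2 : ℝ) • (p ν * a ρ - p ρ * a ν)) *
      ((1 / 2 : ℝ) • (r σ * c τ - r τ * c σ))) = (1 / 4 : ℝ) •
      (eps μ ν ρ σ τ • (m μ * p ν * a ρ * r σ * c τ) - eps μ ν ρ σ τ • (m μ * a ν * p ρ * r σ * c τ)
      - eps μ ν ρ σ τ • (m μ * p ν * a ρ * c σ * r τ)
      + eps μ ν ρ σ τ • (m μ * a ν * p ρ * c σ * r τ)) := fun μ ν ρ σ τ => by algebra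
  simp only [h, ← Finset.smul_sum, Finset.sum_add_distrib, Finset.sum_sub_distrib]
  change (1 / 4 : ℝ) • (eps5 m p a r c - eps5 m a p r c - eps5 m p a c r + eps5 m a p c r) = _
  rw [eps5_swap₂₃ m p a r c, eps5_swap₂₃ m p a c r, eps5_swap₄₅ m p a r c]
  algebra

theorem eps5_smul₁ (u v w x y : Fin 5 → Q) (f : Q) :
    eps5 (fun μ => f * u μ) v w x y = f * eps5 u v w x y := by
  simp only [eps5, Finset.mul_sum]
  refine Finset.sum_congr rfl fun μ _ => Finset.sum_congr rfl fun ν _ => Finset.sum_congr rfl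
    fun ρ _ => Finset.sum_congr rfl fun σ _ => Finset.sum_congr rfl fun τ _ => ?_
  rw [mul_smul_comm]; congr 1; ring

/-- After contraction over `λ`, `α`, `β` the summand is a vector `M_μ` times the bivectors `p ∧ a`
and `r ∧ c`, so the source is `ε(M,p,a,r,c)`. The vector `M` is a combination of `b`, `q`, `r`, `c`;
the last two repeat an argument of `ε`, and `q` is removed by `h0`, which is momentum conservation.
Only the coefficient of `b` survives. -/
theorem sourceSymbol_eq (p a q b r c : Fin 5 → Q) (h0 : eps5 q p a r c = 0) :
    sourceSymbol p a q b r c = (3 / 2 : ℝ) • (eps5 b p a r c *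
      (dot a r * (dot q q * dot b c ^ 2 - 2 * dot q b * dot q c * dot b c
          + dot b b * dot q c ^ 2 - dot c c * (dot b b * dot q q - dot q b ^ 2))
        - 2 * dot a c * (dot q q * dot b r * dot b c
          - dot q b * (dot q r * dot b c + dot b r * dot q c)
          + dot b b * dot q r * dot q c - dot r c * (dot b b * dot q q - dot q b ^ 2)))) := by
  set K : (Fin 5 → Q) → (Fin 5 → Q) → Fin 5 → Q := fun x y μ =>
    ∑ α, ∑ β, (sgn α * sgn β) • (eomSymbol q b α β μ * (x α * y β)) with hK
  set M : Fin 5 → Q := fun μ => (3 / 2 : ℝ) • (dot a r * K c c μ)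
    - (3 / 2 : ℝ) • (dot a c * (K r c μ + K c r μ)) with hM
  have h1 : ∀ μ ν ρ σ τ, ∑ α, ∑ β, ∑ l, (sgn α * sgn β * sgn l) •
      (curlSymbol p a ν ρ l * eomSymbol q b α β μ *
        ((1 / 2 : ℝ) • (connSymbol r c l σ τ α β - connSymbol r c l τ σ α β))) =
      M μ * ((1 / 2 : ℝ) • (p ν * a ρ - p ρ * a ν)) * ((1 / 2 : ℝ) • (r σ * c τ - r τ * c σ)) := by
    intro μ ν ρ σ τ
    have h2 : ∀ α β, ∑ l, (sgn α * sgn β * sgn l) • (curlSymbol p a ν ρ l * eomSymbol q b α β μ *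
        ((1 / 2 : ℝ) • (connSymbol r c l σ τ α β - connSymbol r c l τ σ α β))) =
        ((1 / 2 : ℝ) • (p ν * a ρ - p ρ * a ν) * (1 / 2 : ℝ) • (r σ * c τ - r τ * c σ)) *
        ((sgn α * sgn β) • (eomSymbol q b α β μ * (c α * c β)) * ((3 / 2 : ℝ) • dot a r)
        - ((sgn α * sgn β) • (eomSymbol q b α β μ * (r α * c β))
          + (sgn α * sgn β) • (eomSymbol q b α β μ * (c α * r β))) * ((3 / 2 : ℝ) • dot a c)) := by
      intro α β
      have h3 : ∀ l, (sgn α * sgn β * sgn l) • (curlSymbol p a ν ρ l * eomSymbol q b α β μ *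
        ((1 / 2 : ℝ) • (connSymbol r c l σ τ α β - connSymbol r c l τ σ α β))) =
        ((sgn α * sgn β) • (eomSymbol q b α β μ * ((1 / 2 : ℝ) • (p ν * a ρ - p ρ * a ν)))) *
        sgn l • (a l * ((1 / 2 : ℝ) •
          (connSymbol r c l σ τ α β - connSymbol r c l τ σ α β))) := fun l => by
        rw [curlSymbol]; algebra
      simp only [h3, ← Finset.mul_sum]
      rw [conn_contract]
      algebra
    simp only [h2, ← Finset.mul_sum, Finset.sum_sub_distrib, Finset.sum_add_distrib,
      ← Finset.sum_mul]
    simp only [hM, hK]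
    algebra
  have h4 : sourceSymbol p a q b r c = eps5 M p a r c := by
    simp only [sourceSymbol, h1]
    exact eps5_antisymm M p a r c
  have h5 : ∀ (U V W Z : Q), eps5 (fun μ => U * b μ + V * q μ + W * r μ + Z * c μ) p a r c =
      U * eps5 b p a r c := by
    intro U V W Z
    change eps5 ((fun μ => U * b μ) + (fun μ => V * q μ) + (fun μ => W * r μ) +
      (fun μ => Z * c μ)) p a r c = _
    simp only [eps5_add₁, eps5_smul₁, h0, eps5_eq₁₄, eps5_eq₁₅, mul_zero, add_zero]
  -- The coefficients of `q`, `r`, `c` are read off from `eomSymbol_contract`; by `h5` their values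
  -- do not matter, so only their existence is recorded.
  have h6 : ∃ V W Z : Q, M = fun μ => ((3 / 2 : ℝ) •
      (dot a r * (dot q q * dot b c ^ 2 - 2 * dot q b * dot q c * dot b c
          + dot b b * dot q c ^ 2 - dot c c * (dot b b * dot q q - dot q b ^ 2))
        - 2 * dot a c * (dot q q * dot b r * dot b c
          - dot q b * (dot q r * dot b c + dot b r * dot q c)
          + dot b b * dot q r * dot q c - dot r c * (dot b b * dot q q - dot q b ^ 2)))) * b μ
      + V * q μ + W * r μ + Z * c μ := by
    let T : (Fin 5 → Q) → (Fin 5 → Q) → Q := fun x y =>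
      - dot q b * dot b x * dot b y + dot b b * (dot q x * dot b y + dot b x * dot q y)
        - (1 / 2 : ℝ) • (dot x y * dot b b * dot q b)
    let Y : (Fin 5 → Q) → Q := fun y => (1 / 2 : ℝ) • ((2 * dot b b * dot q q - 2 * dot q b ^ 2)
      * dot b y + dot b b * dot q b * dot q y)
    refine ⟨(3 / 2 : ℝ) • (dot a r * T c c) - (3 / 2 : ℝ) • (dot a c * (T r c + T c r)),
      (3 / 2 : ℝ) • (dot a c * (2 * Y c)),
      -(3 / 2 : ℝ) • (dot a r * (2 * Y c)) + (3 / 2 : ℝ) • (dot a c * (2 * Y r)), ?_⟩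
    ext μ
    simp only [hM, hK, eomSymbol_contract, T, Y, dot_comm c r]
    algebra
  obtain ⟨V, W, Z, h6⟩ := h6
  rw [h4, h6, h5]
  algebra

end Symbol

/-! ### The symbol of the vertex and its gauge variation -/

section Symbol
variable {Q : Type*} [CommRing Q] [Algebra ℝ Q]

/-- The scalar factor of the symbol of the vertex, for `h^a = a³`, `h^b = b³`, `h^c = c³` with
momenta `p`, `q` (the third momentum does not occur). -/
def vertexSymbol (p a q b c : Fin 5 → Q) : Q :=
  -(1 / 8 : ℝ) • (dot p p * dot a a * dot b b * dot c c)
  + (1 / 2 : ℝ) • (dot a a * dot p b * dot p b * dot c c)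
  + (1 / 4 : ℝ) • (dot p p * dot a b * dot a b * dot c c)
  + (3 / 8 : ℝ) • (dot p p * dot a a * dot b c * dot b c)
  - (1 / 2 : ℝ) • (dot p p * dot a b * dot a c * dot b c)
  - (1 / 2 : ℝ) • (dot a a * dot p b * dot p c * dot b c)
  - (1 / 2 : ℝ) • (dot p a * dot a c * dot p c * dot b b)
  - (1 / 4 : ℝ) • (dot p a * dot p a * dot b c * dot b c)
  - (1 / 2 : ℝ) • (dot p b * dot p b * dot a c * dot a c)
  + dot p a * dot a b * dot b c * dot p c
  + (1 / 2 : ℝ) • (dot p a * dot q c * dot a c * dot b b)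
  - dot p b * dot a b * dot q c * dot a c

/-- The symbol of the vertex. -/
def cubicSymbol (p a q b c : Fin 5 → Q) : Q :=
  (3 / 2 : ℝ) • (eps5 p a q b c * vertexSymbol p a q b c)

/-- The derivative of `vertexSymbol` along `a ↦ p`. -/
def vertexSymbol₁ (p a q b c : Fin 5 → Q) : Q :=
  -(1 / 4 : ℝ) • (dot p p * dot p a * dot b b * dot c c)
  + (dot p a * dot p b * dot p b * dot c c)
  + (1 / 2 : ℝ) • (dot p p * dot p b * dot a b * dot c c)
  + (3 / 4 : ℝ) • (dot p p * dot p a * dot b c * dot b c)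
  - (1 / 2 : ℝ) • (dot p p * (dot p b * dot a c + dot a b * dot p c) * dot b c)
  - (dot p a * dot p b * dot p c * dot b c)
  - (1 / 2 : ℝ) • ((dot p p * dot a c + dot p a * dot p c) * dot p c * dot b b)
  - (1 / 2 : ℝ) • (dot p p * dot p a * dot b c * dot b c)
  - (dot p b * dot p b * dot p c * dot a c)
  + (dot p p * dot a b + dot p a * dot p b) * dot b c * dot p c
  + (1 / 2 : ℝ) • ((dot p p * dot a c + dot p a * dot p c) * dot q c * dot b b)
  - dot p b * dot q c * (dot p b * dot a c + dot a b * dot p c)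

/-- The derivative of `vertexSymbol` along `b ↦ q`. -/
def vertexSymbol₂ (p a q b c : Fin 5 → Q) : Q :=
  -(1 / 4 : ℝ) • (dot p p * dot a a * dot q b * dot c c)
  + (dot a a * dot p q * dot p b * dot c c)
  + (1 / 2 : ℝ) • (dot p p * dot a q * dot a b * dot c c)
  + (3 / 4 : ℝ) • (dot p p * dot a a * dot q c * dot b c)
  - (1 / 2 : ℝ) • (dot p p * (dot a q * dot b c + dot a b * dot q c) * dot a c)
  - (1 / 2 : ℝ) • (dot a a * (dot p q * dot b c + dot p b * dot q c) * dot p c)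
  - (dot p a * dot a c * dot p c * dot q b)
  - (1 / 2 : ℝ) • (dot p a * dot p a * dot q c * dot b c)
  - (dot p q * dot p b * dot a c * dot a c)
  + dot p a * (dot a q * dot b c + dot a b * dot q c) * dot p c
  + (dot p a * dot q c * dot a c * dot q b)
  - (dot p q * dot a b + dot p b * dot a q) * dot q c * dot a c

/-- The derivative of `vertexSymbol` along `c ↦ r`. -/
def vertexSymbol₃ (p a q b c r : Fin 5 → Q) : Q :=
  -(1 / 4 : ℝ) • (dot p p * dot a a * dot b b * dot r c)
  + (dot a a * dot p b * dot p b * dot r c)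
  + (1 / 2 : ℝ) • (dot p p * dot a b * dot a b * dot r c)
  + (3 / 4 : ℝ) • (dot p p * dot a a * dot b r * dot b c)
  - (1 / 2 : ℝ) • (dot p p * dot a b * (dot a r * dot b c + dot a c * dot b r))
  - (1 / 2 : ℝ) • (dot a a * dot p b * (dot p r * dot b c + dot p c * dot b r))
  - (1 / 2 : ℝ) • (dot p a * (dot a r * dot p c + dot a c * dot p r) * dot b b)
  - (1 / 2 : ℝ) • (dot p a * dot p a * dot b r * dot b c)
  - (dot p b * dot p b * dot a r * dot a c)
  + dot p a * dot a b * (dot b r * dot p c + dot b c * dot p r)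
  + (1 / 2 : ℝ) • (dot p a * (dot q r * dot a c + dot q c * dot a r) * dot b b)
  - dot p b * dot a b * (dot q r * dot a c + dot q c * dot a r)

theorem dot_zero_left (u : Fin 5 → Q) : dot (fun _ => 0) u = 0 := by simp [dot]
theorem dot_zero_right (u : Fin 5 → Q) : dot u (fun _ => 0) = 0 := by simp [dot]

/-- The determinant already contains `p`, so replacing `a` by `p` in it gives zero: only the scalar
factor is varied. The second slot behaves in the same way with `b ↦ q`. -/
theorem derivation_cubicSymbol₁ (D : Derivation ℝ Q Q) (p a q b c : Fin 5 → Q)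
    (hp : ∀ μ, D (p μ) = 0) (ha : ∀ μ, D (a μ) = p μ) (hq : ∀ μ, D (q μ) = 0)
    (hb : ∀ μ, D (b μ) = 0) (hc : ∀ μ, D (c μ) = 0) :
    D (cubicSymbol p a q b c) = (3 / 2 : ℝ) • (eps5 p a q b c * vertexSymbol₁ p a q b c) := by
  have z : eps5 (fun _ => 0) a q b c = 0 ∧ eps5 p a (fun _ => 0) b c = 0 ∧
      eps5 p a q (fun _ => 0) c = 0 ∧ eps5 p a q b (fun _ => 0) = 0 := by simp [eps5]
  simp only [cubicSymbol, vertexSymbol, vertexSymbol₁, Derivation.map_smul, Derivation.leibniz,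
    map_add, map_sub, smul_eq_mul, derivation_dot, derivation_eps5, hp, ha, hq, hb, hc,
    dot_zero_left, dot_zero_right, z, eps5_eq₁₂, dot_comm a p]
  algebra

theorem derivation_cubicSymbol₂ (D : Derivation ℝ Q Q) (p a q b c : Fin 5 → Q)
    (hp : ∀ μ, D (p μ) = 0) (ha : ∀ μ, D (a μ) = 0) (hq : ∀ μ, D (q μ) = 0)
    (hb : ∀ μ, D (b μ) = q μ) (hc : ∀ μ, D (c μ) = 0) :
    D (cubicSymbol p a q b c) = (3 / 2 : ℝ) • (eps5 p a q b c * vertexSymbol₂ p a q b c) := by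
  have z : eps5 (fun _ => 0) a q b c = 0 ∧ eps5 p (fun _ => 0) q b c = 0 ∧
      eps5 p a (fun _ => 0) b c = 0 ∧ eps5 p a q b (fun _ => 0) = 0 := by simp [eps5]
  simp only [cubicSymbol, vertexSymbol, vertexSymbol₂, Derivation.map_smul, Derivation.leibniz,
    map_add, map_sub, smul_eq_mul, derivation_dot, derivation_eps5, hp, ha, hq, hb, hc,
    dot_zero_left, dot_zero_right, z, eps5_eq₃₄, dot_comm b q]
  algebra

-- The third momentum is not an argument of the determinant, so here varying `c ↦ r` also changes
-- `ε`. The extra term disappears only modulo momentum conservation.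
set_option maxHeartbeats 1000000 in
theorem derivation_cubicSymbol₃ (D : Derivation ℝ Q Q) (p a q b c r : Fin 5 → Q)
    (hp : ∀ μ, D (p μ) = 0) (ha : ∀ μ, D (a μ) = 0) (hq : ∀ μ, D (q μ) = 0)
    (hb : ∀ μ, D (b μ) = 0) (hc : ∀ μ, D (c μ) = r μ) :
    D (cubicSymbol p a q b c) = (3 / 2 : ℝ) • (eps5 p a q b r * vertexSymbol p a q b c
      + eps5 p a q b c * vertexSymbol₃ p a q b c r) := by
  have z : eps5 (fun _ => 0) a q b c = 0 ∧ eps5 p (fun _ => 0) q b c = 0 ∧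
      eps5 p a (fun _ => 0) b c = 0 ∧ eps5 p a q (fun _ => 0) c = 0 := by simp [eps5]
  simp only [cubicSymbol, vertexSymbol, vertexSymbol₃, Derivation.map_smul, Derivation.leibniz,
    map_add, map_sub, smul_eq_mul, derivation_dot, derivation_eps5, hp, ha, hq, hb, hc,
    dot_zero_left, dot_zero_right, z, dot_comm c r]
  algebra

/-- The symbol of `γ a₀ + δ a₁`, with the ghost in the first slot. -/
def variationSymbol (p a q b r c : Fin 5 → Q) : Q :=
  (3 / 2 : ℝ) • (eps5 p a q b c * vertexSymbol₁ p a q b c)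
  + (3 / 2 : ℝ) • (eps5 q b p a c * vertexSymbol₂ q b p a c)
  + (3 / 2 : ℝ) • (eps5 q b r c p * vertexSymbol q b r c a
      + eps5 q b r c a * vertexSymbol₃ q b r c a p)
  + sourceSymbol p a q b r c

theorem eps5_momentum (p a q r c : Fin 5 → Q) (h : p + q + r = 0) : eps5 q p a r c = 0 := by
  have hq : q = -p + -r := by
    rw [← neg_add, eq_neg_iff_add_eq_zero, ← h]; abel
  rw [hq, eps5_add₁, eps5_neg₁, eps5_neg₁, eps5_eq₁₂, eps5_eq₁₄]; simp

set_option maxHeartbeats 8000000 in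
/-- Gauge invariance of the symmetrized vertex, up to momentum conservation. -/
theorem variationSymbol_symm (p a q b r c : Fin 5 → Q) (h : p + q + r = 0) :
    variationSymbol p a q b r c + variationSymbol p a r c q b = 0 := by
  have hp : p = -(q + r) := by rw [eq_neg_iff_add_eq_zero, ← h]; abel
  have h' : p + r + q = 0 := by rw [← h]; abel
  have hr : r = -p + -q := by rw [hp]; abel
  have hq : q = -p + -r := by rw [hp]; abel
  have cyc : ∀ u v w x y : Fin 5 → Q, eps5 w u v x y = eps5 u v w x y := fun u v w x y => by
    rw [eps5_swap₁₂, eps5_swap₂₃, neg_neg]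
  have mom₁ : ∀ u v w : Fin 5 → Q, eps5 r p u v w = -eps5 q p u v w := fun u v w => by
    rw [hr, eps5_add₁, eps5_neg₁, eps5_neg₁, eps5_eq₁₂]; ring
  have mom₂ : ∀ u v w : Fin 5 → Q, eps5 r q u v w = -eps5 p q u v w := fun u v w => by
    rw [hr, eps5_add₁, eps5_neg₁, eps5_neg₁, eps5_eq₁₂]; ring
  -- Of the three momenta only two are independent, so each determinant below either equals `eps5 p
  -- a q b c` or contains all three momenta and vanishes (`e5`, `e6`). The latter disposes of the
  -- extra term from varying the third slot.
  have e0 : eps5 q b p a c = eps5 p a q b c := by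
    rw [eps5_swap₂₃, eps5_swap₁₂, eps5_swap₃₄, eps5_swap₂₃]; ring
  have e1 : eps5 r c p a b = eps5 p a r c b := by
    rw [eps5_swap₂₃, eps5_swap₁₂, eps5_swap₃₄, eps5_swap₂₃]; ring
  have e2 : eps5 p a r c b = eps5 p a q b c := by
    rw [← cyc, mom₁, cyc, eps5_swap₄₅]; ring
  have e3 : eps5 q b r c a = eps5 p a q b c := by
    rw [← cyc, mom₂, eps5_swap₄₅, eps5_swap₃₄, eps5_swap₂₃]; ring
  have e4 : eps5 r c q b a = eps5 p a q b c := by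
    rw [eps5_swap₂₃, mom₂, eps5_swap₂₃, eps5_swap₄₅, eps5_swap₃₄, eps5_swap₂₃ p a c,
      eps5_swap₃₄, eps5_swap₄₅]; ring
  have e5 : eps5 q b r c p = 0 := by
    rw [← cyc, mom₂, eps5_eq₁₅, neg_zero]
  have e6 : eps5 r c q b p = 0 := by
    rw [eps5_swap₂₃, mom₂, eps5_eq₁₅, neg_zero, neg_zero]
  have e7 : eps5 b p a r c = eps5 p a q b c := by
    rw [eps5_swap₃₄, ← cyc, eps5_swap₂₃, mom₁, ← e0, eps5_swap₂₃ q p b]; ring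
  have e8 : eps5 c p a q b = eps5 p a q b c := eps5_rotate p a q b c
  simp only [variationSymbol, sourceSymbol_eq _ _ _ _ _ _ (eps5_momentum p a q r c h),
    sourceSymbol_eq _ _ _ _ _ _ (eps5_momentum p a r q b h'), e0, e1, e2, e3, e4, e5, e6, e7, e8,
    vertexSymbol₁, vertexSymbol₂, vertexSymbol₃]
  -- With `p` eliminated, the claim is an identity with common factor `E` between polynomials in the
  -- scalar products of `q`, `r`, `a`, `b`, `c`. It holds with these scalar products treated as
  -- independent variables; no Gram determinant relation is needed.
  generalize eps5 p a q b c = E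
  simp only [hp, dot_neg_left, dot_neg_right, dot_add_left, dot_add_right, dot_comm r q,
    dot_comm b q, dot_comm b r, dot_comm c q, dot_comm c r, dot_comm a q, dot_comm a r,
    dot_comm b a, dot_comm c a, dot_comm c b]
  algebra

end Symbol

/-! # Symbols of one field -/

/-- Polynomials in a momentum `p_μ` and a polarization vector `a_μ`; a monomial is a pair of
multisets of indices. -/
def Poly : Type := AddMonoidAlgebra ℝ (Multiset (Fin 5) × Multiset (Fin 5))

instance : CommRing Poly :=
  inferInstanceAs (CommRing (AddMonoidAlgebra ℝ (Multiset (Fin 5) × Multiset (Fin 5))))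

instance : Algebra ℝ Poly :=
  inferInstanceAs (Algebra ℝ (AddMonoidAlgebra ℝ (Multiset (Fin 5) × Multiset (Fin 5))))

/-- The monomial `p_m a_k`. -/
def mono (m k : Multiset (Fin 5)) : Poly :=
  (AddMonoidAlgebra.single (m, k) 1 : AddMonoidAlgebra ℝ (Multiset (Fin 5) × Multiset (Fin 5)))

/-- The momentum. -/
def mom (μ : Fin 5) : Poly := mono {μ} 0

/-- The polarization vector. -/
def pol (μ : Fin 5) : Poly := mono 0 {μ}

theorem mono_mul (m k m' k' : Multiset (Fin 5)) :
    mono m k * mono m' k' = mono (m + m') (k + k') :=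
  (AddMonoidAlgebra.single_mul_single (m, k) (m', k') (1 : ℝ) 1).trans (by rw [mul_one]; rfl)

/-- Linear maps out of `Poly`. -/
def polyLift {M : Type*} [AddCommGroup M] [Module ℝ M]
    (f : Multiset (Fin 5) → Multiset (Fin 5) → M) : Poly →ₗ[ℝ] M :=
  Finsupp.linearCombination ℝ (fun x : Multiset (Fin 5) × Multiset (Fin 5) => f x.1 x.2) ∘ₗ
    (AddMonoidAlgebra.coeffLinearEquiv ℝ).toLinearMap

@[simp] theorem polyLift_mono {M : Type*} [AddCommGroup M] [Module ℝ M]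
    (f : Multiset (Fin 5) → Multiset (Fin 5) → M) (m k : Multiset (Fin 5)) :
    polyLift f (mono m k) = f m k :=
  (Finsupp.linearCombination_single ℝ (1 : ℝ) (m, k)).trans (one_smul ℝ _)

theorem Poly.induction {P : Poly → Prop} (h0 : P 0) (ha : ∀ x y, P x → P y → P (x + y))
    (hs : ∀ (r : ℝ) m k, P (r • mono m k)) (x : Poly) : P x := by
  refine AddMonoidAlgebra.induction_linear (motive := P) x h0 (fun f g hf hg => ha f g hf hg) ?_
  intro m r
  have e : r • mono m.1 m.2 = AddMonoidAlgebra.single m r :=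
    (AddMonoidAlgebra.smul_single r m (1 : ℝ)).trans (by rw [smul_eq_mul, mul_one])
  rw [← e]
  exact hs r m.1 m.2

theorem poly_ext {M : Type*} [AddCommGroup M] [Module ℝ M] {f g : Poly →ₗ[ℝ] M}
    (h : ∀ m k, f (mono m k) = g (mono m k)) (x : Poly) : f x = g x := by
  induction x using Poly.induction with
  | h0 => simp
  | ha x y hx hy => rw [map_add, map_add, hx, hy]
  | hs r m k => rw [map_smul, map_smul, h]

/-- The derivation with `p_μ ↦ f_μ`, `a_μ ↦ k_μ`, on monomials. -/
def derMono (f k : Fin 5 → Poly) (m n : Multiset (Fin 5)) : Poly :=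
  (m.map fun μ => mono (m.erase μ) n * f μ).sum + (n.map fun μ => mono m (n.erase μ) * k μ).sum

/-- The sums run over indices with multiplicity, so repeated variables automatically receive the
right exponent. Erasing an index from a sum of multisets erases it from the summand to which it
belongs, which is the Leibniz rule on monomials. -/
theorem derMono_add (f k : Fin 5 → Poly) (m n m' n' : Multiset (Fin 5)) :
    derMono f k (m + m') (n + n') =
      mono m n * derMono f k m' n' + mono m' n' * derMono f k m n := by
  have h1 : ∀ (s t : Multiset (Fin 5)) (F : Multiset (Fin 5) → Fin 5 → Poly),
      ((s + t).map fun μ => F ((s + t).erase μ) μ).sum =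
      (s.map fun μ => F (s.erase μ + t) μ).sum + (t.map fun μ => F (s + t.erase μ) μ).sum := by
    intro s t F
    rw [Multiset.map_add, Multiset.sum_add]
    congr 2
    · exact Multiset.map_congr rfl fun μ hμ => by rw [Multiset.erase_add_left_pos _ hμ]
    · exact Multiset.map_congr rfl fun μ hμ => by rw [Multiset.erase_add_right_pos _ hμ]
  rw [derMono, h1 m m' (fun s μ => mono s (n + n') * f μ),
    h1 n n' (fun s μ => mono (m + m') s * k μ)]
  simp only [derMono, mul_add, Multiset.sum_map_mul_left.symm, ← mul_assoc, mono_mul]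
  rw [add_comm m' m, add_comm n' n]
  simp only [add_comm m' (m.erase _), add_comm n' (n.erase _)]
  abel

/-- The derivation with `p_μ ↦ f_μ`, `a_μ ↦ k_μ`. -/
def polyDer (f k : Fin 5 → Poly) : Derivation ℝ Poly Poly :=
  Derivation.mk' (polyLift (derMono f k)) (by
    intro x y
    induction x using Poly.induction with
    | h0 => simp
    | ha x x' hx hx' => simp only [add_mul, map_add, hx, hx', smul_eq_mul, mul_add]; ring
    | hs r m n =>
      induction y using Poly.induction with
      | h0 => simp
      | ha y y' hy hy' =>
        simp only [mul_add, map_add, hy, hy', smul_eq_mul, add_mul]; ring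
      | hs r' m' n' =>
        simp only [smul_mul_smul_comm, mono_mul, map_smul, polyLift_mono, derMono_add, smul_eq_mul,
          smul_add]
        rw [mul_comm r' r])

theorem polyDer_mono (f k : Fin 5 → Poly) (m n : Multiset (Fin 5)) :
    polyDer f k (mono m n) = derMono f k m n := polyLift_mono _ _ _

@[simp] theorem polyDer_mom (f k : Fin 5 → Poly) (μ : Fin 5) : polyDer f k (mom μ) = f μ := by
  have : mono 0 0 = 1 := rfl
  simp [mom, polyDer_mono, derMono, this]

@[simp] theorem polyDer_pol (f k : Fin 5 → Poly) (μ : Fin 5) : polyDer f k (pol μ) = k μ := by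
  have : mono 0 0 = 1 := rfl
  simp [pol, polyDer_mono, derMono, this]

/-! # Fields from symbols -/

/-- A symmetric function of three indices, as a function of a multiset (zero unless its cardinality
is three). -/
def symFun₃ {M : Type*} [Zero M] (T : Fin 5 → Fin 5 → Fin 5 → M) (k : Multiset (Fin 5)) : M :=
  match k.toList with
  | [μ, ν, ρ] => T μ ν ρ
  | _ => 0

/-- A symmetric function of two indices, as a function of a multiset. -/
def symFun₂ {M : Type*} [Zero M] (T : Fin 5 → Fin 5 → M) (k : Multiset (Fin 5)) : M :=
  match k.toList with
  | [μ, ν] => T μ ν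
  | _ => 0

/-- `Multiset.toList` returns the indices in an arbitrary order; symmetry of `T` makes the choice
irrelevant. -/
theorem symFun₂_pair {M : Type*} [Zero M] {T : Fin 5 → Fin 5 → M}
    (h : ∀ μ ν, T μ ν = T ν μ) (μ ν : Fin 5) : symFun₂ T {μ, ν} = T μ ν := by
  have hp : ({μ, ν} : Multiset (Fin 5)).toList.Perm [μ, ν] :=
    Multiset.coe_eq_coe.mp (by rw [Multiset.coe_toList]; rfl)
  unfold symFun₂
  generalize ({μ, ν} : Multiset (Fin 5)).toList = l at hp
  have hl := hp.length_eq
  match l, hl with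
  | [x, y], _ =>
    have hx : x ∈ [μ, ν] := hp.subset (by simp)
    simp only [List.mem_cons, List.not_mem_nil, or_false] at hx
    rcases hx with rfl | rfl
    · have := List.perm_singleton.mp ((List.perm_cons _).mp hp)
      simp_all
    · have := List.perm_singleton.mp ((List.perm_cons _).mp (hp.trans (List.Perm.swap _ _ _)))
      simp_all

theorem symFun₃_triple {M : Type*} [Zero M] {T : Fin 5 → Fin 5 → Fin 5 → M}
    (h₁ : ∀ μ ν ρ, T μ ν ρ = T ν μ ρ) (h₂ : ∀ μ ν ρ, T μ ν ρ = T μ ρ ν) (μ ν ρ : Fin 5) :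
    symFun₃ T {μ, ν, ρ} = T μ ν ρ := by
  have hp : ({μ, ν, ρ} : Multiset (Fin 5)).toList.Perm [μ, ν, ρ] :=
    Multiset.coe_eq_coe.mp (by rw [Multiset.coe_toList]; rfl)
  unfold symFun₃
  generalize ({μ, ν, ρ} : Multiset (Fin 5)).toList = l at hp
  have hl := hp.length_eq
  have two : ∀ {x y z : Fin 5} {s t : Fin 5}, [s, t].Perm [y, z] → T x s t = T x y z := by
    intro x y z s t hst
    have hx : s ∈ [y, z] := hst.subset (by simp)
    simp only [List.mem_cons, List.not_mem_nil, or_false] at hx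
    rcases hx with rfl | rfl
    · have := List.perm_singleton.mp ((List.perm_cons _).mp hst)
      simp_all
    · have := List.perm_singleton.mp ((List.perm_cons _).mp (hst.trans (List.Perm.swap _ _ _)))
      simp only [List.cons.injEq, and_true] at this
      rw [this, h₂]
  match l, hl with
  | [x, y, z], _ =>
    have hx : x ∈ [μ, ν, ρ] := hp.subset (by simp)
    simp only [List.mem_cons, List.not_mem_nil, or_false] at hx
    change T x y z = T μ ν ρ
    rcases hx with rfl | rfl | rfl
    · exact two ((List.perm_cons _).mp hp)
    · rw [two ((List.perm_cons _).mp (hp.trans (List.Perm.swap _ _ _))), h₁]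
    · rw [two ((List.perm_cons _).mp (hp.trans
        (((List.Perm.swap _ _ _).cons _).trans (List.Perm.swap _ _ _)))), h₁, h₂]

theorem symFun₃_of_card {M : Type*} [Zero M] (T : Fin 5 → Fin 5 → Fin 5 → M)
    {k : Multiset (Fin 5)} (hk : k.card ≠ 3) : symFun₃ T k = 0 := by
  unfold symFun₃
  rw [← Multiset.length_toList] at hk
  split
  · simp_all
  · rfl

theorem symFun₂_of_card {M : Type*} [Zero M] (T : Fin 5 → Fin 5 → M)
    {k : Multiset (Fin 5)} (hk : k.card ≠ 2) : symFun₂ T k = 0 := by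
  unfold symFun₂
  rw [← Multiset.length_toList] at hk
  split
  · simp_all
  · rfl

/-- The field `h^a` as a linear map on symbols: `p_m a_μ a_ν a_ρ ↦ ∂_m h^a_{μνρ}`. -/
def hMap (a : Fin N) : Poly →ₗ[ℝ] BRST N := polyLift fun m => symFun₃ (hJet m a)

/-- The ghost `C^a` as a linear map on symbols. -/
def CMap (a : Fin N) : Poly →ₗ[ℝ] BRST N := polyLift fun m => symFun₂ (CJet m a)

/-- The antifield `h^*_a` as a linear map on symbols. -/
def hsMap (a : Fin N) : Poly →ₗ[ℝ] BRST N := polyLift fun m => symFun₃ (hsJet m a)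

theorem hMap_mono (m : Multiset (Fin 5)) (a : Fin N) (μ ν ρ : Fin 5) :
    hMap a (mono m {μ, ν, ρ}) = hJet m a μ ν ρ := by
  rw [hMap, polyLift_mono]
  exact symFun₃_triple (gen_respects.h₁₂ m a) (gen_respects.h₂₃ m a) μ ν ρ

theorem hsMap_mono (m : Multiset (Fin 5)) (a : Fin N) (μ ν ρ : Fin 5) :
    hsMap a (mono m {μ, ν, ρ}) = hsJet m a μ ν ρ := by
  rw [hsMap, polyLift_mono]
  exact symFun₃_triple (gen_respects.hs₁₂ m a) (gen_respects.hs₂₃ m a) μ ν ρ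

theorem CMap_mono (m : Multiset (Fin 5)) (a : Fin N) (μ ν : Fin 5) :
    CMap a (mono m {μ, ν}) = CJet m a μ ν := by
  rw [CMap, polyLift_mono]
  exact symFun₂_pair (gen_respects.C₁₂ m a) μ ν

theorem pol_mul₂ (μ ν : Fin 5) : pol μ * pol ν = mono 0 {μ, ν} := by
  simp only [pol, mono_mul]; rfl

theorem pol_mul₃ (μ ν ρ : Fin 5) : pol μ * pol ν * pol ρ = mono 0 {μ, ν, ρ} := by
  simp only [pol, mono_mul]; rfl

theorem mom_mul_mono (κ : Fin 5) (m k : Multiset (Fin 5)) :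
    mom κ * mono m k = mono (κ ::ₘ m) k := by
  rw [mom, mono_mul, zero_add]; rfl

/-- A linear map that turns multiplication by the momentum into the total derivative. -/
def Translates (φ : Poly →ₗ[ℝ] BRST N) : Prop :=
  ∀ κ f, totalDeriv κ (φ f) = φ (mom κ * f)

theorem translates_polyLift {J : Multiset (Fin 5) → Multiset (Fin 5) → BRST N}
    (h : ∀ κ m k, totalDeriv κ (J m k) = J (κ ::ₘ m) k) : Translates (polyLift J) := by
  intro κ f
  refine poly_ext (f := totalDeriv κ ∘ₗ polyLift J)
    (g := polyLift J ∘ₗ LinearMap.mulLeft ℝ (mom κ)) (fun m k => ?_) f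
  simp [mom_mul_mono, h]

theorem hMap_translates (a : Fin N) : Translates (hMap a) :=
  translates_polyLift fun κ m k => by
    unfold symFun₃; split
    · exact totalDeriv_gen _ _
    · exact map_zero _

theorem hsMap_translates (a : Fin N) : Translates (hsMap a) :=
  translates_polyLift fun κ m k => by
    unfold symFun₃; split
    · exact totalDeriv_gen _ _
    · exact map_zero _

theorem CMap_translates (a : Fin N) : Translates (CMap a) :=
  translates_polyLift fun κ m k => by
    unfold symFun₂; split
    · exact totalDeriv_gen _ _
    · exact map_zero _

/-- The derivation `a_μ ↦ p_μ`, the symbol of `γ`. -/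
def gammaDer : Derivation ℝ Poly Poly := polyDer 0 mom

theorem mono_triple (m : Multiset (Fin 5)) (μ ν ρ : Fin 5) :
    mono m {μ, ν, ρ} = mono m 0 * (pol μ * pol ν * pol ρ) := by
  rw [pol_mul₃, mono_mul]; simp

theorem mono_pair (m : Multiset (Fin 5)) (μ ν : Fin 5) :
    mono m {μ, ν} = mono m 0 * (pol μ * pol ν) := by
  rw [pol_mul₂, mono_mul]; simp

theorem gammaDer_mono (m k : Multiset (Fin 5)) :
    gammaDer (mono m k) = (k.map fun μ => mono (μ ::ₘ m) (k.erase μ)).sum := by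
  rw [gammaDer, polyDer_mono, derMono]
  simp [mul_comm (mono m _), mom_mul_mono]

/-- On `a_μ a_ν a_ρ` the derivation `a ↦ p` produces three terms, which are exactly three times the
strength-one symmetrization of `∂_μ C_{νρ}`. -/
theorem gamma_hMap (a : Fin N) (f : Poly) : gamma (hMap a f) = CMap a (gammaDer f) := by
  refine poly_ext (f := gamma ∘ₗ hMap a) (g := CMap a ∘ₗ gammaDer.toLinearMap) (fun m k => ?_) f
  change gamma (hMap a (mono m k)) = CMap a (gammaDer (mono m k))
  by_cases hk : k.card = 3
  · obtain ⟨μ, ν, ρ, rfl⟩ := Multiset.card_eq_three.mp hk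
    have e : ∀ μ ν ρ, mono (μ ::ₘ m) {ν, ρ} = mono m 0 * (mom μ * pol ν * pol ρ) := by
      intro μ ν ρ
      rw [mono_pair, ← mom_mul_mono]; ring
    have h0 : gammaDer (mono m 0) = 0 := by simp [gammaDer_mono]
    have h1 : gammaDer (mono m {μ, ν, ρ}) =
        mono (μ ::ₘ m) {ν, ρ} + mono (ν ::ₘ m) {μ, ρ} + mono (ρ ::ₘ m) {μ, ν} := by
      rw [mono_triple, Derivation.leibniz, h0, Derivation.leibniz, Derivation.leibniz, e, e, e]
      simp only [gammaDer, polyDer_pol, smul_eq_mul]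
      ring
    rw [hMap_mono, gamma_hJet, h1, map_add, map_add, CMap_mono, CMap_mono, CMap_mono]
    simp only [sym3, CJet_swap _ a ρ ν, CJet_swap _ a ρ μ, CJet_swap _ a ν μ]
    module
  -- Away from degree three in the polarization both sides vanish: the derivation lowers that degree
  -- by one, so `CMap` never sees degree two.
  · have h1 : hMap a (mono m k) = 0 := by
      rw [hMap, polyLift_mono, symFun₃_of_card _ hk]
    rw [h1, map_zero, eq_comm, gammaDer_mono, map_multiset_sum, Multiset.map_map]
    refine Multiset.sum_eq_zero fun x hx => ?_
    obtain ⟨μ, hμ, rfl⟩ := Multiset.mem_map.mp hx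
    rw [Function.comp_apply, CMap, polyLift_mono, symFun₂_of_card]
    rw [Multiset.card_erase_of_mem hμ]
    have : 0 < k.card := Multiset.card_pos_iff_exists_mem.mpr ⟨μ, hμ⟩
    rw [Nat.pred_eq_sub_one]
    omega

open scoped TensorProduct

/-! # Symbols of products of three fields -/

/-- Symbols of products of three fields. -/
def Poly₃ : Type := Poly ⊗[ℝ] (Poly ⊗[ℝ] Poly)

instance : CommRing Poly₃ := inferInstanceAs (CommRing (Poly ⊗[ℝ] (Poly ⊗[ℝ] Poly)))

instance : Algebra ℝ Poly₃ := inferInstanceAs (Algebra ℝ (Poly ⊗[ℝ] (Poly ⊗[ℝ] Poly)))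

/-- The identification of `Poly₃` with the tensor product. -/
def tensorEquiv : Poly ⊗[ℝ] (Poly ⊗[ℝ] Poly) ≃ₐ[ℝ] Poly₃ :=
  AlgEquiv.refl (R := ℝ) (A₁ := Poly ⊗[ℝ] (Poly ⊗[ℝ] Poly))

def slot₁ : Poly →ₐ[ℝ] Poly₃ := tensorEquiv.toAlgHom.comp Algebra.TensorProduct.includeLeft
def slot₂ : Poly →ₐ[ℝ] Poly₃ := tensorEquiv.toAlgHom.comp
  (Algebra.TensorProduct.includeRight.comp Algebra.TensorProduct.includeLeft)
def slot₃ : Poly →ₐ[ℝ] Poly₃ := tensorEquiv.toAlgHom.comp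
  (Algebra.TensorProduct.includeRight.comp Algebra.TensorProduct.includeRight)

theorem slot_mul (x y z : Poly) :
    slot₁ x * slot₂ y * slot₃ z = tensorEquiv (x ⊗ₜ[ℝ] (y ⊗ₜ[ℝ] z)) := by
  have h : x ⊗ₜ[ℝ] (y ⊗ₜ[ℝ] z) = x ⊗ₜ[ℝ] (1 ⊗ₜ[ℝ] 1) * 1 ⊗ₜ[ℝ] (y ⊗ₜ[ℝ] 1)
      * 1 ⊗ₜ[ℝ] (1 ⊗ₜ[ℝ] z) := by
    simp [Algebra.TensorProduct.tmul_mul_tmul]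
  rw [h, map_mul, map_mul]
  rfl

theorem Poly₃.induction {P : Poly₃ → Prop} (h0 : P 0) (ha : ∀ x y, P x → P y → P (x + y))
    (hs : ∀ x y z, P (slot₁ x * slot₂ y * slot₃ z)) (F : Poly₃) : P F := by
  obtain ⟨F, rfl⟩ := tensorEquiv.surjective F
  induction F using TensorProduct.induction_on with
  | zero => rw [map_zero]; exact h0
  | add x y hx hy => rw [map_add]; exact ha _ _ hx hy
  | tmul x u =>
    induction u using TensorProduct.induction_on with
    | zero => rw [TensorProduct.tmul_zero, map_zero]; exact h0
    | add u v hu hv => rw [TensorProduct.tmul_add, map_add]; exact ha _ _ hu hv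
    | tmul y z => rw [← slot_mul]; exact hs x y z

/-- The local function with a given symbol. -/
def quantize (φ₁ φ₂ φ₃ : Poly →ₗ[ℝ] BRST N) : Poly₃ →ₗ[ℝ] BRST N :=
  (TensorProduct.lift ((LinearMap.mul ℝ (BRST N)).compl₁₂ φ₁
    (TensorProduct.lift ((LinearMap.mul ℝ (BRST N)).compl₁₂ φ₂ φ₃)))) ∘ₗ
    tensorEquiv.symm.toLinearMap

theorem quantize_slot (φ₁ φ₂ φ₃ : Poly →ₗ[ℝ] BRST N) (x y z : Poly) :
    quantize φ₁ φ₂ φ₃ (slot₁ x * slot₂ y * slot₃ z) = φ₁ x * φ₂ y * φ₃ z := by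
  rw [slot_mul]; simp [quantize, mul_assoc]

/-- The algebra homomorphism that sends the three slots to given homomorphisms. -/
def rearrange (i j k : Poly →ₐ[ℝ] Poly₃) : Poly₃ →ₐ[ℝ] Poly₃ :=
  (Algebra.TensorProduct.lift i
    (Algebra.TensorProduct.lift j k fun _ _ => Commute.all _ _) fun _ _ => Commute.all _ _).comp
    tensorEquiv.symm.toAlgHom

@[simp] theorem rearrange_slot₁ (i j k : Poly →ₐ[ℝ] Poly₃) (x : Poly) :
    rearrange i j k (slot₁ x) = i x := by simp [rearrange, slot₁]

@[simp] theorem rearrange_slot₂ (i j k : Poly →ₐ[ℝ] Poly₃) (x : Poly) :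
    rearrange i j k (slot₂ x) = j x := by simp [rearrange, slot₂]

@[simp] theorem rearrange_slot₃ (i j k : Poly →ₐ[ℝ] Poly₃) (x : Poly) :
    rearrange i j k (slot₃ x) = k x := by simp [rearrange, slot₃]

/-- The linear map acting by given linear maps on the three slots, with the Leibniz rule. -/
def slotLin (d₁ d₂ d₃ : Poly →ₗ[ℝ] Poly) : Poly₃ →ₗ[ℝ] Poly₃ :=
  tensorEquiv.toLinearMap ∘ₗ (TensorProduct.map d₁ LinearMap.id
    + TensorProduct.map LinearMap.id (TensorProduct.map d₂ LinearMap.id)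
    + TensorProduct.map LinearMap.id (TensorProduct.map LinearMap.id d₃)) ∘ₗ
    tensorEquiv.symm.toLinearMap

theorem slotLin_mul (d₁ d₂ d₃ : Poly →ₗ[ℝ] Poly) (x y z : Poly) :
    slotLin d₁ d₂ d₃ (slot₁ x * slot₂ y * slot₃ z) = slot₁ (d₁ x) * slot₂ y * slot₃ z
      + slot₁ x * slot₂ (d₂ y) * slot₃ z + slot₁ x * slot₂ y * slot₃ (d₃ z) := by
  simp only [slot_mul]
  simp [slotLin]

/-- The derivation acting by given derivations on the three slots. -/
def slotDer (d₁ d₂ d₃ : Derivation ℝ Poly Poly) : Derivation ℝ Poly₃ Poly₃ :=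
  Derivation.mk' (slotLin d₁.toLinearMap d₂.toLinearMap d₃.toLinearMap) (by
    intro F G
    induction F using Poly₃.induction with
    | h0 => simp
    | ha x x' hx hx' => rw [add_mul, map_add, hx, hx', map_add]; simp only [smul_eq_mul]; ring
    | hs x y z =>
      induction G using Poly₃.induction with
      | h0 => simp
      | ha x x' hx hx' => rw [mul_add, map_add, hx, hx', map_add]; simp only [smul_eq_mul]; ring
      | hs x' y' z' =>
        have e : slot₁ x * slot₂ y * slot₃ z * (slot₁ x' * slot₂ y' * slot₃ z') =
            slot₁ (x * x') * slot₂ (y * y') * slot₃ (z * z') := by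
          simp only [map_mul]; ring
        rw [e, slotLin_mul, slotLin_mul, slotLin_mul]
        simp only [Derivation.coeFn_coe, Derivation.leibniz, smul_eq_mul, map_add,
          map_mul]
        ring)

theorem slotDer_mul (d₁ d₂ d₃ : Derivation ℝ Poly Poly) (x y z : Poly) :
    slotDer d₁ d₂ d₃ (slot₁ x * slot₂ y * slot₃ z) = slot₁ (d₁ x) * slot₂ y * slot₃ z
      + slot₁ x * slot₂ (d₂ y) * slot₃ z + slot₁ x * slot₂ y * slot₃ (d₃ z) :=
  slotLin_mul _ _ _ x y z

theorem slotDer_slot₁ (d₁ d₂ d₃ : Derivation ℝ Poly Poly) (x : Poly) :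
    slotDer d₁ d₂ d₃ (slot₁ x) = slot₁ (d₁ x) := by
  simpa using slotDer_mul d₁ d₂ d₃ x 1 1

theorem slotDer_slot₂ (d₁ d₂ d₃ : Derivation ℝ Poly Poly) (x : Poly) :
    slotDer d₁ d₂ d₃ (slot₂ x) = slot₂ (d₂ x) := by
  simpa using slotDer_mul d₁ d₂ d₃ 1 x 1

theorem slotDer_slot₃ (d₁ d₂ d₃ : Derivation ℝ Poly Poly) (x : Poly) :
    slotDer d₁ d₂ d₃ (slot₃ x) = slot₃ (d₃ x) := by
  simpa using slotDer_mul d₁ d₂ d₃ 1 1 x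

/-! # Total divergences -/

/-- The total divergences. -/
def totalDivs (N : ℕ) : Submodule ℝ (BRST N) where
  carrier := {x | IsTotalDiv x}
  add_mem' := by
    rintro _ _ ⟨j, rfl⟩ ⟨k, rfl⟩
    exact ⟨j + k, by simp [Finset.sum_add_distrib]⟩
  zero_mem' := ⟨0, by simp⟩
  smul_mem' := by
    rintro c _ ⟨j, rfl⟩
    exact ⟨c • j, by simp [Finset.smul_sum]⟩

theorem totalDeriv_mem (κ : Fin 5) (y : BRST N) : totalDeriv κ y ∈ totalDivs N :=
  ⟨Pi.single κ y, by
    rw [Finset.sum_eq_single κ] <;> simp +contextual [Pi.single_apply]⟩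

/-- The total momentum. -/
def totalMom (κ : Fin 5) : Poly₃ := slot₁ (mom κ) + slot₂ (mom κ) + slot₃ (mom κ)

/-- The Leibniz rule distributes the derivative over the three factors, and each factor turns it
into its own momentum. -/
theorem totalDeriv_quantize {φ₁ φ₂ φ₃ : Poly →ₗ[ℝ] BRST N} (h₁ : Translates φ₁)
    (h₂ : Translates φ₂) (h₃ : Translates φ₃) (κ : Fin 5) (F : Poly₃) :
    totalDeriv κ (quantize φ₁ φ₂ φ₃ F) = quantize φ₁ φ₂ φ₃ (F * totalMom κ) := by
  induction F using Poly₃.induction with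
  | h0 => simp
  | ha x y hx hy => rw [map_add, map_add, hx, hy, add_mul, map_add]
  | hs x y z =>
    have e : slot₁ x * slot₂ y * slot₃ z * totalMom κ = slot₁ (mom κ * x) * slot₂ y * slot₃ z
        + slot₁ x * slot₂ (mom κ * y) * slot₃ z + slot₁ x * slot₂ y * slot₃ (mom κ * z) := by
      simp only [totalMom, map_mul]; ring
    rw [e, map_add, map_add]
    simp only [quantize_slot]
    rw [totalDeriv_mul, totalDeriv_mul, h₁, h₂, h₃, add_mul]

/-- The ideal generated by the total momentum. -/
def momIdeal : Ideal Poly₃ := Ideal.span (Set.range totalMom)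

/-- A multiple of a generator of `momIdeal` quantizes to a total derivative; hence integration by
parts may be replaced by calculation in the quotient ring. -/
theorem quantize_mem_totalDivs {φ₁ φ₂ φ₃ : Poly →ₗ[ℝ] BRST N} (h₁ : Translates φ₁)
    (h₂ : Translates φ₂) (h₃ : Translates φ₃) {F : Poly₃} (hF : F ∈ momIdeal) :
    quantize φ₁ φ₂ φ₃ F ∈ totalDivs N := by
  -- Since `quantize` is only linear, the claim must be strengthened to all multiples of `F` for the
  -- induction over the ideal to close.
  suffices H : ∀ G, quantize φ₁ φ₂ φ₃ (G * F) ∈ totalDivs N by simpa using H 1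
  induction hF using Submodule.span_induction with
  | mem x hx =>
    obtain ⟨κ, rfl⟩ := hx
    intro G
    rw [← totalDeriv_quantize h₁ h₂ h₃]
    exact totalDeriv_mem _ _
  | zero => intro G; simp
  | add x y _ _ hx hy => intro G; rw [mul_add, map_add]; exact add_mem (hx G) (hy G)
  | smul a x _ hx => intro G; rw [smul_eq_mul, ← mul_assoc]; exact hx _

/-- The momentum-conserving quotient of the algebra of symbols. -/
abbrev onShell : Poly₃ →ₐ[ℝ] (Poly₃ ⧸ momIdeal) := Ideal.Quotient.mkₐ ℝ momIdeal

theorem onShell_momentum : (fun μ => onShell (slot₁ (mom μ))) + (fun μ => onShell (slot₂ (mom μ)))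
    + (fun μ => onShell (slot₃ (mom μ))) = 0 := by
  ext κ
  simp only [Pi.add_apply, ← map_add]
  exact Ideal.Quotient.eq_zero_iff_mem.mpr (Ideal.subset_span ⟨κ, rfl⟩)

theorem mem_momIdeal {F : Poly₃} (h : onShell F = 0) : F ∈ momIdeal :=
  Ideal.Quotient.eq_zero_iff_mem.mp h

/-! # Commutation of fields -/

theorem hJet_commute (m : Multiset (Fin 5)) (a : Fin N) (μ ν ρ : Fin 5) (y : BRST N) :
    Commute (hJet m a μ ν ρ) y := by
  induction y using BRST.induction with
  | hc r => exact (Algebra.commutes r _).symm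
  | hg x => exact gen_commute_of_even _ _ rfl
  | hm u v hu hv => exact hu.mul_right hv
  | ha u v hu hv => exact hu.add_right hv

theorem hMap_commute (a : Fin N) (f : Poly) (y : BRST N) : Commute (hMap a f) y := by
  induction f using Poly.induction with
  | h0 => rw [map_zero]; exact Commute.zero_left y
  | ha f g hf hg => rw [map_add]; exact hf.add_left hg
  | hs r m k =>
    rw [map_smul, hMap, polyLift_mono]
    refine Commute.smul_left ?_ r
    unfold symFun₃; split
    · exact hJet_commute _ _ _ _ _ y
    · exact Commute.zero_left y

theorem parityInv_hMap (a : Fin N) (f : Poly) : parityInv (hMap a f) = hMap a f := by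
  refine poly_ext (f := parityInv.toLinearMap ∘ₗ hMap a) (g := hMap a) (fun m k => ?_) f
  change parityInv (hMap a (mono m k)) = hMap a (mono m k)
  rw [hMap, polyLift_mono]
  unfold symFun₃; split
  · exact parityInv_hJet _ _ _ _ _
  · exact map_zero _

theorem CMap_anticomm (a b : Fin N) (f g : Poly) :
    CMap a f * CMap b g = -(CMap b g * CMap a f) := by
  induction f using Poly.induction with
  | h0 => simp
  | ha x y hx hy => rw [map_add, add_mul, mul_add, hx, hy]; abel
  | hs r m k =>
    induction g using Poly.induction with
    | h0 => simp
    | ha x y hx hy => rw [map_add, add_mul, mul_add, hx, hy]; abel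
    | hs r' m' k' =>
      rw [map_smul, map_smul, smul_mul_smul_comm, smul_mul_smul_comm, mul_comm r' r, ← smul_neg]
      congr 1
      rw [CMap, CMap, polyLift_mono, polyLift_mono]
      unfold symFun₂; split
      · split
        · refine (gen_comm _ _).trans ?_
          simp only [Var.odd, koszul, Bool.and_self, if_true, neg_smul, one_smul]
          rfl
        · simp
      · simp

/-- The fields are even and commute with everything, so whichever field `γ` turns into a ghost can
be moved to the front without a sign. `rearrange` permutes the slots of the symbol accordingly. -/
theorem gamma_quantize (a b c : Fin N) (F : Poly₃) :
    gamma (quantize (hMap a) (hMap b) (hMap c) F) =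
      quantize (CMap a) (hMap b) (hMap c) (slotDer gammaDer 0 0 F)
      + quantize (CMap b) (hMap a) (hMap c)
          (rearrange slot₂ slot₁ slot₃ (slotDer 0 gammaDer 0 F))
      + quantize (CMap c) (hMap a) (hMap b)
          (rearrange slot₂ slot₃ slot₁ (slotDer 0 0 gammaDer F)) := by
  induction F using Poly₃.induction with
  | h0 => simp
  | ha x y hx hy => simp only [map_add, hx, hy]; abel
  | hs x y z =>
    have e1 : ∀ x y z : Poly, slot₂ x * slot₁ y * slot₃ z = slot₁ y * slot₂ x * slot₃ z :=
      fun x y z => by ring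
    have e2 : ∀ x y z : Poly, slot₂ x * slot₃ y * slot₁ z = slot₁ z * slot₂ x * slot₃ y :=
      fun x y z => by ring
    simp only [slotDer_mul, quantize_slot, gamma_mul, map_mul, gamma_hMap, parityInv_hMap,
      Derivation.coe_zero, Pi.zero_apply, map_zero, mul_zero, zero_mul, add_zero, zero_add,
      rearrange_slot₁, rearrange_slot₂, rearrange_slot₃, e1, e2, add_mul]
    rw [(hMap_commute a x _).eq, ((hMap_commute a x _).mul_left (hMap_commute b y _)).eq,
      ← mul_assoc (CMap c _)]

theorem mom_eq_zero_mono (κ : Fin 5) : mom κ = mono {κ} 0 := rfl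

theorem hMap_mom_zero (a : Fin N) (μ ν ρ : Fin 5) :
    hMap a (pol μ * pol ν * pol ρ) = hJet 0 a μ ν ρ := by rw [pol_mul₃, hMap_mono]

theorem hMap_mom (a : Fin N) (κ μ ν ρ : Fin 5) :
    hMap a (mom κ * (pol μ * pol ν * pol ρ)) = hJet {κ} a μ ν ρ := by
  rw [pol_mul₃, mom_mul_mono, hMap_mono]; rfl

theorem hMap_mom₂ (a : Fin N) (κ l μ ν ρ : Fin 5) :
    hMap a (mom κ * mom l * (pol μ * pol ν * pol ρ)) = hJet {κ, l} a μ ν ρ := by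
  rw [pol_mul₃, mul_assoc, mom_mul_mono, mom_mul_mono, hMap_mono]; rfl

theorem hMap_mom₃ (a : Fin N) (κ l s μ ν ρ : Fin 5) :
    hMap a (mom κ * mom l * mom s * (pol μ * pol ν * pol ρ)) = hJet {κ, l, s} a μ ν ρ := by
  rw [pol_mul₃, mul_assoc, mul_assoc, mom_mul_mono, mom_mul_mono, mom_mul_mono, hMap_mono]; rfl

theorem CMap_mom (a : Fin N) (κ μ ν : Fin 5) :
    CMap a (mom κ * (pol μ * pol ν)) = CJet {κ} a μ ν := by
  rw [pol_mul₂, mom_mul_mono, CMap_mono]; rfl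

theorem CMap_mom₃ (a : Fin N) (κ l s μ ν : Fin 5) :
    CMap a (mom κ * mom l * mom s * (pol μ * pol ν)) = CJet {κ, l, s} a μ ν := by
  rw [pol_mul₂, mul_assoc, mul_assoc, mom_mul_mono, mom_mul_mono, mom_mul_mono, CMap_mono]; rfl

theorem hMap_connSymbol (c : Fin N) (l σ τ α β : Fin 5) :
    hMap c (connSymbol mom pol l σ τ α β) = conn c l σ τ α β := by
  simp only [connSymbol, conn, map_sub, map_add, map_smul, map_sym3, hMap_mom₂]

theorem CMap_curlSymbol (b : Fin N) (ν ρ β : Fin 5) :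
    CMap b (curlSymbol mom pol ν ρ β) = curlC 0 b ν ρ β := by
  simp only [curlSymbol, curlC, map_sub, map_smul, CMap_mom]; rfl

theorem hMap_fronsdalSymbol (a : Fin N) (μ ν ρ : Fin 5) :
    hMap a (fronsdalSymbol mom pol μ ν ρ) = fronsdal 0 a μ ν ρ := by
  simp only [fronsdalSymbol, fronsdal, map_sub, map_add, map_smul, map_sym3, hMap_mom₂, map_sum,
    hTr]
  rfl

theorem hMap_eomSymbol (a : Fin N) (μ ν ρ : Fin 5) :
    hMap a (eomSymbol mom pol μ ν ρ) = eom 0 a μ ν ρ := by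
  simp only [eomSymbol, eom, map_sub, map_smul, map_sym3, map_sum, hMap_fronsdalSymbol]

/-- The coefficients in the connection are tuned so that, under `a ↦ p`, every structure other than
`p_τ p_α p_β a_ρ a_σ` cancels. -/
theorem gamma_conn (c : Fin N) (ρ σ τ α β : Fin 5) :
    gamma (conn c ρ σ τ α β) = (3 : ℝ) • CJet {τ, α, β} c ρ σ := by
  rw [← hMap_connSymbol, gamma_hMap, ← CMap_mom₃, ← map_smul]
  congr 1
  have hp : ∀ μ, gammaDer (mom μ) = 0 := fun μ => polyDer_mom _ _ μ
  have ha : ∀ μ, gammaDer (pol μ) = mom μ := fun μ => polyDer_pol _ _ μ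
  simp only [connSymbol, sym3, map_sub, map_add, Derivation.map_smul, Derivation.leibniz, hp, ha,
    smul_eq_mul]
  algebra

/-! # The symbol of `δ a₁` -/

section Map
variable {Q Q' : Type*} [CommRing Q] [Algebra ℝ Q] [CommRing Q'] [Algebra ℝ Q'] (π : Q →ₐ[ℝ] Q')

theorem map_sym3' (T : Fin 5 → Fin 5 → Fin 5 → Q) (μ ν ρ : Fin 5) :
    π (sym3 T μ ν ρ) = sym3 (fun μ ν ρ => π (T μ ν ρ)) μ ν ρ := map_sym3 π.toLinearMap T μ ν ρ

/-- Symbols are natural under algebra homomorphisms. The same formulas can thus be moved into a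
slot, relabelled by `rearrange`, or reduced modulo total momentum. -/
theorem fronsdalSymbol_map (p a : Fin 5 → Q) (μ ν ρ : Fin 5) :
    π (fronsdalSymbol p a μ ν ρ) = fronsdalSymbol (fun μ => π (p μ)) (fun μ => π (a μ)) μ ν ρ := by
  simp only [fronsdalSymbol, map_sub, map_add, map_smul, map_sym3', map_sum, map_mul]

theorem eomSymbol_map (p a : Fin 5 → Q) (μ ν ρ : Fin 5) :
    π (eomSymbol p a μ ν ρ) = eomSymbol (fun μ => π (p μ)) (fun μ => π (a μ)) μ ν ρ := by
  simp only [eomSymbol, map_sub, map_smul, map_sym3', map_sum, fronsdalSymbol_map]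

theorem connSymbol_map (p a : Fin 5 → Q) (l σ τ α β : Fin 5) :
    π (connSymbol p a l σ τ α β) =
      connSymbol (fun μ => π (p μ)) (fun μ => π (a μ)) l σ τ α β := by
  simp only [connSymbol, map_sub, map_add, map_smul, map_sym3', map_mul]

theorem curlSymbol_map (p a : Fin 5 → Q) (ν ρ β : Fin 5) :
    π (curlSymbol p a ν ρ β) = curlSymbol (fun μ => π (p μ)) (fun μ => π (a μ)) ν ρ β := by
  simp only [curlSymbol, map_sub, map_smul, map_mul]

theorem sourceSymbol_map (p a q b r c : Fin 5 → Q) :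
    π (sourceSymbol p a q b r c) = sourceSymbol (fun μ => π (p μ)) (fun μ => π (a μ))
      (fun μ => π (q μ)) (fun μ => π (b μ)) (fun μ => π (r μ)) (fun μ => π (c μ)) := by
  simp only [sourceSymbol, map_sum, map_smul, map_mul, map_sub, curlSymbol_map, eomSymbol_map,
    connSymbol_map]

theorem variationSymbol_map (p a q b r c : Fin 5 → Q) :
    π (variationSymbol p a q b r c) = variationSymbol (fun μ => π (p μ)) (fun μ => π (a μ))
      (fun μ => π (q μ)) (fun μ => π (b μ)) (fun μ => π (r μ)) (fun μ => π (c μ)) := by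
  simp only [variationSymbol, vertexSymbol, vertexSymbol₁, vertexSymbol₂, vertexSymbol₃, map_add,
    map_sub, map_neg, map_smul, map_mul, dot_map, eps5_map, sourceSymbol_map]

end Map

/-- The momentum vector of the first field. -/
def mom₁ (μ : Fin 5) : Poly₃ := slot₁ (mom μ)
/-- The momentum vector of the second field. -/
def mom₂ (μ : Fin 5) : Poly₃ := slot₂ (mom μ)
/-- The momentum vector of the third field. -/
def mom₃ (μ : Fin 5) : Poly₃ := slot₃ (mom μ)
/-- The polarization vector of the first field. -/
def pol₁ (μ : Fin 5) : Poly₃ := slot₁ (pol μ)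
/-- The polarization vector of the second field. -/
def pol₂ (μ : Fin 5) : Poly₃ := slot₂ (pol μ)
/-- The polarization vector of the third field. -/
def pol₃ (μ : Fin 5) : Poly₃ := slot₃ (pol μ)

theorem slot₁_curlSymbol (ν ρ l : Fin 5) :
    curlSymbol mom₁ pol₁ ν ρ l = slot₁ (curlSymbol mom pol ν ρ l) := by
  rw [curlSymbol_map]; rfl
theorem slot₂_eomSymbol (μ α β : Fin 5) :
    eomSymbol mom₂ pol₂ α β μ = slot₂ (eomSymbol mom pol α β μ) := by
  rw [eomSymbol_map]; rfl
theorem slot₃_connSymbol (l σ τ α β : Fin 5) :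
    connSymbol mom₃ pol₃ l σ τ α β = slot₃ (connSymbol mom pol l σ τ α β) := by
  rw [connSymbol_map]; rfl
theorem slot₃_connSymbol_antisymm (l σ τ α β : Fin 5) :
    ((1 / 2 : ℝ) • (connSymbol mom₃ pol₃ l σ τ α β
        - connSymbol mom₃ pol₃ l τ σ α β)) =
      slot₃ ((1 / 2 : ℝ) • (connSymbol mom pol l σ τ α β - connSymbol mom pol l τ σ α β)) := by
  rw [map_smul, map_sub, slot₃_connSymbol, slot₃_connSymbol]
theorem slot_source (ν ρ l α β μ σ τ : Fin 5) : curlSymbol mom₁ pol₁ ν ρ l *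
      eomSymbol mom₂ pol₂ α β μ * ((1 / 2 : ℝ) • (connSymbol mom₃ pol₃ l σ τ α β
        - connSymbol mom₃ pol₃ l τ σ α β)) =
    slot₁ (curlSymbol mom pol ν ρ l) * slot₂ (eomSymbol mom pol α β μ) *
      slot₃ ((1 / 2 : ℝ) • (connSymbol mom pol l σ τ α β - connSymbol mom pol l τ σ α β)) := by
  rw [slot₁_curlSymbol, slot₂_eomSymbol, slot₃_connSymbol_antisymm]

theorem delta_source_term (a b c : Fin N) (μ ν ρ σ τ α β l : Fin 5) :
    delta (hsJet 0 a α β μ * curlC 0 b ν ρ l *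
      ((1 / 2 : ℝ) • (conn c l σ τ α β - conn c l τ σ α β))) =
    eom 0 a α β μ * curlC 0 b ν ρ l *
      ((1 / 2 : ℝ) • (conn c l σ τ α β - conn c l τ σ α β)) := by
  rw [delta_mul, delta_mul, delta_hsJet]
  simp only [map_smul, map_sub, delta_conn, delta_curlC, sub_self, smul_zero, mul_zero, add_zero]

/-- Only the antifield is affected by `δ`, and the field equations that replace it are even; they
pass the ghost and take the second slot, leaving the ghost in the first. -/
theorem delta_source (a b c : Fin N) (μ ν ρ σ τ α β l : Fin 5) :
    delta (hsJet 0 a α β μ * curlC 0 b ν ρ l *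
      ((1 / 2 : ℝ) • (conn c l σ τ α β - conn c l τ σ α β))) =
    quantize (CMap b) (hMap a) (hMap c) (curlSymbol mom₁ pol₁ ν ρ l * eomSymbol mom₂ pol₂ α β μ *
      ((1 / 2 : ℝ) • (connSymbol mom₃ pol₃ l σ τ α β - connSymbol mom₃ pol₃ l τ σ α β))) := by
  rw [slot_source, quantize_slot, map_smul, map_sub, hMap_connSymbol, hMap_connSymbol,
    CMap_curlSymbol, ← (hMap_commute a _ _).eq, hMap_eomSymbol, delta_source_term]

theorem map_sourceSymbol {Q M : Type*} [CommRing Q] [Algebra ℝ Q] [AddCommGroup M] [Module ℝ M]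
    (L : Q →ₗ[ℝ] M) (p a q b r c : Fin 5 → Q) : L (sourceSymbol p a q b r c) =
    ∑ μ, ∑ ν, ∑ ρ, ∑ σ, ∑ τ, eps μ ν ρ σ τ • ∑ α, ∑ β, ∑ l, (sgn α * sgn β * sgn l) •
    L (curlSymbol p a ν ρ l * eomSymbol q b α β μ *
      ((1 / 2 : ℝ) • (connSymbol r c l σ τ α β - connSymbol r c l τ σ α β))) := by
  rw [sourceSymbol]
  iterate 5 (rw [map_sum]; refine Finset.sum_congr rfl fun _ _ => ?_)
  rw [LinearMap.map_smul]
  refine congrArg (_ • ·) ?_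
  iterate 3 (rw [map_sum]; refine Finset.sum_congr rfl fun _ _ => ?_)
  rw [LinearMap.map_smul]

theorem delta_a1 (g : Fin N → Fin N → Fin N → ℝ) :
    delta (a1 g) = ∑ a, ∑ b, ∑ c, g a b c • quantize (CMap b) (hMap a) (hMap c)
      (sourceSymbol mom₁ pol₁ mom₂ pol₂ mom₃ pol₃) := by
  rw [a1]
  iterate 3 (rw [map_sum]; refine Finset.sum_congr rfl fun _ _ => ?_)
  rw [LinearMap.map_smul, map_sourceSymbol]
  refine congrArg (_ • ·) ?_
  iterate 5 (rw [map_sum]; refine Finset.sum_congr rfl fun _ _ => ?_)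
  rw [LinearMap.map_smul]
  refine congrArg (_ • ·) ?_
  iterate 3 (rw [map_sum]; refine Finset.sum_congr rfl fun _ _ => ?_)
  rw [LinearMap.map_smul, delta_source]

/-! # The symbol of the vertex -/

theorem hMap_hTr (m : Multiset (Fin 5)) (a : Fin N) (μ : Fin 5) :
    hMap a (mono m 0 * (pol μ * dot pol pol)) = hTr m a μ := by
  have h : mono m 0 * (pol μ * dot pol pol) = ∑ α, sgn α • mono m {μ, α, α} := by
    simp only [mono_triple, dot, Finset.mul_sum, mul_smul_comm, mul_assoc]
  rw [h, map_sum]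
  simp only [map_smul, hMap_mono, hTr]

section Dot
variable {Q : Type*} [CommRing Q] [Algebra ℝ Q]

/-- This and the next three lemmas expand a product of scalar products into the nested index sums in
which the vertex is written. -/
theorem mul_dot_1 (K : Q) (u v : Fin 5 → Q) :
    K * dot u v = ∑ α, sgn α • (K * (u α * v α)) := by
  simp only [dot, Finset.mul_sum, mul_smul_comm]

theorem mul_dot_2 (K : Q) (u v u' v' : Fin 5 → Q) :
    K * (dot u v * dot u' v') =
      ∑ α, ∑ β, (sgn α * sgn β) • (K * ((u α * v α) * (u' β * v' β))) := by
  rw [mul_comm (dot u v), ← mul_assoc, mul_dot_1]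
  refine Finset.sum_congr rfl fun α _ => ?_
  rw [mul_right_comm, mul_dot_1, Finset.smul_sum]
  refine Finset.sum_congr rfl fun β _ => ?_
  rw [smul_smul, mul_assoc]

theorem mul_dot_3 (K : Q) (u v u' v' u'' v'' : Fin 5 → Q) :
    K * (dot u v * dot u' v' * dot u'' v'') = ∑ α, ∑ β, ∑ γ,
      (sgn α * sgn β * sgn γ) • (K * ((u α * v α) * (u' β * v' β) * (u'' γ * v'' γ))) := by
  rw [mul_comm (_ * _) (dot u'' v''), ← mul_assoc, mul_dot_2]
  refine Finset.sum_congr rfl fun α _ => Finset.sum_congr rfl fun β _ => ?_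
  rw [mul_right_comm K, mul_dot_1, Finset.smul_sum]
  refine Finset.sum_congr rfl fun γ _ => ?_
  rw [smul_smul, mul_assoc K]

theorem mul_dot_4 (K : Q) (u v u' v' u'' v'' x y : Fin 5 → Q) :
    K * (dot u v * dot u' v' * dot u'' v'' * dot x y) = ∑ α, ∑ β, ∑ γ, ∑ δ,
      (sgn α * sgn β * sgn γ * sgn δ) •
        (K * ((u α * v α) * (u' β * v' β) * (u'' γ * v'' γ) * (x δ * y δ))) := by
  rw [mul_comm (_ * _) (dot x y), ← mul_assoc, mul_dot_3]
  refine Finset.sum_congr rfl fun α _ => Finset.sum_congr rfl fun β _ =>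
    Finset.sum_congr rfl fun γ _ => ?_
  rw [mul_right_comm K, mul_dot_1, Finset.smul_sum]
  refine Finset.sum_congr rfl fun δ _ => ?_
  rw [smul_smul, mul_assoc K]

end Dot

theorem hTr_symbol (a : Fin N) (μ : Fin 5) : hTr 0 a μ = hMap a (pol μ * dot pol pol) := by
  rw [← hMap_hTr, show mono 0 0 = 1 from rfl, one_mul]

theorem hTr_symbol₁ (a : Fin N) (κ μ : Fin 5) :
    hTr {κ} a μ = hMap a (mom κ * (pol μ * dot pol pol)) := (hMap_hTr {κ} a μ).symm

theorem hTr_symbol₂ (a : Fin N) (κ l μ : Fin 5) :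
    hTr {κ, l} a μ = hMap a (mom κ * mom l * (pol μ * dot pol pol)) := by
  rw [← hMap_hTr, mom_eq_zero_mono l, mom_mul_mono]; rfl

theorem hTr_symbol₃ (a : Fin N) (κ l s μ : Fin 5) :
    hTr {κ, l, s} a μ = hMap a (mom κ * mom l * mom s * (pol μ * dot pol pol)) := by
  rw [← hMap_hTr, mul_assoc (mom κ), mom_eq_zero_mono s, mom_mul_mono, mom_mul_mono]; rfl

theorem boxH_symbol (a : Fin N) (κ μ ν ρ : Fin 5) :
    boxH {κ} a μ ν ρ = hMap a (mom κ * dot mom mom * (pol μ * pol ν * pol ρ)) := by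
  rw [mul_right_comm, mul_dot_1, map_sum, boxH]
  refine Finset.sum_congr rfl fun α _ => ?_
  rw [map_smul, mul_comm, ← mul_assoc, hMap_mom₃]; rfl

theorem boxTr_symbol (a : Fin N) (κ μ : Fin 5) :
    boxTr {κ} a μ = hMap a (mom κ * dot mom mom * (pol μ * dot pol pol)) := by
  rw [mul_right_comm, mul_dot_1, map_sum, boxTr]
  refine Finset.sum_congr rfl fun α _ => ?_
  rw [map_smul, mul_comm, ← mul_assoc, ← hTr_symbol₃]; rfl

/-- The factors of a vertex monomial that are contracted with the Levi-Civita density. -/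
def vertexBase (μ ν ρ σ τ : Fin 5) : Poly₃ := mom₁ μ * pol₁ ν * mom₂ ρ * pol₂ σ * pol₃ τ

theorem slot₁_mom (μ : Fin 5) : slot₁ (mom μ) = mom₁ μ := rfl
theorem slot₂_mom (μ : Fin 5) : slot₂ (mom μ) = mom₂ μ := rfl
theorem slot₁_pol (μ : Fin 5) : slot₁ (pol μ) = pol₁ μ := rfl
theorem slot₂_pol (μ : Fin 5) : slot₂ (pol μ) = pol₂ μ := rfl
theorem slot₃_pol (μ : Fin 5) : slot₃ (pol μ) = pol₃ μ := rfl

/-- Each of the twelve monomials of the vertex has as symbol `vertexBase`, which carries the indices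
contracted with `ε`, times four scalar products: one for each remaining pair of contracted indices.
-/
theorem vertexTerm_traces (a b c : Fin N) (μ ν ρ σ τ : Fin 5) :
    (boxTr {μ} a ν * hTr {ρ} b σ * hTr 0 c τ) =
    quantize (hMap a) (hMap b) (hMap c)
      ((vertexBase μ ν ρ σ τ * dot mom₁ mom₁ * dot pol₁ pol₁ * dot pol₂ pol₂ * dot pol₃ pol₃)) := by
  simp only [boxTr_symbol, boxH_symbol, hTr_symbol, hTr_symbol₁, hTr_symbol₂, hTr_symbol₃,
    ← hMap_mom_zero, ← hMap_mom, ← hMap_mom₂, ← hMap_mom₃]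
  rw [← quantize_slot]
  refine congrArg _ ?_
  simp only [map_mul, dot_map, vertexBase]
  simp only [slot₁_mom, slot₂_mom, slot₁_pol, slot₂_pol, slot₃_pol]
  ring

theorem vertexTerm_hess_trace (a b c : Fin N) (μ ν ρ σ τ : Fin 5) :
    ∑ α, ∑ β, (sgn α * sgn β) •
      (hTr {μ, α, β} a ν * hJet {ρ} b σ α β * hTr 0 c τ) =
    quantize (hMap a) (hMap b) (hMap c)
      ((vertexBase μ ν ρ σ τ * dot pol₁ pol₁ * dot pol₃ pol₃) * (dot mom₁ pol₂ * dot mom₁ pol₂)) := by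
  rw [mul_dot_2]
  rw [map_sum]
  refine Finset.sum_congr rfl fun α _ => ?_
  rw [map_sum]
  refine Finset.sum_congr rfl fun β _ => ?_
  rw [LinearMap.map_smul]
  refine congrArg (_ • ·) ?_
  simp only [boxTr_symbol, boxH_symbol, hTr_symbol, hTr_symbol₁, hTr_symbol₂, hTr_symbol₃,
    ← hMap_mom_zero, ← hMap_mom, ← hMap_mom₂, ← hMap_mom₃]
  rw [← quantize_slot]
  refine congrArg _ ?_
  simp only [map_mul, dot_map, vertexBase]
  simp only [slot₁_mom, slot₂_mom, slot₁_pol, slot₂_pol, slot₃_pol]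
  ring

theorem vertexTerm_box_trace (a b c : Fin N) (μ ν ρ σ τ : Fin 5) :
    ∑ α, ∑ β, (sgn α * sgn β) •
      (boxH {μ} a ν α β * hJet {ρ} b σ α β * hTr 0 c τ) =
    quantize (hMap a) (hMap b) (hMap c)
      ((vertexBase μ ν ρ σ τ * dot mom₁ mom₁ * dot pol₃ pol₃) * (dot pol₁ pol₂ * dot pol₁ pol₂)) := by
  rw [mul_dot_2]
  rw [map_sum]
  refine Finset.sum_congr rfl fun α _ => ?_
  rw [map_sum]
  refine Finset.sum_congr rfl fun β _ => ?_
  rw [LinearMap.map_smul]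
  refine congrArg (_ • ·) ?_
  simp only [boxTr_symbol, boxH_symbol, hTr_symbol, hTr_symbol₁, hTr_symbol₂, hTr_symbol₃,
    ← hMap_mom_zero, ← hMap_mom, ← hMap_mom₂, ← hMap_mom₃]
  rw [← quantize_slot]
  refine congrArg _ ?_
  simp only [map_mul, dot_map, vertexBase]
  simp only [slot₁_mom, slot₂_mom, slot₁_pol, slot₂_pol, slot₃_pol]
  ring

theorem vertexTerm_box_square (a b c : Fin N) (μ ν ρ σ τ : Fin 5) :
    ∑ α, ∑ β, (sgn α * sgn β) •
      (boxTr {μ} a ν * hJet {ρ} b σ α β * hJet 0 c τ α β) =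
    quantize (hMap a) (hMap b) (hMap c)
      ((vertexBase μ ν ρ σ τ * dot mom₁ mom₁ * dot pol₁ pol₁) * (dot pol₂ pol₃ * dot pol₂ pol₃)) := by
  rw [mul_dot_2]
  rw [map_sum]
  refine Finset.sum_congr rfl fun α _ => ?_
  rw [map_sum]
  refine Finset.sum_congr rfl fun β _ => ?_
  rw [LinearMap.map_smul]
  refine congrArg (_ • ·) ?_
  simp only [boxTr_symbol, boxH_symbol, hTr_symbol, hTr_symbol₁, hTr_symbol₂, hTr_symbol₃,
    ← hMap_mom_zero, ← hMap_mom, ← hMap_mom₂, ← hMap_mom₃]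
  rw [← quantize_slot]
  refine congrArg _ ?_
  simp only [map_mul, dot_map, vertexBase]
  simp only [slot₁_mom, slot₂_mom, slot₁_pol, slot₂_pol, slot₃_pol]
  ring

theorem vertexTerm_box_triangle (a b c : Fin N) (μ ν ρ σ τ : Fin 5) :
    ∑ α, ∑ β, ∑ γ, (sgn α * sgn β * sgn γ) •
      (boxH {μ} a ν α β * hJet {ρ} b σ α γ * hJet 0 c τ β γ) =
    quantize (hMap a) (hMap b) (hMap c)
      ((vertexBase μ ν ρ σ τ * dot mom₁ mom₁) * (dot pol₁ pol₂ * dot pol₁ pol₃ * dot pol₂ pol₃)) := by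
  rw [mul_dot_3]
  rw [map_sum]
  refine Finset.sum_congr rfl fun α _ => ?_
  rw [map_sum]
  refine Finset.sum_congr rfl fun β _ => ?_
  rw [map_sum]
  refine Finset.sum_congr rfl fun γ _ => ?_
  rw [LinearMap.map_smul]
  refine congrArg (_ • ·) ?_
  simp only [boxTr_symbol, boxH_symbol, hTr_symbol, hTr_symbol₁, hTr_symbol₂, hTr_symbol₃,
    ← hMap_mom_zero, ← hMap_mom, ← hMap_mom₂, ← hMap_mom₃]
  rw [← quantize_slot]
  refine congrArg _ ?_
  simp only [map_mul, dot_map, vertexBase]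
  simp only [slot₁_mom, slot₂_mom, slot₁_pol, slot₂_pol, slot₃_pol]
  ring

theorem vertexTerm_hess_triangle (a b c : Fin N) (μ ν ρ σ τ : Fin 5) :
    ∑ α, ∑ β, ∑ γ, (sgn α * sgn β * sgn γ) •
      (hTr {μ, α, β} a ν * hJet {ρ} b σ α γ * hJet 0 c τ β γ) =
    quantize (hMap a) (hMap b) (hMap c)
      ((vertexBase μ ν ρ σ τ * dot pol₁ pol₁) * (dot mom₁ pol₂ * dot mom₁ pol₃ * dot pol₂ pol₃)) := by
  rw [mul_dot_3]
  rw [map_sum]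
  refine Finset.sum_congr rfl fun α _ => ?_
  rw [map_sum]
  refine Finset.sum_congr rfl fun β _ => ?_
  rw [map_sum]
  refine Finset.sum_congr rfl fun γ _ => ?_
  rw [LinearMap.map_smul]
  refine congrArg (_ • ·) ?_
  simp only [boxTr_symbol, boxH_symbol, hTr_symbol, hTr_symbol₁, hTr_symbol₂, hTr_symbol₃,
    ← hMap_mom_zero, ← hMap_mom, ← hMap_mom₂, ← hMap_mom₃]
  rw [← quantize_slot]
  refine congrArg _ ?_
  simp only [map_mul, dot_map, vertexBase]
  simp only [slot₁_mom, slot₂_mom, slot₁_pol, slot₂_pol, slot₃_pol]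
  ring

theorem vertexTerm_div_trace (a b c : Fin N) (μ ν ρ σ τ : Fin 5) :
    ∑ α, ∑ β, ∑ γ, (sgn α * sgn β * sgn γ) •
      (hJet {μ, α, β} a ν α γ * hTr {ρ} b σ * hJet 0 c τ β γ) =
    quantize (hMap a) (hMap b) (hMap c)
      ((vertexBase μ ν ρ σ τ * dot pol₂ pol₂) * (dot mom₁ pol₁ * dot mom₁ pol₃ * dot pol₁ pol₃)) := by
  rw [mul_dot_3]
  rw [map_sum]
  refine Finset.sum_congr rfl fun α _ => ?_
  rw [map_sum]
  refine Finset.sum_congr rfl fun β _ => ?_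
  rw [map_sum]
  refine Finset.sum_congr rfl fun γ _ => ?_
  rw [LinearMap.map_smul]
  refine congrArg (_ • ·) ?_
  simp only [boxTr_symbol, boxH_symbol, hTr_symbol, hTr_symbol₁, hTr_symbol₂, hTr_symbol₃,
    ← hMap_mom_zero, ← hMap_mom, ← hMap_mom₂, ← hMap_mom₃]
  rw [← quantize_slot]
  refine congrArg _ ?_
  simp only [map_mul, dot_map, vertexBase]
  simp only [slot₁_mom, slot₂_mom, slot₁_pol, slot₂_pol, slot₃_pol]
  ring

theorem vertexTerm_doubleDiv (a b c : Fin N) (μ ν ρ σ τ : Fin 5) :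
    ∑ α, ∑ β, ∑ γ, ∑ δ, (sgn α * sgn β * sgn γ * sgn δ) •
      (hJet {μ, α, β} a ν α β * hJet {ρ} b σ γ δ * hJet 0 c τ γ δ) =
    quantize (hMap a) (hMap b) (hMap c)
      ((vertexBase μ ν ρ σ τ) * (dot mom₁ pol₁ * dot mom₁ pol₁ * dot pol₂ pol₃ * dot pol₂ pol₃)) := by
  rw [mul_dot_4]
  rw [map_sum]
  refine Finset.sum_congr rfl fun α _ => ?_
  rw [map_sum]
  refine Finset.sum_congr rfl fun β _ => ?_
  rw [map_sum]
  refine Finset.sum_congr rfl fun γ _ => ?_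
  rw [map_sum]
  refine Finset.sum_congr rfl fun δ _ => ?_
  rw [LinearMap.map_smul]
  refine congrArg (_ • ·) ?_
  simp only [boxTr_symbol, boxH_symbol, hTr_symbol, hTr_symbol₁, hTr_symbol₂, hTr_symbol₃,
    ← hMap_mom_zero, ← hMap_mom, ← hMap_mom₂, ← hMap_mom₃]
  rw [← quantize_slot]
  refine congrArg _ ?_
  simp only [map_mul, dot_map, vertexBase]
  simp only [slot₁_mom, slot₂_mom, slot₁_pol, slot₂_pol, slot₃_pol]
  ring

theorem vertexTerm_hess_square (a b c : Fin N) (μ ν ρ σ τ : Fin 5) :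
    ∑ α, ∑ β, ∑ γ, ∑ δ, (sgn α * sgn β * sgn γ * sgn δ) •
      (hJet {μ, α, β} a ν γ δ * hJet {ρ} b σ α β * hJet 0 c τ γ δ) =
    quantize (hMap a) (hMap b) (hMap c)
      ((vertexBase μ ν ρ σ τ) * (dot mom₁ pol₂ * dot mom₁ pol₂ * dot pol₁ pol₃ * dot pol₁ pol₃)) := by
  rw [mul_dot_4]
  rw [map_sum]
  refine Finset.sum_congr rfl fun α _ => ?_
  rw [map_sum]
  refine Finset.sum_congr rfl fun β _ => ?_
  rw [map_sum]
  refine Finset.sum_congr rfl fun γ _ => ?_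
  rw [map_sum]
  refine Finset.sum_congr rfl fun δ _ => ?_
  rw [LinearMap.map_smul]
  refine congrArg (_ • ·) ?_
  simp only [boxTr_symbol, boxH_symbol, hTr_symbol, hTr_symbol₁, hTr_symbol₂, hTr_symbol₃,
    ← hMap_mom_zero, ← hMap_mom, ← hMap_mom₂, ← hMap_mom₃]
  rw [← quantize_slot]
  refine congrArg _ ?_
  simp only [map_mul, dot_map, vertexBase]
  simp only [slot₁_mom, slot₂_mom, slot₁_pol, slot₂_pol, slot₃_pol]
  ring

theorem vertexTerm_div_cycle (a b c : Fin N) (μ ν ρ σ τ : Fin 5) :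
    ∑ α, ∑ β, ∑ γ, ∑ δ, (sgn α * sgn β * sgn γ * sgn δ) •
      (hJet {μ, α, β} a ν β γ * hJet {ρ} b σ γ δ * hJet 0 c τ α δ) =
    quantize (hMap a) (hMap b) (hMap c)
      ((vertexBase μ ν ρ σ τ) * (dot mom₁ pol₃ * dot mom₁ pol₁ * dot pol₁ pol₂ * dot pol₂ pol₃)) := by
  rw [mul_dot_4]
  rw [map_sum]
  refine Finset.sum_congr rfl fun α _ => ?_
  rw [map_sum]
  refine Finset.sum_congr rfl fun β _ => ?_
  rw [map_sum]
  refine Finset.sum_congr rfl fun γ _ => ?_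
  rw [map_sum]
  refine Finset.sum_congr rfl fun δ _ => ?_
  rw [LinearMap.map_smul]
  refine congrArg (_ • ·) ?_
  simp only [boxTr_symbol, boxH_symbol, hTr_symbol, hTr_symbol₁, hTr_symbol₂, hTr_symbol₃,
    ← hMap_mom_zero, ← hMap_mom, ← hMap_mom₂, ← hMap_mom₃]
  rw [← quantize_slot]
  refine congrArg _ ?_
  simp only [map_mul, dot_map, vertexBase]
  simp only [slot₁_mom, slot₂_mom, slot₁_pol, slot₂_pol, slot₃_pol]
  ring

theorem vertexTerm_div_gradTrace (a b c : Fin N) (μ ν ρ σ τ : Fin 5) :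
    ∑ α, ∑ β, ∑ γ, (sgn α * sgn β * sgn γ) •
      (hJet {μ, α} a ν α β * hTr {ρ, γ} b σ * hJet 0 c τ β γ) =
    quantize (hMap a) (hMap b) (hMap c)
      ((vertexBase μ ν ρ σ τ * dot pol₂ pol₂) * (dot mom₁ pol₁ * dot pol₁ pol₃ * dot mom₂ pol₃)) := by
  rw [mul_dot_3]
  rw [map_sum]
  refine Finset.sum_congr rfl fun α _ => ?_
  rw [map_sum]
  refine Finset.sum_congr rfl fun β _ => ?_
  rw [map_sum]
  refine Finset.sum_congr rfl fun γ _ => ?_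
  rw [LinearMap.map_smul]
  refine congrArg (_ • ·) ?_
  simp only [boxTr_symbol, boxH_symbol, hTr_symbol, hTr_symbol₁, hTr_symbol₂, hTr_symbol₃,
    ← hMap_mom_zero, ← hMap_mom, ← hMap_mom₂, ← hMap_mom₃]
  rw [← quantize_slot]
  refine congrArg _ ?_
  simp only [map_mul, dot_map, vertexBase]
  simp only [slot₁_mom, slot₂_mom, slot₁_pol, slot₂_pol, slot₃_pol]
  ring

theorem vertexTerm_grad_cycle (a b c : Fin N) (μ ν ρ σ τ : Fin 5) :
    ∑ α, ∑ β, ∑ γ, ∑ δ, (sgn α * sgn β * sgn γ * sgn δ) •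
      (hJet {μ, α} a ν β γ * hJet {ρ, δ} b σ α β * hJet 0 c τ γ δ) =
    quantize (hMap a) (hMap b) (hMap c)
      ((vertexBase μ ν ρ σ τ) * (dot mom₁ pol₂ * dot pol₁ pol₂ * dot pol₁ pol₃ * dot mom₂ pol₃)) := by
  rw [mul_dot_4]
  rw [map_sum]
  refine Finset.sum_congr rfl fun α _ => ?_
  rw [map_sum]
  refine Finset.sum_congr rfl fun β _ => ?_
  rw [map_sum]
  refine Finset.sum_congr rfl fun γ _ => ?_
  rw [map_sum]
  refine Finset.sum_congr rfl fun δ _ => ?_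
  rw [LinearMap.map_smul]
  refine congrArg (_ • ·) ?_
  simp only [boxTr_symbol, boxH_symbol, hTr_symbol, hTr_symbol₁, hTr_symbol₂, hTr_symbol₃,
    ← hMap_mom_zero, ← hMap_mom, ← hMap_mom₂, ← hMap_mom₃]
  rw [← quantize_slot]
  refine congrArg _ ?_
  simp only [map_mul, dot_map, vertexBase]
  simp only [slot₁_mom, slot₂_mom, slot₁_pol, slot₂_pol, slot₃_pol]
  ring

theorem map_vertexSymbol {Q M : Type*} [CommRing Q] [Algebra ℝ Q] [AddCommGroup M] [Module ℝ M]
    (L : Q →ₗ[ℝ] M) (K : Q) (p a q b c : Fin 5 → Q) :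
    L (K * vertexSymbol p a q b c) =
      -(1 / 8 : ℝ) • L (K * dot p p * dot a a * dot b b * dot c c)
      + (1 / 2 : ℝ) • L (K * dot a a * dot c c * (dot p b * dot p b))
      + (1 / 4 : ℝ) • L (K * dot p p * dot c c * (dot a b * dot a b))
      + (3 / 8 : ℝ) • L (K * dot p p * dot a a * (dot b c * dot b c))
      - (1 / 2 : ℝ) • L (K * dot p p * (dot a b * dot a c * dot b c))
      - (1 / 2 : ℝ) • L (K * dot a a * (dot p b * dot p c * dot b c))
      - (1 / 2 : ℝ) • L (K * dot b b * (dot p a * dot p c * dot a c))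
      - (1 / 4 : ℝ) • L (K * (dot p a * dot p a * dot b c * dot b c))
      - (1 / 2 : ℝ) • L (K * (dot p b * dot p b * dot a c * dot a c))
      + L (K * (dot p c * dot p a * dot a b * dot b c))
      + (1 / 2 : ℝ) • L (K * dot b b * (dot p a * dot a c * dot q c))
      - L (K * (dot p b * dot a b * dot a c * dot q c)) := by
  simp only [← LinearMap.map_smul, ← map_add, ← map_sub, vertexSymbol]
  refine congrArg _ ?_
  algebra

theorem vertexTerm_eq (a b c : Fin N) (μ ν ρ σ τ : Fin 5) :
    vertexTerm a b c μ ν ρ σ τ = quantize (hMap a) (hMap b) (hMap c)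
      (vertexBase μ ν ρ σ τ * vertexSymbol mom₁ pol₁ mom₂ pol₂ pol₃) := by
  rw [vertexTerm, vertexTerm_traces, vertexTerm_hess_trace, vertexTerm_box_trace,
    vertexTerm_box_square, vertexTerm_box_triangle, vertexTerm_hess_triangle, vertexTerm_div_trace,
    vertexTerm_doubleDiv, vertexTerm_hess_square, vertexTerm_div_cycle, vertexTerm_div_gradTrace,
    vertexTerm_grad_cycle]
  generalize vertexBase μ ν ρ σ τ = K
  exact (map_vertexSymbol _ K _ _ _ _ _).symm

theorem a0_eq (g : Fin N → Fin N → Fin N → ℝ) :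
    a0 g = ∑ a, ∑ b, ∑ c, g a b c • quantize (hMap a) (hMap b) (hMap c)
      (cubicSymbol mom₁ pol₁ mom₂ pol₂ pol₃) := by
  rw [a0, Finset.smul_sum]
  refine Finset.sum_congr rfl fun a _ => ?_
  rw [Finset.smul_sum]
  refine Finset.sum_congr rfl fun b _ => ?_
  rw [Finset.smul_sum]
  refine Finset.sum_congr rfl fun c _ => ?_
  rw [smul_comm, cubicSymbol, LinearMap.map_smul]
  refine congrArg (_ • ·) (congrArg (_ • ·) ?_)
  rw [eps5]
  iterate 5 (rw [Finset.sum_mul, map_sum]; refine Finset.sum_congr rfl fun _ _ => ?_)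
  rw [smul_mul_assoc, LinearMap.map_smul, vertexTerm_eq]
  rfl

/-! # The vertex is consistent -/

theorem slotDer_gamma₁ : slotDer gammaDer 0 0 (cubicSymbol mom₁ pol₁ mom₂ pol₂ pol₃) =
    (3 / 2 : ℝ) • (eps5 mom₁ pol₁ mom₂ pol₂ pol₃ * vertexSymbol₁ mom₁ pol₁ mom₂ pol₂ pol₃) := by
  have hp : ∀ μ, gammaDer (mom μ) = 0 := fun μ => polyDer_mom _ _ μ
  have ha : ∀ μ, gammaDer (pol μ) = mom μ := fun μ => polyDer_pol _ _ μ
  apply derivation_cubicSymbol₁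
  · intro μ; rw [mom₁, slotDer_slot₁, hp, map_zero]
  · intro μ; rw [pol₁, slotDer_slot₁, ha, mom₁]
  · intro μ; rw [mom₂, slotDer_slot₂, Derivation.zero_apply, map_zero]
  · intro μ; rw [pol₂, slotDer_slot₂, Derivation.zero_apply, map_zero]
  · intro μ; rw [pol₃, slotDer_slot₃, Derivation.zero_apply, map_zero]

theorem slotDer_gamma₂ : slotDer 0 gammaDer 0 (cubicSymbol mom₁ pol₁ mom₂ pol₂ pol₃) =
    (3 / 2 : ℝ) • (eps5 mom₁ pol₁ mom₂ pol₂ pol₃ * vertexSymbol₂ mom₁ pol₁ mom₂ pol₂ pol₃) := by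
  have hp : ∀ μ, gammaDer (mom μ) = 0 := fun μ => polyDer_mom _ _ μ
  have ha : ∀ μ, gammaDer (pol μ) = mom μ := fun μ => polyDer_pol _ _ μ
  apply derivation_cubicSymbol₂
  · intro μ; rw [mom₁, slotDer_slot₁, Derivation.zero_apply, map_zero]
  · intro μ; rw [pol₁, slotDer_slot₁, Derivation.zero_apply, map_zero]
  · intro μ; rw [mom₂, slotDer_slot₂, hp, map_zero]
  · intro μ; rw [pol₂, slotDer_slot₂, ha, mom₂]
  · intro μ; rw [pol₃, slotDer_slot₃, Derivation.zero_apply, map_zero]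

theorem slotDer_gamma₃ : slotDer 0 0 gammaDer (cubicSymbol mom₁ pol₁ mom₂ pol₂ pol₃) =
    (3 / 2 : ℝ) • (eps5 mom₁ pol₁ mom₂ pol₂ mom₃ * vertexSymbol mom₁ pol₁ mom₂ pol₂ pol₃
      + eps5 mom₁ pol₁ mom₂ pol₂ pol₃ * vertexSymbol₃ mom₁ pol₁ mom₂ pol₂ pol₃ mom₃) := by
  have ha : ∀ μ, gammaDer (pol μ) = mom μ := fun μ => polyDer_pol _ _ μ
  apply derivation_cubicSymbol₃
  · intro μ; rw [mom₁, slotDer_slot₁, Derivation.zero_apply, map_zero]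
  · intro μ; rw [pol₁, slotDer_slot₁, Derivation.zero_apply, map_zero]
  · intro μ; rw [mom₂, slotDer_slot₂, Derivation.zero_apply, map_zero]
  · intro μ; rw [pol₂, slotDer_slot₂, Derivation.zero_apply, map_zero]
  · intro μ; rw [pol₃, slotDer_slot₃, ha, mom₃]

theorem rearrange_gamma₂ : rearrange slot₂ slot₁ slot₃
      (slotDer 0 gammaDer 0 (cubicSymbol mom₁ pol₁ mom₂ pol₂ pol₃)) =
    (3 / 2 : ℝ) • (eps5 mom₂ pol₂ mom₁ pol₁ pol₃ * vertexSymbol₂ mom₂ pol₂ mom₁ pol₁ pol₃) := by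
  rw [slotDer_gamma₂]
  simp only [vertexSymbol₂, map_add, map_sub, map_neg, map_smul, map_mul, dot_map, eps5_map,
    mom₁, mom₂, pol₁, pol₂, pol₃, rearrange_slot₁, rearrange_slot₂, rearrange_slot₃]
  rfl

theorem rearrange_gamma₃ : rearrange slot₂ slot₃ slot₁
      (slotDer 0 0 gammaDer (cubicSymbol mom₁ pol₁ mom₂ pol₂ pol₃)) =
    (3 / 2 : ℝ) • (eps5 mom₂ pol₂ mom₃ pol₃ mom₁ * vertexSymbol mom₂ pol₂ mom₃ pol₃ pol₁
      + eps5 mom₂ pol₂ mom₃ pol₃ pol₁ * vertexSymbol₃ mom₂ pol₂ mom₃ pol₃ pol₁ mom₁) := by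
  rw [slotDer_gamma₃]
  simp only [vertexSymbol, vertexSymbol₃, map_add, map_sub, map_neg, map_smul, map_mul, dot_map,
    eps5_map, mom₁, mom₂, mom₃, pol₁, pol₂, pol₃, rearrange_slot₁, rearrange_slot₂,
    rearrange_slot₃]
  rfl

theorem quantize_swap (φ : Poly →ₗ[ℝ] BRST N) (b c : Fin N) (F : Poly₃) :
    quantize φ (hMap b) (hMap c) (rearrange slot₁ slot₃ slot₂ F) =
      quantize φ (hMap c) (hMap b) F := by
  induction F using Poly₃.induction with
  | h0 => simp
  | ha x y hx hy => simp only [map_add, hx, hy]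
  | hs x y z =>
    have e : slot₁ x * slot₃ y * slot₂ z = slot₁ x * slot₂ z * slot₃ y := by ring
    simp only [map_mul, rearrange_slot₁, rearrange_slot₂, rearrange_slot₃, e, quantize_slot]
    rw [mul_assoc, (hMap_commute b z _).eq, mul_assoc]

/-- The symbol of `γ a₀ + δ a₁`. -/
abbrev totalVariation : Poly₃ := variationSymbol mom₁ pol₁ mom₂ pol₂ mom₃ pol₃

theorem totalVariation_symm :
    totalVariation + rearrange slot₁ slot₃ slot₂ totalVariation ∈ momIdeal := by
  apply mem_momIdeal
  rw [map_add, totalVariation, variationSymbol_map, variationSymbol_map, variationSymbol_map]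
  simp only [mom₁, mom₂, mom₃, pol₁, pol₂, pol₃, rearrange_slot₁, rearrange_slot₂,
    rearrange_slot₃]
  exact variationSymbol_symm _ _ _ _ _ _ onShell_momentum

/-- The ghost may arise from any of the three fields of `a_0`, and in `δ a_1` it carries the second
label. Total symmetry allows the labels to be renamed so that the ghost always carries the first
one, after which all contributions add up to a single symbol. -/
theorem variation_eq (g : Fin N → Fin N → Fin N → ℝ) (h : TotallySymmetric g) :
    gamma (a0 g) + delta (a1 g) =
      ∑ a, ∑ b, ∑ c, g a b c • quantize (CMap a) (hMap b) (hMap c) totalVariation := by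
  have s1 : ∀ G : Fin N → Fin N → Fin N → BRST N,
      ∑ a, ∑ b, ∑ c, g a b c • G b a c = ∑ a, ∑ b, ∑ c, g a b c • G a b c := by
    intro G
    rw [Finset.sum_comm]
    simp only [fun a b c => (h a b c).1]
  have s2 : ∀ G : Fin N → Fin N → Fin N → BRST N,
      ∑ a, ∑ b, ∑ c, g a b c • G c a b = ∑ a, ∑ b, ∑ c, g a b c • G a b c := by
    intro G
    rw [← s1 (fun a b c => G a b c)]
    refine Finset.sum_congr rfl fun a _ => ?_
    rw [Finset.sum_comm]
    refine Finset.sum_congr rfl fun c _ => Finset.sum_congr rfl fun b _ => ?_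
    rw [(h a b c).2]
  rw [delta_a1, s1 fun b a c => quantize (CMap b) (hMap a) (hMap c) _, a0_eq]
  simp only [map_sum, LinearMap.map_smul, gamma_quantize, smul_add, Finset.sum_add_distrib]
  rw [s1 fun b a c => quantize (CMap b) (hMap a) (hMap c) _,
    s2 fun c a b => quantize (CMap c) (hMap a) (hMap b) _]
  simp only [← Finset.sum_add_distrib, ← smul_add, ← map_add]
  rw [slotDer_gamma₁, rearrange_gamma₂, rearrange_gamma₃]
  rfl

/-- Exchanging the last two slots of the symbol amounts to exchanging `b` and `c`, which `g_{abc}`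
does not notice. So twice the variation is the quantization of the symmetrized symbol, which lies in
`momIdeal`. -/
theorem variation_mem_totalDivs (g : Fin N → Fin N → Fin N → ℝ) (h : TotallySymmetric g) :
    gamma (a0 g) + delta (a1 g) ∈ totalDivs N := by
  set X := ∑ a, ∑ b, ∑ c, g a b c • quantize (CMap a) (hMap b) (hMap c) totalVariation with hX
  have hX' : X = ∑ a, ∑ b, ∑ c, g a b c • quantize (CMap a) (hMap b) (hMap c)
      (rearrange slot₁ slot₃ slot₂ totalVariation) := by
    simp only [quantize_swap, hX]
    refine Finset.sum_congr rfl fun a _ => ?_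
    rw [Finset.sum_comm]
    refine Finset.sum_congr rfl fun b _ => Finset.sum_congr rfl fun c _ => ?_
    rw [(h a b c).2]
  have h2 : X + X ∈ totalDivs N := by
    nth_rewrite 2 [hX']
    rw [hX]
    simp only [← Finset.sum_add_distrib, ← smul_add, ← map_add]
    exact sum_mem fun a _ => sum_mem fun b _ => sum_mem fun c _ => Submodule.smul_mem _ _
      (quantize_mem_totalDivs (CMap_translates a) (hMap_translates b) (hMap_translates c)
        totalVariation_symm)
  have h3 := Submodule.smul_mem _ (1 / 2 : ℝ) h2
  rw [variation_eq g h, ← hX]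
  convert h3 using 1
  module

/-! # Lorentz invariance and parity of the vertex -/

theorem sum_fin_succ_pi {n : ℕ} {α M : Type*} [Fintype α] [AddCommMonoid M]
    (F : (Fin (n + 1) → α) → M) :
    ∑ r, F r = ∑ a, ∑ r : Fin n → α, F (Matrix.vecCons a r) := by
  rw [← (Fin.consEquiv fun _ : Fin (n + 1) => α).sum_comp, Fintype.sum_prod_type]
  rfl

/-- This is the derivative of the determinant along `M ↦ M (1 + t A)`. By Cramer's rule the sum is
the trace of `adj(M) M A`, and `adj(M) M = det M`. -/
theorem sum_det_updateRow {n R : Type*} [Fintype n] [DecidableEq n] [CommRing R]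
    (M A : Matrix n n R) : ∑ i, (M.updateRow i ((M * A) i)).det = A.trace * M.det := by
  have h : ∀ i, (M.updateRow i ((M * A) i)).det = ∑ j, M.adjugate j i * (M * A) i j := by
    intro i
    rw [← Matrix.cramer_transpose_apply, Matrix.cramer_eq_adjugate_mulVec,
      ← Matrix.adjugate_transpose]
    rfl
  simp only [h]
  rw [Finset.sum_comm]
  change (M.adjugate * (M * A)).trace = _
  rw [← mul_assoc, Matrix.adjugate_mul, Matrix.smul_mul, one_mul, Matrix.trace_smul, smul_eq_mul,
    mul_comm]

theorem updateRow_of_vec₁ {α : Type*} (u v x y z : Fin 5 → α)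
    (f : (Fin 5 → α) → Fin 5 → α) :
    (Matrix.of ![u, v, x, y, z]).updateRow 0 (f (![u, v, x, y, z] 0)) =
      Matrix.of ![f u, v, x, y, z] := by
  ext i; fin_cases i <;> rfl

theorem updateRow_of_vec₂ {α : Type*} (u v x y z : Fin 5 → α)
    (f : (Fin 5 → α) → Fin 5 → α) :
    (Matrix.of ![u, v, x, y, z]).updateRow 1 (f (![u, v, x, y, z] 1)) =
      Matrix.of ![u, f v, x, y, z] := by
  ext i; fin_cases i <;> rfl

theorem updateRow_of_vec₃ {α : Type*} (u v x y z : Fin 5 → α)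
    (f : (Fin 5 → α) → Fin 5 → α) :
    (Matrix.of ![u, v, x, y, z]).updateRow 2 (f (![u, v, x, y, z] 2)) =
      Matrix.of ![u, v, f x, y, z] := by
  ext i; fin_cases i <;> rfl

theorem updateRow_of_vec₄ {α : Type*} (u v x y z : Fin 5 → α)
    (f : (Fin 5 → α) → Fin 5 → α) :
    (Matrix.of ![u, v, x, y, z]).updateRow 3 (f (![u, v, x, y, z] 3)) =
      Matrix.of ![u, v, x, f y, z] := by
  ext i; fin_cases i <;> rfl

theorem updateRow_of_vec₅ {α : Type*} (u v x y z : Fin 5 → α)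
    (f : (Fin 5 → α) → Fin 5 → α) :
    (Matrix.of ![u, v, x, y, z]).updateRow 4 (f (![u, v, x, y, z] 4)) =
      Matrix.of ![u, v, x, y, f z] := by
  ext i; fin_cases i <;> rfl

section Vector
variable {Q : Type*} [CommRing Q] [Algebra ℝ Q]

theorem det_basisRows {n : Type*} [Fintype n] [DecidableEq n] (r : n → n) :
    (Matrix.of fun i j => if r i = j then (1 : Q) else 0).det = algebraMap ℝ Q
      (Matrix.of fun i j => if r i = j then (1 : ℝ) else 0).det := by
  rw [RingHom.map_det]
  congr 1
  ext i j
  simp [apply_ite (algebraMap ℝ Q)]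

/-- Expand each row in the standard basis and use multilinearity. The coefficients are determinants
of matrices of basis rows, which is the way `eps` is defined. -/
theorem det_eq_sum {n : Type*} [Fintype n] [DecidableEq n] (M : Matrix n n Q) :
    M.det = ∑ r : n → n,
      (Matrix.of fun i j => if r i = j then (1 : ℝ) else 0).det • ∏ i, M i (r i) := by
  have hv : M = fun i => ∑ κ, M i κ • fun j => if κ = j then (1 : Q) else 0 := by
    ext i j; simp [Finset.sum_apply]
  have h := (Matrix.detRowAlternating (n := n) (R := Q)).toMultilinearMap.map_sum
    (fun i κ => M i κ • fun j => if κ = j then (1 : Q) else 0)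
  rw [← hv] at h
  refine h.trans (Finset.sum_congr rfl fun r _ => ?_)
  have h2 := Matrix.det_mul_column (fun i => M i (r i))
    (Matrix.of fun i j => if r i = j then (1 : Q) else 0)
  rw [det_basisRows, mul_comm, ← Algebra.smul_def] at h2
  exact h2

theorem eps5_eq_det (u v w x y : Fin 5 → Q) : eps5 u v w x y =
    (Matrix.of ![u, v, w, x, y]).det := by
  rw [det_eq_sum]
  simp only [sum_fin_succ_pi, Fintype.sum_unique]
  refine Finset.sum_congr rfl fun μ _ => Finset.sum_congr rfl fun ν _ => Finset.sum_congr rfl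
    fun ρ _ => Finset.sum_congr rfl fun σ _ => Finset.sum_congr rfl fun τ _ => ?_
  rw [Fin.prod_univ_five]
  rfl

/-- The action of a matrix on a vector. -/
def rotVec (w : Fin 5 → Fin 5 → ℝ) (u : Fin 5 → Q) (μ : Fin 5) : Q := ∑ κ, w μ κ • u κ

theorem IsLorentz.trace_eq_zero {w : Fin 5 → Fin 5 → ℝ} (hw : IsLorentz w) :
    ∑ κ, w κ κ = 0 := by
  refine Finset.sum_eq_zero fun κ _ => ?_
  have h1 := hw κ κ
  have h2 := sgn_mul_self κ
  linear_combination (1 / 2 * sgn κ) * h1 - w κ κ * h2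

theorem IsLorentz.dot_rotVec {w : Fin 5 → Fin 5 → ℝ} (hw : IsLorentz w) (u v : Fin 5 → Q) :
    dot (rotVec w u) v + dot u (rotVec w v) = 0 := by
  simp only [dot, rotVec, Finset.sum_mul, Finset.mul_sum, Finset.smul_sum]
  rw [Finset.sum_comm, ← Finset.sum_add_distrib]
  refine Finset.sum_eq_zero fun μ _ => ?_
  rw [← Finset.sum_add_distrib]
  refine Finset.sum_eq_zero fun ν _ => ?_
  have h : sgn ν * w ν μ + sgn μ * w μ ν = 0 := by
    have h1 := hw μ ν
    have h2 := sgn_mul_self μ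
    have h3 := sgn_mul_self ν
    linear_combination (sgn μ * sgn ν) * h1 - sgn μ * w μ ν * h3 - sgn ν * w ν μ * h2
  rw [smul_mul_assoc, mul_smul_comm, smul_smul, smul_smul, ← add_smul, h, zero_smul]

/-- An infinitesimal Lorentz transformation is traceless, so the derivative of the determinant along
it is zero. -/
theorem IsLorentz.eps5_rotVec {w : Fin 5 → Fin 5 → ℝ} (hw : IsLorentz w)
    (u v x y z : Fin 5 → Q) :
    eps5 (rotVec w u) v x y z + eps5 u (rotVec w v) x y z + eps5 u v (rotVec w x) y z
      + eps5 u v x (rotVec w y) z + eps5 u v x y (rotVec w z) = 0 := by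
  have h := sum_det_updateRow (Matrix.of ![u, v, x, y, z])
    (Matrix.of fun i j => algebraMap ℝ Q (w j i))
  have hA : (Matrix.of fun i j => algebraMap ℝ Q (w j i)).trace = 0 := by
    simp only [Matrix.trace, Matrix.diag, Matrix.of_apply, ← map_sum, hw.trace_eq_zero, map_zero]
  have hrow : ∀ i, (Matrix.of ![u, v, x, y, z] * Matrix.of fun i j => algebraMap ℝ Q (w j i)) i =
      rotVec w (![u, v, x, y, z] i) := by
    intro i; ext κ
    simp only [Matrix.mul_apply, rotVec, Matrix.of_apply, Algebra.smul_def, mul_comm]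
  simp only [hrow, hA, zero_mul] at h
  rw [Fin.sum_univ_five] at h
  simp only [updateRow_of_vec₁, updateRow_of_vec₂, updateRow_of_vec₃, updateRow_of_vec₄,
    updateRow_of_vec₅, ← eps5_eq_det] at h
  exact h

/-- The reflection of a vector in the direction `1`. -/
def reflVec (u : Fin 5 → Q) (μ : Fin 5) : Q := (if μ = 1 then (-1 : ℝ) else 1) • u μ

theorem dot_reflVec (u v : Fin 5 → Q) : dot (reflVec u) (reflVec v) = dot u v := by
  refine Finset.sum_congr rfl fun μ _ => ?_
  by_cases h : μ = 1 <;> simp [reflVec, h]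

/-- Reflecting all five vectors scales one column of the determinant by `-1`. -/
theorem eps5_reflVec (u v w x y : Fin 5 → Q) :
    eps5 (reflVec u) (reflVec v) (reflVec w) (reflVec x) (reflVec y) = -eps5 u v w x y := by
  let r : Fin 5 → Q := fun μ => algebraMap ℝ Q (if μ = 1 then (-1 : ℝ) else 1)
  have h := Matrix.det_mul_row r (Matrix.of ![u, v, w, x, y])
  have hr : ∏ i, r i = -1 := by
    rw [← map_prod, Fin.prod_univ_five]; simp
  rw [eps5_eq_det, eps5_eq_det, ← neg_one_mul, ← hr, ← h]
  refine congrArg Matrix.det ?_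
  ext i j
  fin_cases i <;> simp [reflVec, r, Algebra.smul_def]

theorem derivation_cubicSymbol_eq_zero {w : Fin 5 → Fin 5 → ℝ} (hw : IsLorentz w)
    (D : Derivation ℝ Q Q) (p a q b c : Fin 5 → Q)
    (hp : ∀ μ, D (p μ) = rotVec w p μ) (ha : ∀ μ, D (a μ) = rotVec w a μ)
    (hq : ∀ μ, D (q μ) = rotVec w q μ) (hb : ∀ μ, D (b μ) = rotVec w b μ)
    (hc : ∀ μ, D (c μ) = rotVec w c μ) : D (cubicSymbol p a q b c) = 0 := by
  have hd : ∀ u v : Fin 5 → Q, (∀ μ, D (u μ) = rotVec w u μ) → (∀ μ, D (v μ) = rotVec w v μ) →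
      D (dot u v) = 0 := fun u v hu hv => by
    rw [derivation_dot, funext hu, funext hv]; exact hw.dot_rotVec u v
  have he : D (eps5 p a q b c) = 0 := by
    rw [derivation_eps5, funext hp, funext ha, funext hq, funext hb, funext hc]
    exact hw.eps5_rotVec p a q b c
  simp only [cubicSymbol, vertexSymbol, Derivation.map_smul, Derivation.leibniz, map_add, map_sub,
    hd p p hp hp, hd a a ha ha, hd b b hb hb, hd c c hc hc, hd p b hp hb, hd a b ha hb,
    hd b c hb hc, hd a c ha hc, hd p c hp hc, hd p a hp ha, hd q c hq hc, he, smul_zero, add_zero,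
    sub_zero]

theorem cubicSymbol_reflVec (p a q b c : Fin 5 → Q) :
    cubicSymbol (reflVec p) (reflVec a) (reflVec q) (reflVec b) (reflVec c) =
      -cubicSymbol p a q b c := by
  simp only [cubicSymbol, vertexSymbol, dot_reflVec, eps5_reflVec, neg_mul, smul_neg]

end Vector

/-- The infinitesimal Lorentz transformation of symbols. -/
def lorentzDer (w : Fin 5 → Fin 5 → ℝ) : Derivation ℝ Poly Poly :=
  polyDer (rotVec w mom) (rotVec w pol)

theorem lorentzDer_mono (w : Fin 5 → Fin 5 → ℝ) (m k : Multiset (Fin 5)) :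
    lorentzDer w (mono m k) =
      (m.map fun μ => ∑ κ, w μ κ • mono (κ ::ₘ m.erase μ) k).sum
      + (k.map fun μ => ∑ κ, w μ κ • mono m (κ ::ₘ k.erase μ)).sum := by
  rw [lorentzDer, polyDer_mono, derMono]
  have h : ∀ κ m k, mono m k * pol κ = mono m (κ ::ₘ k) := fun κ m k => by
    rw [pol, mono_mul, add_zero, add_comm k]; rfl
  simp only [rotVec, Finset.mul_sum, mul_smul_comm, h, mul_comm _ (mom _), mom_mul_mono]

theorem sum_multiset_map_eq {M : Type*} [AddCommGroup M] [Module ℝ M] (m : Multiset (Fin 5))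
    (F : Fin 5 → M) : (m.map F).sum = ∑ μ, (m.count μ : ℝ) • F μ := by
  rw [Finset.sum_multiset_map_count]
  simp only [Nat.cast_smul_eq_nsmul]
  refine Finset.sum_subset (Finset.subset_univ _) fun μ _ hμ => ?_
  rw [Multiset.count_eq_zero_of_notMem (by simpa using hμ), zero_smul]

theorem hMap_mono_of_card (a : Fin N) (m : Multiset (Fin 5)) {k : Multiset (Fin 5)}
    (hk : k.card ≠ 3) : hMap a (mono m k) = 0 := by
  rw [hMap, polyLift_mono, symFun₃_of_card _ hk]

theorem lorentz_hJet (w : Fin 5 → Fin 5 → ℝ) (hw : IsLorentz w) (m : Multiset (Fin 5)) (a : Fin N)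
    (μ ν ρ : Fin 5) : lorentz w hw (hJet m a μ ν ρ) =
      rotDeriv w (m, .h a μ ν ρ) + rotIndex w m (.h a μ ν ρ) := gradedDer_gen _ _ _ _ _

/-- Lorentz transformations act on symbols by rotating momentum and polarization. The momentum part
reproduces `rotDeriv`, with multiplicities as counts, and the polarization part reproduces
`rotIndex`. -/
theorem lorentz_hMap (w : Fin 5 → Fin 5 → ℝ) (hw : IsLorentz w) (a : Fin N) (f : Poly) :
    lorentz w hw (hMap a f) = hMap a (lorentzDer w f) := by
  refine poly_ext (f := lorentz w hw ∘ₗ hMap a) (g := hMap a ∘ₗ (lorentzDer w).toLinearMap)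
    (fun m k => ?_) f
  change lorentz w hw (hMap a (mono m k)) = hMap a (lorentzDer w (mono m k))
  rw [lorentzDer_mono, map_add]
  by_cases hk : k.card = 3
  · obtain ⟨μ, ν, ρ, rfl⟩ := Multiset.card_eq_three.mp hk
    rw [hMap_mono, lorentz_hJet]
    congr 1
    · rw [sum_multiset_map_eq, map_sum]
      refine Finset.sum_congr rfl fun μ _ => ?_
      rw [map_smul, map_sum, Finset.smul_sum]
      refine Finset.sum_congr rfl fun κ _ => ?_
      rw [map_smul, smul_smul, hMap_mono]
      rfl
    · have e2 : ({μ, ν, ρ} : Multiset (Fin 5)).erase ν = {μ, ρ} := by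
        rw [show ({μ, ν, ρ} : Multiset (Fin 5)) = {ν, μ, ρ} from Multiset.cons_swap _ _ _]
        exact Multiset.erase_cons_head _ _
      have e3 : ({μ, ν, ρ} : Multiset (Fin 5)).erase ρ = {μ, ν} := by
        rw [show ({μ, ν, ρ} : Multiset (Fin 5)) = {ρ, μ, ν} from by
          rw [show ({ν, ρ} : Multiset (Fin 5)) = {ρ, ν} from Multiset.cons_swap _ _ _]
          exact Multiset.cons_swap _ _ _]
        exact Multiset.erase_cons_head _ _
      have e1 : ({μ, ν, ρ} : Multiset (Fin 5)).erase μ = {ν, ρ} := Multiset.erase_cons_head _ _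
      have s1 : ∀ κ, hJet m a μ κ ρ = hJet m a κ μ ρ := fun κ => gen_respects.h₁₂ _ _ _ _ _
      have s2 : ∀ κ, hJet m a μ ν κ = hJet m a κ μ ν := fun κ =>
        (gen_respects.h₂₃ _ _ _ _ _).trans (gen_respects.h₁₂ _ _ _ _ _)
      have s3 : ∀ κ α β, hMap a (mono m (κ ::ₘ {α, β})) = hJet m a κ α β :=
        fun κ α β => hMap_mono m a κ α β
      rw [show ({μ, ν, ρ} : Multiset (Fin 5)) = μ ::ₘ ν ::ₘ {ρ} from rfl, Multiset.map_cons,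
        Multiset.map_cons, Multiset.map_singleton, Multiset.sum_cons, Multiset.sum_cons,
        Multiset.sum_singleton]
      change _ = hMap a (∑ κ, w μ κ • mono m (κ ::ₘ ({μ, ν, ρ} : Multiset (Fin 5)).erase μ) +
        (∑ κ, w ν κ • mono m (κ ::ₘ ({μ, ν, ρ} : Multiset (Fin 5)).erase ν) +
        ∑ κ, w ρ κ • mono m (κ ::ₘ ({μ, ν, ρ} : Multiset (Fin 5)).erase ρ)))
      rw [e1, e2, e3, ← Finset.sum_add_distrib, ← Finset.sum_add_distrib, map_sum]
      refine Finset.sum_congr rfl fun κ _ => ?_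
      simp only [map_add, map_smul, s1, s2, s3, add_assoc]
  -- A rotation preserves the degree in the polarization, so in degree other than three every term
  -- on the right is sent to zero as well.
  · rw [hMap_mono_of_card a m hk, map_zero, map_multiset_sum, map_multiset_sum, Multiset.map_map,
      Multiset.map_map, Multiset.sum_eq_zero, Multiset.sum_eq_zero, add_zero]
    · intro x hx
      obtain ⟨μ, hμ, rfl⟩ := Multiset.mem_map.mp hx
      rw [Function.comp_apply, map_sum]
      refine Finset.sum_eq_zero fun κ _ => ?_
      rw [map_smul, hMap_mono_of_card, smul_zero]
      rw [Multiset.card_cons, Multiset.card_erase_add_one hμ]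
      exact hk
    · intro x hx
      obtain ⟨μ, hμ, rfl⟩ := Multiset.mem_map.mp hx
      rw [Function.comp_apply, map_sum]
      refine Finset.sum_eq_zero fun κ _ => ?_
      rw [map_smul, hMap_mono_of_card _ _ hk, smul_zero]

theorem lorentz_quantize (w : Fin 5 → Fin 5 → ℝ) (hw : IsLorentz w) (a b c : Fin N) (F : Poly₃) :
    lorentz w hw (quantize (hMap a) (hMap b) (hMap c) F) = quantize (hMap a) (hMap b) (hMap c)
      (slotDer (lorentzDer w) (lorentzDer w) (lorentzDer w) F) := by
  induction F using Poly₃.induction with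
  | h0 => simp
  | ha x y hx hy => simp only [map_add, hx, hy]
  | hs x y z =>
    simp only [slotDer_mul, quantize_slot, lorentz_mul, lorentz_hMap, map_add, add_mul]

theorem lorentz_a0 (g : Fin N → Fin N → Fin N → ℝ) (w : Fin 5 → Fin 5 → ℝ) (hw : IsLorentz w) :
    lorentz w hw (a0 g) = 0 := by
  rw [a0_eq]
  simp only [map_sum, map_smul, lorentz_quantize]
  refine Finset.sum_eq_zero fun a _ => Finset.sum_eq_zero fun b _ => Finset.sum_eq_zero fun c _ => ?_
  have hm : ∀ μ, lorentzDer w (mom μ) = rotVec w mom μ := fun μ => polyDer_mom _ _ μ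
  have hp : ∀ μ, lorentzDer w (pol μ) = rotVec w pol μ := fun μ => polyDer_pol _ _ μ
  rw [derivation_cubicSymbol_eq_zero hw, map_zero, smul_zero]
  · intro μ; rw [mom₁, slotDer_slot₁, hm]; simp only [rotVec, map_sum, map_smul]; rfl
  · intro μ; rw [pol₁, slotDer_slot₁, hp]; simp only [rotVec, map_sum, map_smul]; rfl
  · intro μ; rw [mom₂, slotDer_slot₂, hm]; simp only [rotVec, map_sum, map_smul]; rfl
  · intro μ; rw [pol₂, slotDer_slot₂, hp]; simp only [rotVec, map_sum, map_smul]; rfl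
  · intro μ; rw [pol₃, slotDer_slot₃, hp]; simp only [rotVec, map_sum, map_smul]; rfl

/-- The reflection of symbols. -/
def reflPoly : Poly →ₐ[ℝ] Poly :=
  AlgHom.ofLinearMap (polyLift fun m k => ((-1 : ℝ) ^ (m.count 1 + k.count 1)) • mono m k)
    (by
      change polyLift _ (mono 0 0) = mono 0 0
      simp)
    (by
      intro x y
      induction x using Poly.induction with
      | h0 => simp
      | ha x x' hx hx' => simp only [add_mul, map_add, hx, hx']
      | hs r m n =>
        induction y using Poly.induction with
        | h0 => simp
        | ha y y' hy hy' => simp only [mul_add, map_add, hy, hy']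
        | hs r' m' n' =>
          simp only [smul_mul_smul_comm, mono_mul, map_smul, polyLift_mono, Multiset.count_add,
            smul_smul]
          congr 1
          ring)

theorem reflPoly_mono (m k : Multiset (Fin 5)) :
    reflPoly (mono m k) = ((-1 : ℝ) ^ (m.count 1 + k.count 1)) • mono m k := by
  rw [reflPoly, AlgHom.ofLinearMap_apply, polyLift_mono]

theorem reflPoly_mom (μ : Fin 5) : reflPoly (mom μ) = reflVec mom μ := by
  rw [mom, reflPoly_mono, reflVec]
  by_cases h : μ = 1
  · subst h; simp [mom]
  · simp [mom, h, Ne.symm h]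

theorem reflPoly_pol (μ : Fin 5) : reflPoly (pol μ) = reflVec pol μ := by
  rw [pol, reflPoly_mono, reflVec]
  by_cases h : μ = 1
  · subst h; simp [pol]
  · simp [pol, h, Ne.symm h]

theorem reflection_hMap (a : Fin N) (f : Poly) :
    reflection (hMap a f) = hMap a (reflPoly f) := by
  refine poly_ext (f := reflection.toLinearMap ∘ₗ hMap a) (g := hMap a ∘ₗ reflPoly.toLinearMap)
    (fun m k => ?_) f
  change reflection (hMap a (mono m k)) = hMap a (reflPoly (mono m k))
  rw [reflPoly_mono, map_smul]
  by_cases hk : k.card = 3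
  · obtain ⟨μ, ν, ρ, rfl⟩ := Multiset.card_eq_three.mp hk
    have hc : ({μ, ν, ρ} : Multiset (Fin 5)).count 1 = (Var.h a μ ν ρ).ones :=
      Multiset.coe_count (1 : Fin 5) [μ, ν, ρ]
    rw [hMap_mono, hJet, reflection, liftHom_gen, hc]
  · rw [hMap_mono_of_card a m hk, map_zero, smul_zero]

theorem reflection_quantize (a b c : Fin N) (F : Poly₃) :
    reflection (quantize (hMap a) (hMap b) (hMap c) F) = quantize (hMap a) (hMap b) (hMap c)
      (rearrange (slot₁.comp reflPoly) (slot₂.comp reflPoly) (slot₃.comp reflPoly) F) := by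
  induction F using Poly₃.induction with
  | h0 => simp
  | ha x y hx hy => simp only [map_add, hx, hy]
  | hs x y z =>
    simp only [map_mul, rearrange_slot₁, rearrange_slot₂, rearrange_slot₃, AlgHom.comp_apply,
      quantize_slot, reflection_hMap]

theorem cubicSymbol_map {Q Q' : Type*} [CommRing Q] [Algebra ℝ Q] [CommRing Q'] [Algebra ℝ Q']
    (π : Q →ₐ[ℝ] Q') (p a q b c : Fin 5 → Q) :
    π (cubicSymbol p a q b c) = cubicSymbol (fun μ => π (p μ)) (fun μ => π (a μ))
      (fun μ => π (q μ)) (fun μ => π (b μ)) (fun μ => π (c μ)) := by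
  simp only [cubicSymbol, vertexSymbol, map_add, map_sub, map_smul, map_mul, dot_map, eps5_map]

theorem reflection_a0 (g : Fin N → Fin N → Fin N → ℝ) : reflection (a0 g) = -a0 g := by
  rw [a0_eq]
  simp only [map_sum, map_smul, reflection_quantize, ← Finset.sum_neg_distrib]
  refine Finset.sum_congr rfl fun a _ => Finset.sum_congr rfl fun b _ => Finset.sum_congr rfl
    fun c _ => ?_
  have e1 : ∀ μ, slot₁ (reflVec mom μ) = reflVec mom₁ μ := fun μ => map_smul _ _ _
  have e2 : ∀ μ, slot₂ (reflVec mom μ) = reflVec mom₂ μ := fun μ => map_smul _ _ _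
  have e3 : ∀ μ, slot₁ (reflVec pol μ) = reflVec pol₁ μ := fun μ => map_smul _ _ _
  have e4 : ∀ μ, slot₂ (reflVec pol μ) = reflVec pol₂ μ := fun μ => map_smul _ _ _
  have e5 : ∀ μ, slot₃ (reflVec pol μ) = reflVec pol₃ μ := fun μ => map_smul _ _ _
  rw [cubicSymbol_map]
  simp only [mom₁, mom₂, pol₁, pol₂, pol₃, rearrange_slot₁, rearrange_slot₂, rearrange_slot₃,
    AlgHom.comp_apply, reflPoly_mom, reflPoly_pol]
  simp only [e1, e2, e3, e4, e5]
  rw [cubicSymbol_reflVec, map_neg, smul_neg]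

/-! # The vertex is cubic with four derivatives -/

/-- Symbols of given degree in the momenta. -/
def momDegree (n : ℕ) : Submodule ℝ Poly₃ :=
  Submodule.span ℝ {F | ∃ m₁ m₂ m₃ k₁ k₂ k₃ : Multiset (Fin 5),
    m₁.card + m₂.card + m₃.card = n ∧
    F = slot₁ (mono m₁ k₁) * slot₂ (mono m₂ k₂) * slot₃ (mono m₃ k₃)}

theorem momDegree_mul {i j n : ℕ} {x y : Poly₃} (hx : x ∈ momDegree i) (hy : y ∈ momDegree j)
    (h : i + j = n) : x * y ∈ momDegree n := by
  induction hx using Submodule.span_induction with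
  | zero => rw [zero_mul]; exact Submodule.zero_mem _
  | add x x' _ _ hx hx' => rw [add_mul]; exact add_mem hx hx'
  | smul r x _ hx => rw [smul_mul_assoc]; exact Submodule.smul_mem _ _ hx
  | mem x hx =>
    induction hy using Submodule.span_induction with
    | zero => rw [mul_zero]; exact Submodule.zero_mem _
    | add y y' _ _ hy hy' => rw [mul_add]; exact add_mem hy hy'
    | smul r y _ hy => rw [mul_smul_comm]; exact Submodule.smul_mem _ _ hy
    | mem y hy =>
      obtain ⟨m₁, m₂, m₃, k₁, k₂, k₃, hm, rfl⟩ := hx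
      obtain ⟨n₁, n₂, n₃, l₁, l₂, l₃, hn, rfl⟩ := hy
      refine Submodule.subset_span ⟨m₁ + n₁, m₂ + n₂, m₃ + n₃, k₁ + l₁, k₂ + l₂, k₃ + l₃, ?_, ?_⟩
      · simp only [Multiset.card_add]; omega
      · simp only [← mono_mul, map_mul]; ring

theorem slot₁_mem_momDegree (m k : Multiset (Fin 5)) : slot₁ (mono m k) ∈ momDegree m.card :=
  Submodule.subset_span ⟨m, 0, 0, k, 0, 0, by simp, by
    rw [show mono 0 0 = 1 from rfl, map_one, map_one, mul_one, mul_one]⟩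

theorem slot₂_mem_momDegree (m k : Multiset (Fin 5)) : slot₂ (mono m k) ∈ momDegree m.card :=
  Submodule.subset_span ⟨0, m, 0, 0, k, 0, by simp, by
    rw [show mono 0 0 = 1 from rfl, map_one, map_one, one_mul, mul_one]⟩

theorem slot₃_mem_momDegree (m k : Multiset (Fin 5)) : slot₃ (mono m k) ∈ momDegree m.card :=
  Submodule.subset_span ⟨0, 0, m, 0, 0, k, by simp, by
    rw [show mono 0 0 = 1 from rfl, map_one, map_one, one_mul, one_mul]⟩

theorem dot_mem_momDegree {i j n : ℕ} {u v : Fin 5 → Poly₃} (hu : ∀ μ, u μ ∈ momDegree i)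
    (hv : ∀ μ, v μ ∈ momDegree j) (h : i + j = n) : dot u v ∈ momDegree n :=
  sum_mem fun μ _ => Submodule.smul_mem _ _ (momDegree_mul (hu μ) (hv μ) h)

theorem cubicSymbol_mem_momDegree : cubicSymbol mom₁ pol₁ mom₂ pol₂ pol₃ ∈ momDegree 4 := by
  have p : ∀ μ, mom₁ μ ∈ momDegree 1 := fun μ => slot₁_mem_momDegree {μ} 0
  have a : ∀ μ, pol₁ μ ∈ momDegree 0 := fun μ => slot₁_mem_momDegree 0 {μ}
  have q : ∀ μ, mom₂ μ ∈ momDegree 1 := fun μ => slot₂_mem_momDegree {μ} 0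
  have b : ∀ μ, pol₂ μ ∈ momDegree 0 := fun μ => slot₂_mem_momDegree 0 {μ}
  have c : ∀ μ, pol₃ μ ∈ momDegree 0 := fun μ => slot₃_mem_momDegree 0 {μ}
  have pp : dot mom₁ mom₁ ∈ momDegree 2 := dot_mem_momDegree p p rfl
  have pa : dot mom₁ pol₁ ∈ momDegree 1 := dot_mem_momDegree p a rfl
  have pb : dot mom₁ pol₂ ∈ momDegree 1 := dot_mem_momDegree p b rfl
  have pc : dot mom₁ pol₃ ∈ momDegree 1 := dot_mem_momDegree p c rfl
  have qc : dot mom₂ pol₃ ∈ momDegree 1 := dot_mem_momDegree q c rfl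
  have aa : dot pol₁ pol₁ ∈ momDegree 0 := dot_mem_momDegree a a rfl
  have ab : dot pol₁ pol₂ ∈ momDegree 0 := dot_mem_momDegree a b rfl
  have ac : dot pol₁ pol₃ ∈ momDegree 0 := dot_mem_momDegree a c rfl
  have bb : dot pol₂ pol₂ ∈ momDegree 0 := dot_mem_momDegree b b rfl
  have bc : dot pol₂ pol₃ ∈ momDegree 0 := dot_mem_momDegree b c rfl
  have cc : dot pol₃ pol₃ ∈ momDegree 0 := dot_mem_momDegree c c rfl
  have four : ∀ {i j k l : ℕ} {x y z w : Poly₃}, x ∈ momDegree i → y ∈ momDegree j →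
      z ∈ momDegree k → w ∈ momDegree l → i + j + k + l = 2 → x * y * z * w ∈ momDegree 2 :=
    fun hx hy hz hw h => momDegree_mul (momDegree_mul (momDegree_mul hx hy rfl) hz rfl) hw h
  have hV : vertexSymbol mom₁ pol₁ mom₂ pol₂ pol₃ ∈ momDegree 2 := by
    rw [vertexSymbol]
    have s := fun (r : ℝ) {x : Poly₃} (hx : x ∈ momDegree 2) => Submodule.smul_mem (momDegree 2) r hx
    have t0 := four pp aa bb cc rfl
    have t1 := four aa pb pb cc rfl
    have t2 := four pp ab ab cc rfl
    have t3 := four pp aa bc bc rfl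
    have t4 := four pp ab ac bc rfl
    have t5 := four aa pb pc bc rfl
    have t6 := four pa ac pc bb rfl
    have t7 := four pa pa bc bc rfl
    have t8 := four pb pb ac ac rfl
    have t9 := four pa ab bc pc rfl
    have t10 := four pa qc ac bb rfl
    have t11 := four pb ab qc ac rfl
    exact sub_mem (add_mem (add_mem (sub_mem (sub_mem (sub_mem (sub_mem (sub_mem (add_mem
      (add_mem (add_mem (s _ t0) (s _ t1)) (s _ t2)) (s _ t3)) (s _ t4)) (s _ t5)) (s _ t6)) (s
      _ t7)) (s _ t8)) t9) (s _ t10)) t11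
  have hE : eps5 mom₁ pol₁ mom₂ pol₂ pol₃ ∈ momDegree 2 := by
    rw [eps5]
    exact sum_mem fun μ _ => sum_mem fun ν _ => sum_mem fun ρ _ => sum_mem fun σ _ => sum_mem fun τ _ =>
      Submodule.smul_mem _ _ (momDegree_mul (four (p μ) (a ν) (q ρ) (b σ) rfl) (c τ) rfl)
  rw [cubicSymbol]
  exact Submodule.smul_mem _ _ (momDegree_mul hE hV rfl)

theorem quantize_mem_cubicFour (a b c : Fin N) {F : Poly₃} (hF : F ∈ momDegree 4) :
    quantize (hMap a) (hMap b) (hMap c) F ∈ cubicFour N := by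
  induction hF using Submodule.span_induction with
  | zero => rw [map_zero]; exact Submodule.zero_mem _
  | add x y _ _ hx hy => rw [map_add]; exact add_mem hx hy
  | smul r x _ hx => rw [map_smul]; exact Submodule.smul_mem _ _ hx
  | mem F hF =>
    obtain ⟨m₁, m₂, m₃, k₁, k₂, k₃, hm, rfl⟩ := hF
    rw [quantize_slot]
    by_cases h₁ : k₁.card = 3
    · by_cases h₂ : k₂.card = 3
      · by_cases h₃ : k₃.card = 3
        · obtain ⟨μ, ν, ρ, rfl⟩ := Multiset.card_eq_three.mp h₁
          obtain ⟨μ', ν', ρ', rfl⟩ := Multiset.card_eq_three.mp h₂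
          obtain ⟨μ'', ν'', ρ'', rfl⟩ := Multiset.card_eq_three.mp h₃
          rw [hMap_mono, hMap_mono, hMap_mono]
          exact Submodule.subset_span ⟨m₁, m₂, m₃, a, b, c, μ, ν, ρ, μ', ν', ρ', μ'', ν'', ρ'',
            hm, rfl⟩
        · rw [hMap_mono_of_card c _ h₃, mul_zero]; exact Submodule.zero_mem _
      · rw [hMap_mono_of_card b _ h₂, mul_zero, zero_mul]; exact Submodule.zero_mem _
    · rw [hMap_mono_of_card a _ h₁, zero_mul, zero_mul]; exact Submodule.zero_mem _

theorem a0_mem_cubicFour (g : Fin N → Fin N → Fin N → ℝ) : a0 g ∈ cubicFour N := by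
  rw [a0_eq]
  exact sum_mem fun a _ => sum_mem fun b _ => sum_mem fun c _ => Submodule.smul_mem _ _
    (quantize_mem_cubicFour a b c cubicSymbol_mem_momDegree)

theorem cubicFour_le_localFunctions {x : BRST N} (hx : x ∈ cubicFour N) :
    x ∈ localFunctions N := by
  have h : cubicFour N ≤ Subalgebra.toSubmodule (localFunctions N) := by
    refine Submodule.span_le.mpr ?_
    rintro _ ⟨m₁, m₂, m₃, a, b, c, μ, ν, ρ, μ', ν', ρ', μ'', ν'', ρ'', -, rfl⟩
    have g : ∀ m a μ ν ρ, hJet m a μ ν ρ ∈ localFunctions N := fun m a μ ν ρ =>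
      Algebra.subset_adjoin ⟨m, a, μ, ν, ρ, rfl⟩
    exact (localFunctions N).mul_mem ((localFunctions N).mul_mem (g _ _ _ _ _) (g _ _ _ _ _))
      (g _ _ _ _ _)
  exact h hx

/-! # The lift of `a₂` -/

section Symbol
variable {Q : Type*} [CommRing Q] [Algebra ℝ Q]

/-- Symbol of `γ a₁`. -/
def gammaSymbol (a q b r c : Fin 5 → Q) : Q :=
  ∑ μ, ∑ ν, ∑ ρ, ∑ σ, ∑ τ, eps μ ν ρ σ τ • ∑ α, ∑ β, ∑ l, (sgn α * sgn β * sgn l) •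
    ((a α * a β * a μ) * curlSymbol q b ν ρ l *
      ((3 / 2 : ℝ) • (r τ * r α * r β * (c l * c σ) - r σ * r α * r β * (c l * c τ))))

/-- Symbol of `δ C^*`. -/
def antighostSymbol (p a : Fin 5 → Q) (μ ν : Fin 5) : Q :=
  (-3 : ℝ) • (∑ ρ, sgn ρ • (p ρ * (a μ * a ν * a ρ))
    - ((1 / 5 : ℝ) * eta μ ν) • ∑ ρ, sgn ρ • ∑ α, sgn α • (p ρ * (a ρ * a α * a α)))

/-- Symbol of `δ a₂`. -/
def deltaSymbol (p a q b r c : Fin 5 → Q) : Q :=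
  ∑ μ, ∑ ν, ∑ ρ, ∑ σ, ∑ τ, eps μ ν ρ σ τ • ∑ α, ∑ β, (sgn α * sgn β) •
    (antighostSymbol p a α μ * curlSymbol q b ν ρ β * (r α * curlSymbol r c σ τ β))

/-- All indices outside `ε` form scalar products, and the curl of the second ghost appears because
`γ Γ_{λ[σ;τ]αβ}` is a curl up to sign: `-3` is `3/2` times the normalization `2` of the bivector,
with the sign from the order of `σ` and `τ`. -/
theorem gammaSymbol_eq (a q b r c : Fin 5 → Q) :
    gammaSymbol a q b r c = (-3 : ℝ) • (dot a r ^ 2 * dot b c * eps5 a q b r c) := by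
  have h1 : ∀ μ ν ρ σ τ, ∑ α, ∑ β, ∑ l, (sgn α * sgn β * sgn l) •
    ((a α * a β * a μ) * curlSymbol q b ν ρ l *
      ((3 / 2 : ℝ) • (r τ * r α * r β * (c l * c σ) - r σ * r α * r β * (c l * c τ)))) =
      ((-3 : ℝ) • (dot a r ^ 2 * dot b c) * a μ) * ((1 / 2 : ℝ) • (q ν * b ρ - q ρ * b ν)) *
        ((1 / 2 : ℝ) • (r σ * c τ - r τ * c σ)) := by
    intro μ ν ρ σ τ
    have h2 : ∀ α β l, (sgn α * sgn β * sgn l) • ((a α * a β * a μ) * curlSymbol q b ν ρ l *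
      ((3 / 2 : ℝ) • (r τ * r α * r β * (c l * c σ) - r σ * r α * r β * (c l * c τ)))) =
        sgn α • (a α * r α) * (sgn β • (a β * r β) * (sgn l • (b l * c l) *
        ((-3 : ℝ) • (a μ * ((1 / 2 : ℝ) • (q ν * b ρ - q ρ * b ν)) *
        ((1 / 2 : ℝ) • (r σ * c τ - r τ * c σ)))))) := fun α β l => by
      rw [curlSymbol]; algebra
    simp only [h2, ← Finset.mul_sum, ← Finset.sum_mul]
    change dot a r * (dot a r * (dot b c * _)) = _
    algebra
  simp only [gammaSymbol, h1]
  rw [eps5_antisymm (fun μ => (-3 : ℝ) • (dot a r ^ 2 * dot b c) * a μ), eps5_smul₁]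
  algebra

theorem antighostSymbol_eq (p a : Fin 5 → Q) (μ ν : Fin 5) : antighostSymbol p a μ ν =
    (-3 : ℝ) • (dot p a * (a μ * a ν) - (1 / 5 : ℝ) • eta μ ν • (dot p a * dot a a)) := by
  have h1 : ∑ ρ, sgn ρ • (p ρ * (a μ * a ν * a ρ)) = dot p a * (a μ * a ν) := by
    simp only [dot, Finset.sum_mul]
    exact Finset.sum_congr rfl fun _ _ => by algebra
  have h2 : ∑ ρ, sgn ρ • ∑ α, sgn α • (p ρ * (a ρ * a α * a α)) = dot p a * dot a a := by
    rw [dot, Finset.sum_mul]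
    refine Finset.sum_congr rfl fun _ _ => ?_
    rw [dot, Finset.mul_sum, Finset.smul_sum]
    exact Finset.sum_congr rfl fun _ _ => by algebra
  rw [antighostSymbol, h1, h2, smul_smul (1 / 5 : ℝ)]

/-- The trace part of `δ C^*` contracts `∂_α` with `η`, so it puts the momentum `r` into the first
argument of `ε`, where it is already present. It therefore does not contribute. -/
theorem deltaSymbol_eq (p a q b r c : Fin 5 → Q) : deltaSymbol p a q b r c =
    (-3 : ℝ) • (dot p a * dot a r * dot b c * eps5 a q b r c) := by
  have h1 : ∀ μ ν ρ σ τ, ∑ α, ∑ β, (sgn α * sgn β) •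
      (antighostSymbol p a α μ * curlSymbol q b ν ρ β * (r α * curlSymbol r c σ τ β)) =
      ((fun μ => ((-3 : ℝ) • (dot p a * dot a r * dot b c)) * a μ) +
        (fun μ => ((3 / 5 : ℝ) • (dot p a * dot a a * dot b c)) * r μ)) μ *
        ((1 / 2 : ℝ) • (q ν * b ρ - q ρ * b ν)) *
        ((1 / 2 : ℝ) • (r σ * c τ - r τ * c σ)) := by
    intro μ ν ρ σ τ
    have e : ∀ μ ν, eta μ ν = eta ν μ := fun μ ν => by
      by_cases h : μ = ν
      · rw [h]
      · simp [eta, h, Ne.symm h]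
    have h2 : ∀ α β, (sgn α * sgn β) •
        (antighostSymbol p a α μ * curlSymbol q b ν ρ β * (r α * curlSymbol r c σ τ β)) =
        (sgn β • (b β * c β)) * ((((1 / 2 : ℝ) • (q ν * b ρ - q ρ * b ν)) *
        ((1 / 2 : ℝ) • (r σ * c τ - r τ * c σ))) * (sgn α • (a α * r α) *
          ((-3 : ℝ) • (dot p a * a μ)) +
          sgn α • (eta μ α • (1 : Q) * r α) * ((3 / 5 : ℝ) • (dot p a * dot a a)))) :=
      fun α β => by
        rw [antighostSymbol_eq, curlSymbol, curlSymbol, e α μ]; algebra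
    simp only [h2, ← Finset.mul_sum, ← Finset.sum_mul, Finset.sum_add_distrib, sum_eta]
    change dot b c * (_ * (dot a r * _ + _)) = _
    simp only [Pi.add_apply]
    algebra
  simp only [deltaSymbol, h1]
  rw [eps5_antisymm, eps5_add₁, eps5_smul₁, eps5_smul₁, eps5_eq₁₄, mul_zero, add_zero]
  algebra

end Symbol

theorem hsMap_mom_zero (a : Fin N) (μ ν ρ : Fin 5) :
    hsMap a (pol μ * pol ν * pol ρ) = hsJet 0 a μ ν ρ := by rw [pol_mul₃, hsMap_mono]

theorem hsMap_mom (a : Fin N) (κ μ ν ρ : Fin 5) :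
    hsMap a (mom κ * (pol μ * pol ν * pol ρ)) = hsJet {κ} a μ ν ρ := by
  rw [pol_mul₃, mom_mul_mono, hsMap_mono]; rfl

theorem hsMap_antighostSymbol (a : Fin N) (μ ν : Fin 5) :
    hsMap a (antighostSymbol mom pol μ ν) = delta (CsJet 0 a μ ν) := by
  simp only [antighostSymbol, map_smul, map_sub, map_sum, hsMap_mom, delta_CsJet]
  rfl

theorem CMap_mom₂ (a : Fin N) (κ l μ ν : Fin 5) :
    CMap a (mom κ * (mom l * (pol μ * pol ν))) = CJet {κ, l} a μ ν := by
  rw [pol_mul₂, mom_mul_mono, mom_mul_mono, CMap_mono]; rfl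

theorem CMap_mom_curlSymbol (b : Fin N) (α ν ρ β : Fin 5) :
    CMap b (mom α * curlSymbol mom pol ν ρ β) = curlC {α} b ν ρ β := by
  simp only [curlSymbol, curlC, mul_smul_comm, mul_sub, map_sub, map_smul, CMap_mom₂]
  rw [show ({α, ν} : Multiset (Fin 5)) = ν ::ₘ {α} from Multiset.cons_swap _ _ _,
    show ({α, ρ} : Multiset (Fin 5)) = ρ ::ₘ {α} from Multiset.cons_swap _ _ _]

/-- `γ` acts only on the connection and passes the two odd factors `h^*` and the curl of `C`, so no
sign results. The factor `3/2` is the `3` of `gamma_conn` times the `1/2` of the antisymmetrization.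
-/
theorem gamma_term (a b c : Fin N) (μ ν ρ σ τ α β l : Fin 5) :
    gamma (hsJet 0 a α β μ * curlC 0 b ν ρ l *
      ((1 / 2 : ℝ) • (conn c l σ τ α β - conn c l τ σ α β))) =
    quantize (hsMap a) (CMap b) (CMap c)
      ((pol₁ α * pol₁ β * pol₁ μ) * curlSymbol mom₂ pol₂ ν ρ l *
      ((3 / 2 : ℝ) • (mom₃ τ * mom₃ α * mom₃ β * (pol₃ l * pol₃ σ)
        - mom₃ σ * mom₃ α * mom₃ β * (pol₃ l * pol₃ τ)))) := by
  have e : (pol₁ α * pol₁ β * pol₁ μ) * curlSymbol mom₂ pol₂ ν ρ l *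
      ((3 / 2 : ℝ) • (mom₃ τ * mom₃ α * mom₃ β * (pol₃ l * pol₃ σ)
        - mom₃ σ * mom₃ α * mom₃ β * (pol₃ l * pol₃ τ))) =
      slot₁ (pol α * pol β * pol μ) * slot₂ (curlSymbol mom pol ν ρ l) *
      slot₃ ((3 / 2 : ℝ) • (mom τ * mom α * mom β * (pol l * pol σ)
        - mom σ * mom α * mom β * (pol l * pol τ))) := by
    simp only [map_smul, map_sub, map_mul, curlSymbol_map]
    rfl
  rw [e, quantize_slot, hsMap_mom_zero, CMap_curlSymbol, map_smul, map_sub, CMap_mom₃, CMap_mom₃,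
    gamma_mul, gamma_mul, gamma_hsJet, gamma_curlC, map_mul, parityInv_hsJet, parityInv_curlC,
    map_smul, map_sub, gamma_conn, gamma_conn, zero_mul, mul_zero, zero_add, zero_mul, zero_add,
    neg_mul_neg, ← smul_sub, smul_smul]
  norm_num

theorem delta_term (a b c : Fin N) (μ ν ρ σ τ α β : Fin 5) :
    delta (CsJet 0 a α μ * curlC 0 b ν ρ β * curlC {α} c σ τ β) =
    quantize (hsMap a) (CMap b) (CMap c)
      (antighostSymbol mom₁ pol₁ α μ * curlSymbol mom₂ pol₂ ν ρ β *
        (mom₃ α * curlSymbol mom₃ pol₃ σ τ β)) := by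
  have e : antighostSymbol mom₁ pol₁ α μ * curlSymbol mom₂ pol₂ ν ρ β *
        (mom₃ α * curlSymbol mom₃ pol₃ σ τ β) =
      slot₁ (antighostSymbol mom pol α μ) * slot₂ (curlSymbol mom pol ν ρ β) *
      slot₃ (mom α * curlSymbol mom pol σ τ β) := by
    simp only [antighostSymbol, map_smul, map_sub, map_sum, map_mul, curlSymbol_map]
    rfl
  rw [e, quantize_slot, CMap_curlSymbol, CMap_mom_curlSymbol, hsMap_antighostSymbol, delta_mul,
    delta_mul, delta_curlC, delta_curlC, mul_zero, add_zero, mul_zero, add_zero]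

theorem gamma_a1 (g : Fin N → Fin N → Fin N → ℝ) :
    gamma (a1 g) = ∑ a, ∑ b, ∑ c, g a b c • quantize (hsMap a) (CMap b) (CMap c)
      (gammaSymbol pol₁ mom₂ pol₂ mom₃ pol₃) := by
  rw [a1]
  iterate 3 (rw [map_sum]; refine Finset.sum_congr rfl fun _ _ => ?_)
  rw [LinearMap.map_smul, gammaSymbol]
  refine congrArg (_ • ·) ?_
  iterate 5 (rw [map_sum, map_sum]; refine Finset.sum_congr rfl fun _ _ => ?_)
  rw [LinearMap.map_smul, LinearMap.map_smul]
  refine congrArg (_ • ·) ?_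
  iterate 3 (rw [map_sum, map_sum]; refine Finset.sum_congr rfl fun _ _ => ?_)
  rw [LinearMap.map_smul, LinearMap.map_smul, gamma_term]

theorem delta_a2 (g : Fin N → Fin N → Fin N → ℝ) :
    delta (a2 g) = ∑ a, ∑ b, ∑ c, g a b c • quantize (hsMap a) (CMap b) (CMap c)
      (deltaSymbol mom₁ pol₁ mom₂ pol₂ mom₃ pol₃) := by
  rw [a2]
  iterate 3 (rw [map_sum]; refine Finset.sum_congr rfl fun _ _ => ?_)
  rw [LinearMap.map_smul, deltaSymbol]
  refine congrArg (_ • ·) ?_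
  iterate 5 (rw [map_sum, map_sum]; refine Finset.sum_congr rfl fun _ _ => ?_)
  rw [LinearMap.map_smul, LinearMap.map_smul]
  refine congrArg (_ • ·) ?_
  iterate 2 (rw [map_sum, map_sum]; refine Finset.sum_congr rfl fun _ _ => ?_)
  rw [LinearMap.map_smul, LinearMap.map_smul, delta_term]

/-- The symbol of `γ a₁ + δ a₂`. -/
abbrev liftSymbol : Poly₃ := gammaSymbol pol₁ mom₂ pol₂ mom₃ pol₃
  + deltaSymbol mom₁ pol₁ mom₂ pol₂ mom₃ pol₃

/-- Substituting `p = -(q + r)` cancels `(a·r)²` and leaves `3 (a·q)(a·r)(b·c)` times the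
determinant. Exchanging the pairs `(q,b)` and `(r,c)` is an even permutation, so this is symmetric
in the two ghosts. -/
theorem lift_identity {Q : Type*} [CommRing Q] [Algebra ℝ Q] (p a q b r c : Fin 5 → Q)
    (h : p + q + r = 0) :
    (-3 : ℝ) • (dot a r ^ 2 * dot b c * eps5 a q b r c)
      + (-3 : ℝ) • (dot p a * dot a r * dot b c * eps5 a q b r c) =
    (-3 : ℝ) • (dot a q ^ 2 * dot c b * eps5 a r c q b)
      + (-3 : ℝ) • (dot p a * dot a q * dot c b * eps5 a r c q b) := by
  have hp : p = -(q + r) := by rw [eq_neg_iff_add_eq_zero, ← h, add_assoc]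
  have he : eps5 a r c q b = eps5 a q b r c := by
    rw [eps5_swap₃₄ a r q c b, eps5_swap₂₃ a q r c b, eps5_swap₄₅ a q r b c,
      eps5_swap₃₄ a q b r c]
    ring
  rw [he, hp, dot_neg_left, dot_add_left, dot_comm q a, dot_comm r a, dot_comm c b]
  algebra

theorem liftSymbol_antisymm :
    liftSymbol - rearrange slot₁ slot₃ slot₂ liftSymbol ∈ momIdeal := by
  apply mem_momIdeal
  rw [liftSymbol, gammaSymbol_eq, deltaSymbol_eq]
  simp only [map_sub, map_add, map_smul, map_mul, map_pow, dot_map, eps5_map, mom₁, mom₂, mom₃,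
    pol₁, pol₂, pol₃, rearrange_slot₁, rearrange_slot₂, rearrange_slot₃]
  exact sub_eq_zero.mpr (lift_identity _ _ _ _ _ _ onShell_momentum)

theorem quantize_ghost_swap (φ : Poly →ₗ[ℝ] BRST N) (b c : Fin N) (F : Poly₃) :
    quantize φ (CMap b) (CMap c) (rearrange slot₁ slot₃ slot₂ F) =
      -quantize φ (CMap c) (CMap b) F := by
  induction F using Poly₃.induction with
  | h0 => simp
  | ha x y hx hy => simp only [map_add, hx, hy, neg_add]
  | hs x y z =>
    have e : slot₁ x * slot₃ y * slot₂ z = slot₁ x * slot₂ z * slot₃ y := by ring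
    simp only [map_mul, rearrange_slot₁, rearrange_slot₂, rearrange_slot₃, e, quantize_slot]
    rw [mul_assoc, CMap_anticomm b c, mul_neg, mul_assoc]

/-- Exchange of the two ghosts costs a sign, whereas `g^a_{bc}` and, modulo `momIdeal`, the symbol
are symmetric. Hence the sum equals its own negative up to a divergence. -/
theorem lift_mem_totalDivs (g : Fin N → Fin N → Fin N → ℝ) (hg : ∀ a b c, g a b c = g a c b) :
    gamma (a1 g) + delta (a2 g) ∈ totalDivs N := by
  set X := ∑ a, ∑ b, ∑ c, g a b c • quantize (hsMap a) (CMap b) (CMap c) liftSymbol with hX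
  have hX' : X = -∑ a, ∑ b, ∑ c, g a b c • quantize (hsMap a) (CMap b) (CMap c)
      (rearrange slot₁ slot₃ slot₂ liftSymbol) := by
    simp only [quantize_ghost_swap, hX, smul_neg, Finset.sum_neg_distrib, neg_neg]
    refine Finset.sum_congr rfl fun a _ => ?_
    rw [Finset.sum_comm]
    refine Finset.sum_congr rfl fun b _ => Finset.sum_congr rfl fun c _ => ?_
    rw [hg a b c]
  have h2 : X + X ∈ totalDivs N := by
    nth_rewrite 2 [hX']
    rw [hX, ← sub_eq_add_neg]
    simp only [← Finset.sum_sub_distrib, ← smul_sub, ← map_sub]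
    exact sum_mem fun a _ => sum_mem fun b _ => sum_mem fun c _ => Submodule.smul_mem _ _
      (quantize_mem_totalDivs (hsMap_translates a) (CMap_translates b) (CMap_translates c)
        liftSymbol_antisymm)
  have h3 := Submodule.smul_mem _ (1 / 2 : ℝ) h2
  rw [gamma_a1, delta_a2]
  simp only [← Finset.sum_add_distrib, ← smul_add, ← map_add]
  convert h3 using 1
  module

/-! # The deformed gauge transformations -/

theorem sum_comm₃ {M X Y Z : Type*} [AddCommMonoid M] [Fintype X] [Fintype Y] [Fintype Z] (F : X → Y → Z → M) :
    ∑ x, ∑ y, ∑ z, F x y z = ∑ z, ∑ x, ∑ y, F x y z :=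
  (Finset.sum_congr rfl fun _ _ => Finset.sum_comm).trans Finset.sum_comm

theorem sum_comm₄ {M X Y Z W : Type*} [AddCommMonoid M] [Fintype X] [Fintype Y] [Fintype Z] [Fintype W]
    (F : X → Y → Z → W → M) : ∑ x, ∑ y, ∑ z, ∑ w, F x y z w = ∑ w, ∑ x, ∑ y, ∑ z, F x y z w :=
  (Finset.sum_congr rfl fun _ _ => sum_comm₃ _).trans Finset.sum_comm

section Sums
variable {M : Type*} [AddCommGroup M] [Module ℝ M]

/-- Contraction with the Levi-Civita density. -/
def epsSum (F : Fin 5 → Fin 5 → Fin 5 → Fin 5 → M) (μ : Fin 5) : M :=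
  ∑ ν, ∑ ρ, ∑ σ, ∑ τ, eps μ ν ρ σ τ • F ν ρ σ τ

theorem epsSum_swap₁₂ (F : Fin 5 → Fin 5 → Fin 5 → Fin 5 → M) (μ : Fin 5) :
    epsSum (fun ν ρ σ τ => F ρ ν σ τ) μ = -epsSum F μ := by
  unfold epsSum
  rw [Finset.sum_comm]
  simp only [← Finset.sum_neg_distrib, ← neg_smul, ← eps_swap₂₃]

theorem epsSum_swap₃₄ (F : Fin 5 → Fin 5 → Fin 5 → Fin 5 → M) (μ : Fin 5) :
    epsSum (fun ν ρ σ τ => F ν ρ τ σ) μ = -epsSum F μ := by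
  unfold epsSum
  simp only [← Finset.sum_neg_distrib]
  refine Finset.sum_congr rfl fun ν _ => Finset.sum_congr rfl fun ρ _ => ?_
  rw [Finset.sum_comm]
  simp only [← neg_smul, ← eps_swap₄₅]

/-- Antisymmetrizing in each of the pairs `ν ρ` and `σ τ` has no effect under `ε`; this absorbs the
explicit brackets of `a_1`. -/
theorem epsSum_antisymm (F : Fin 5 → Fin 5 → Fin 5 → Fin 5 → M) (μ : Fin 5) :
    epsSum (fun ν ρ σ τ => (1 / 4 : ℝ) • (F ν ρ σ τ - F ρ ν σ τ - F ν ρ τ σ + F ρ ν τ σ)) μ =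
      epsSum F μ := by
  have h : epsSum (fun ν ρ σ τ =>
      (1 / 4 : ℝ) • (F ν ρ σ τ - F ρ ν σ τ - F ν ρ τ σ + F ρ ν τ σ)) μ =
      (1 / 4 : ℝ) • (epsSum F μ - epsSum (fun ν ρ σ τ => F ρ ν σ τ) μ
        - epsSum (fun ν ρ σ τ => F ν ρ τ σ) μ
        + epsSum (fun ν ρ σ τ => (fun ν ρ σ τ => F ρ ν σ τ) ν ρ τ σ) μ) := by
    simp only [epsSum, smul_add, smul_sub, Finset.sum_add_distrib, Finset.sum_sub_distrib,
      Finset.smul_sum, smul_comm (1 / 4 : ℝ)]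
  rw [h, epsSum_swap₃₄, epsSum_swap₁₂, epsSum_swap₃₄]
  module

/-- Moving one pair of indices past another is an even permutation. -/
theorem epsSum_exchange (F : Fin 5 → Fin 5 → Fin 5 → Fin 5 → M) (μ : Fin 5) :
    epsSum (fun ν ρ σ τ => F σ τ ν ρ) μ = epsSum F μ := by
  have he : ∀ ν ρ σ τ, eps μ ν ρ σ τ = eps μ σ τ ν ρ := fun ν ρ σ τ => by
    rw [eps_swap₃₄ μ σ ν τ ρ, eps_swap₂₃ μ ν σ τ ρ, eps_swap₄₅ μ ν σ ρ τ,
      eps_swap₃₄ μ ν ρ σ τ]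
    ring
  unfold epsSum
  simp only [he _ _ _ _]
  rw [sum_comm₃]
  refine Finset.sum_congr rfl fun σ _ => ?_
  rw [sum_comm₃]
  simp only [← he]

/-- Contraction with a symmetric tensor does not see a symmetrization: all six permutations
contribute equally. -/
theorem sum_mul_sym3 (S T : Fin 5 → Fin 5 → Fin 5 → BRST N) (h₁ : ∀ μ ν ρ, S μ ν ρ = S ν μ ρ)
    (h₂ : ∀ μ ν ρ, S μ ν ρ = S μ ρ ν) :
    ∑ μ, ∑ ν, ∑ ρ, S μ ν ρ * sym3 T μ ν ρ = ∑ μ, ∑ ν, ∑ ρ, S μ ν ρ * T μ ν ρ := by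
  have s₁ : ∀ T : Fin 5 → Fin 5 → Fin 5 → BRST N, ∑ μ, ∑ ν, ∑ ρ, S μ ν ρ * T ν μ ρ =
      ∑ μ, ∑ ν, ∑ ρ, S μ ν ρ * T μ ν ρ := fun T => by
    rw [Finset.sum_comm]
    refine Finset.sum_congr rfl fun μ _ => Finset.sum_congr rfl fun ν _ =>
      Finset.sum_congr rfl fun ρ _ => ?_
    rw [h₁]
  have s₂ : ∀ T : Fin 5 → Fin 5 → Fin 5 → BRST N, ∑ μ, ∑ ν, ∑ ρ, S μ ν ρ * T μ ρ ν =
      ∑ μ, ∑ ν, ∑ ρ, S μ ν ρ * T μ ν ρ := fun T => by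
    refine Finset.sum_congr rfl fun μ _ => ?_
    rw [Finset.sum_comm]
    refine Finset.sum_congr rfl fun ν _ => Finset.sum_congr rfl fun ρ _ => ?_
    rw [h₂]
  simp only [sym3, mul_smul_comm, mul_add, ← Finset.smul_sum, Finset.sum_add_distrib]
  rw [s₂ T, s₁ T, s₁ fun μ ν ρ => T μ ρ ν, s₂ T, s₂ fun μ ν ρ => T ν μ ρ, s₁ T,
    s₂ fun μ ν ρ => T ν ρ μ, s₁ fun μ ν ρ => T μ ρ ν, s₂ T]
  module

end Sums

theorem conn_commute (b : Fin N) (l σ τ α β : Fin 5) (y : BRST N) :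
    Commute (conn b l σ τ α β) y := by
  rw [← hMap_connSymbol]; exact hMap_commute _ _ _

theorem conn_mem_ghostFunctions (b : Fin N) (l σ τ α β : Fin 5) :
    conn b l σ τ α β ∈ ghostFunctions N := by
  have h : ∀ m μ ν ρ, hJet m b μ ν ρ ∈ Subalgebra.toSubmodule (ghostFunctions N) :=
    fun m μ ν ρ => Algebra.subset_adjoin (Or.inl ⟨m, b, μ, ν, ρ, rfl⟩)
  have e : conn b l σ τ α β ∈ Subalgebra.toSubmodule (ghostFunctions N) :=
    sub_mem (add_mem (Submodule.smul_mem _ _ (sym3_mem _ (fun _ _ _ => h _ _ _ _) _ _ _))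
      (h _ _ _ _)) (Submodule.smul_mem _ _ (add_mem (sym3_mem _ (fun _ _ _ => h _ _ _ _) _ _ _)
        (sym3_mem _ (fun _ _ _ => h _ _ _ _) _ _ _)))
  exact e

theorem gaugeTransf_mem_ghostFunctions (g : Fin N → Fin N → Fin N → ℝ) (κ : ℝ) (a : Fin N)
    (μ ν ρ : Fin 5) : gaugeTransf g κ a μ ν ρ ∈ ghostFunctions N := by
  have hC : ∀ m a μ ν, CJet m a μ ν ∈ ghostFunctions N :=
    fun m a μ ν => Algebra.subset_adjoin (Or.inr ⟨m, a, μ, ν, rfl⟩)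
  have e : gaugeTransf g κ a μ ν ρ ∈ Subalgebra.toSubmodule (ghostFunctions N) :=
    add_mem (Submodule.smul_mem _ _ (sym3_mem _ (fun _ _ _ => hC _ _ _ _) _ _ _))
      (Submodule.smul_mem _ _ (sym3_mem _ (fun μ α β => sum_mem fun b _ => sum_mem fun c _ =>
        Submodule.smul_mem _ _ (sum_mem fun ν _ => sum_mem fun ρ _ => sum_mem fun σ _ =>
          sum_mem fun τ _ => Submodule.smul_mem _ _ (sum_mem fun γ _ => Submodule.smul_mem _ _
            ((ghostFunctions N).mul_mem (conn_mem_ghostFunctions _ _ _ _ _ _)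
              (hC _ _ _ _))))) _ _ _))
  exact e

/-- The brackets in `a_1` are redundant under `ε`, and the even connection commutes with the ghost.
Exchanging the index pairs of `ghost` and `Γ` under `ε` gives no sign; exchanging their labels `b`
and `c` uses the symmetry of `g^a_{bc}`. -/
theorem a1_eq_gaugeTerm (g : Fin N → Fin N → Fin N → ℝ) (hg : ∀ a b c, g a b c = g a c b) :
    a1 g = ∑ a, ∑ μ, ∑ α, ∑ β, (sgn μ * sgn α * sgn β) • (hsJet 0 a μ α β * gaugeTerm g a μ α β) := by
  let G : Fin N → Fin N → Fin N → Fin 5 → Fin 5 → Fin 5 → Fin 5 → Fin 5 → BRST N :=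
    fun a b c μ ν ρ σ τ => ∑ α, ∑ β, ∑ l, (sgn α * sgn β * sgn l) •
      (hsJet 0 a α β μ * CJet {ν} b ρ l * conn c l σ τ α β)
  have h1 : a1 g = ∑ a, ∑ b, ∑ c, g a b c • ∑ μ, epsSum (G a b c μ) μ := by
    rw [a1]
    refine Finset.sum_congr rfl fun a _ => Finset.sum_congr rfl fun b _ =>
      Finset.sum_congr rfl fun c _ => congrArg (_ • ·) (Finset.sum_congr rfl fun μ _ => ?_)
    rw [← epsSum_antisymm, epsSum]
    refine Finset.sum_congr rfl fun ν _ => Finset.sum_congr rfl fun ρ _ =>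
      Finset.sum_congr rfl fun σ _ => Finset.sum_congr rfl fun τ _ => congrArg (_ • ·) ?_
    simp only [G, ← Finset.sum_sub_distrib, ← Finset.sum_add_distrib, Finset.smul_sum]
    refine Finset.sum_congr rfl fun α _ => Finset.sum_congr rfl fun β _ =>
      Finset.sum_congr rfl fun l _ => ?_
    simp only [curlC, Multiset.cons_zero, mul_smul_comm, smul_mul_assoc, mul_sub, sub_mul]
    module
  have h2 : ∀ a μ α β, (sgn μ * sgn α * sgn β) • (hsJet 0 a μ α β * gaugeTerm g a μ α β) =
      ∑ b, ∑ c, g a b c • ∑ ν, ∑ ρ, ∑ σ, ∑ τ, eps μ ν ρ σ τ • ∑ γ, (sgn α * sgn β * sgn γ) •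
        (hsJet 0 a α β μ * CJet {σ} c τ γ * conn b γ ν ρ α β) := by
    intro a μ α β
    have hs : hsJet 0 a μ α β = hsJet 0 a α β μ :=
      (gen_respects.hs₁₂ _ _ _ _ _).trans (gen_respects.hs₂₃ _ _ _ _ _)
    simp only [gaugeTerm, Finset.mul_sum, Finset.smul_sum, mul_smul_comm, smul_smul]
    refine Finset.sum_congr rfl fun b _ => Finset.sum_congr rfl fun c _ =>
      Finset.sum_congr rfl fun ν _ => Finset.sum_congr rfl fun ρ _ =>
      Finset.sum_congr rfl fun σ _ => Finset.sum_congr rfl fun τ _ =>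
      Finset.sum_congr rfl fun γ _ => ?_
    rw [(conn_commute b γ ν ρ α β _).eq, hs, ← mul_assoc (hsJet 0 a α β μ)]
    congr 1
    -- The sign from lowering the first index of `ε` cancels the sign from contracting it with
    -- `h^*`.
    linear_combination (g a b c * eps μ ν ρ σ τ * sgn α * sgn β * sgn γ) * sgn_mul_self μ
  have h3 : ∀ a b c μ, epsSum (G a b c μ) μ = ∑ α, ∑ β, ∑ ν, ∑ ρ, ∑ σ, ∑ τ, eps μ ν ρ σ τ •
      ∑ γ, (sgn α * sgn β * sgn γ) • (hsJet 0 a α β μ * CJet {σ} b τ γ * conn c γ ν ρ α β) := by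
    intro a b c μ
    rw [← epsSum_exchange, epsSum]
    symm
    rw [sum_comm₃ (fun α β ν => _)]
    refine Finset.sum_congr rfl fun ν _ => ?_
    rw [sum_comm₃ (fun α β ρ => _)]
    refine Finset.sum_congr rfl fun ρ _ => ?_
    rw [sum_comm₃ (fun α β σ => _)]
    refine Finset.sum_congr rfl fun σ _ => ?_
    rw [sum_comm₃ (fun α β τ => _)]
    simp only [G, Finset.smul_sum]
  rw [h1]
  refine Finset.sum_congr rfl fun a _ => ?_
  simp only [h2]
  rw [sum_comm₄ (fun μ α β b => _)]
  rw [Finset.sum_comm]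
  refine Finset.sum_congr rfl fun b _ => ?_
  rw [sum_comm₄ (fun μ α β c => _)]
  refine Finset.sum_congr rfl fun c _ => ?_
  rw [hg a c b, Finset.smul_sum]
  refine Finset.sum_congr rfl fun μ _ => ?_
  rw [h3, Finset.smul_sum]
  refine Finset.sum_congr rfl fun α _ => ?_
  rw [Finset.smul_sum]

theorem generatesGauge (g : Fin N → Fin N → Fin N → ℝ) (hg : ∀ a b c, g a b c = g a c b) (κ : ℝ) :
    GeneratesGauge (w1 N + κ • a1 g) (gaugeTransf g κ) := by
  -- The two expressions coincide identically, so the zero current suffices.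
  refine ⟨gaugeTransf_mem_ghostFunctions g κ, fun a μ ν ρ => ⟨?_, ?_⟩, 0, ?_⟩
  · simp only [gaugeTransf, sym3_swap₁₂ _ μ ν ρ]
  · simp only [gaugeTransf, sym3_swap₂₃ _ μ ν ρ]
  · have h : ∀ a (T : Fin 5 → Fin 5 → Fin 5 → BRST N),
        ∑ μ, ∑ ν, ∑ ρ, (sgn μ * sgn ν * sgn ρ) • (hsJet 0 a μ ν ρ * sym3 T μ ν ρ) =
        ∑ μ, ∑ ν, ∑ ρ, (sgn μ * sgn ν * sgn ρ) • (hsJet 0 a μ ν ρ * T μ ν ρ) := by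
      intro a T
      have e := sum_mul_sym3 (fun μ ν ρ => (sgn μ * sgn ν * sgn ρ) • hsJet 0 a μ ν ρ) T
        (fun μ ν ρ => by
          rw [mul_comm (sgn μ), hsJet, gen_respects.hs₁₂]; rfl)
        (fun μ ν ρ => by
          rw [mul_right_comm (sgn μ), hsJet, gen_respects.hs₂₃]; rfl)
      simpa only [smul_mul_assoc] using e
    have h2 : ∑ a, ∑ μ, ∑ ν, ∑ ρ, (sgn μ * sgn ν * sgn ρ) •
        (hsJet 0 a μ ν ρ * gaugeTransf g κ a μ ν ρ) = w1 N + κ • a1 g := by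
      rw [a1_eq_gaugeTerm g hg, w1, Finset.smul_sum, ← Finset.sum_add_distrib]
      refine Finset.sum_congr rfl fun a _ => ?_
      simp only [gaugeTransf, mul_add, smul_add, mul_smul_comm, Finset.sum_add_distrib,
        smul_comm (sgn _ * sgn _ * sgn _) κ, smul_comm (sgn _ * sgn _ * sgn _) (3 : ℝ),
        mul_smul (3 : ℝ), ← Finset.smul_sum, h]
    rw [h2, sub_self]
    simp

/-! # Nilpotent test fields -/

/-- The dual numbers over a commutative algebra. -/
def Dual (R : Type) : Type := DualNumber R

namespace Dual
variable {R : Type} [CommRing R] [Algebra ℝ R]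

instance : CommRing (Dual R) := inferInstanceAs (CommRing (DualNumber R))

instance : Algebra ℝ (Dual R) := inferInstanceAs (Algebra ℝ (DualNumber R))

/-- The inclusion of the constants. -/
def incl : R →ₐ[ℝ] Dual R := TrivSqZeroExt.inlAlgHom ℝ R R

/-- The nilpotent generator. -/
def eps : Dual R := DualNumber.eps

/-- The coefficient of the nilpotent generator. -/
def coeff : Dual R →ₗ[ℝ] R := (TrivSqZeroExt.sndHom R R).restrictScalars ℝ

theorem eps_mul_eps : (eps : Dual R) * eps = 0 := DualNumber.eps_mul_eps

theorem coeff_incl_mul (x : R) (y : Dual R) : coeff (incl x * y) = x * coeff y := by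
  have h : ∀ y : DualNumber R, TrivSqZeroExt.snd ((TrivSqZeroExt.inl x : DualNumber R) * y) =
      x * TrivSqZeroExt.snd y := fun y => by simp
  exact h y

theorem coeff_mul_incl (x : Dual R) (y : R) : coeff (x * incl y) = coeff x * y := by
  rw [mul_comm, coeff_incl_mul, mul_comm]

theorem coeff_eps : coeff (eps : Dual R) = 1 := rfl

/-- The extension of a derivation to the dual numbers with `ε ↦ p ε`. -/
def der (D : Derivation ℝ R R) (p : R) : Derivation ℝ (Dual R) (Dual R) :=
  (Derivation.mk'
    { toFun := fun x => TrivSqZeroExt.inl (D x.fst) + TrivSqZeroExt.inr (D x.snd + p * x.snd)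
      map_add' := fun x y => by
        ext <;> simp [mul_add]; abel
      map_smul' := fun r x => by
        ext <;> simp [mul_smul_comm] }
    (fun x y => by
      ext
      · simp
      · simp
        ring) : Derivation ℝ (DualNumber R) (DualNumber R))

/-- Taking the coefficient of `ε` shifts the derivation by `p`. Through a tower of extensions the
momenta therefore add up, as they do in a product of exponentials. -/
theorem coeff_der (D : Derivation ℝ R R) (p : R) (x : Dual R) :
    coeff (der D p x) = D (coeff x) + p * coeff x := by
  change TrivSqZeroExt.snd (TrivSqZeroExt.inl (D x.fst) +
    TrivSqZeroExt.inr (D x.snd + p * x.snd)) = D x.snd + p * x.snd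
  simp

theorem der_incl (D : Derivation ℝ R R) (p x : R) : der D p (incl x) = incl (D x) := by
  change TrivSqZeroExt.inl (D x) + TrivSqZeroExt.inr (D 0 + p * 0) = TrivSqZeroExt.inl (D x)
  simp

theorem der_eps (D : Derivation ℝ R R) (p : R) : der D p eps = incl p * eps := by
  change TrivSqZeroExt.inl (D 0) + TrivSqZeroExt.inr (D 1 + p * 1) =
    TrivSqZeroExt.inl p * TrivSqZeroExt.inr 1
  ext <;> simp

theorem incl_sq {x : R} (hx : x * x = 0) : incl x * incl x = 0 := by
  rw [← map_mul, hx, map_zero]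

end Dual

/-- Coefficients generated by nilpotents, with derivations that multiply the nilpotents `s`, `z₂`,
`z₃` by momenta of total zero, and an invariant functional. -/
structure TestRing (B : Type) [CommRing B] [Algebra ℝ B] where
  (e₁ e₂ s z₂ z₃ : B)
  e₁_sq : e₁ * e₁ = 0
  e₂_sq : e₂ * e₂ = 0
  s_sq : s * s = 0
  z₂_sq : z₂ * z₂ = 0
  z₃_sq : z₃ * z₃ = 0
  E : Fin 5 → Derivation ℝ B B
  E_e₁ : ∀ κ, E κ e₁ = 0
  E_e₂ : ∀ κ, E κ e₂ = 0
  E_s : ∀ κ, E κ s = ![0, 0, e₂, e₁, 0] κ * s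
  E_z₂ : ∀ κ, E κ z₂ = ![0, 1, 0, 0, 0] κ * z₂
  E_z₃ : ∀ κ, E κ z₃ = -(![0, 0, e₂, e₁, 0] κ + ![0, 1, 0, 0, 0] κ) * z₃
  L : B →ₗ[ℝ] ℝ
  L_E : ∀ κ x, L (E κ x) = 0
  L_top : L (z₂ * z₃ * (s * e₁ * e₂)) = 1

/-- A tower of five dual-number extensions of `ℝ`, with generators `e₂`, `e₁`, `s`, `z₂`, `z₃` from
the inside out, so that the momentum of each new generator is available in the ring below it. `L`
takes the coefficient of the product of all five. -/
theorem exists_testRing :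
    ∃ (B : Type) (_ : CommRing B) (_ : Algebra ℝ B), Nonempty (TestRing B) := by
  let e₁ : Dual (Dual ℝ) := Dual.eps
  let e₂ : Dual (Dual ℝ) := Dual.incl Dual.eps
  let P : Fin 5 → Dual (Dual ℝ) := ![0, 0, e₂, e₁, 0]
  let K : Fin 5 → Dual (Dual ℝ) := ![0, 1, 0, 0, 0]
  refine ⟨Dual (Dual (Dual (Dual (Dual ℝ)))), inferInstance, inferInstance, ⟨{
    e₁ := Dual.incl (Dual.incl (Dual.incl e₁))
    e₂ := Dual.incl (Dual.incl (Dual.incl e₂))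
    s := Dual.incl (Dual.incl Dual.eps)
    z₂ := Dual.incl Dual.eps
    z₃ := Dual.eps
    e₁_sq := Dual.incl_sq (Dual.incl_sq (Dual.incl_sq Dual.eps_mul_eps))
    e₂_sq := Dual.incl_sq (Dual.incl_sq (Dual.incl_sq (Dual.incl_sq Dual.eps_mul_eps)))
    s_sq := Dual.incl_sq (Dual.incl_sq Dual.eps_mul_eps)
    z₂_sq := Dual.incl_sq Dual.eps_mul_eps
    z₃_sq := Dual.eps_mul_eps
    E := fun κ => Dual.der (Dual.der (Dual.der 0 (P κ)) (Dual.incl (K κ)))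
      (Dual.incl (Dual.incl (-(P κ + K κ))))
    E_e₁ := fun κ => by simp [Dual.der_incl]
    E_e₂ := fun κ => by simp [Dual.der_incl]
    E_s := fun κ => by
      rw [Dual.der_incl, Dual.der_incl, Dual.der_eps, map_mul, map_mul]
      congr 1
      fin_cases κ <;> simp [P]
    E_z₂ := fun κ => by
      rw [Dual.der_incl, Dual.der_eps, map_mul]
      congr 1
      fin_cases κ <;> simp [K]
    E_z₃ := fun κ => by
      rw [Dual.der_eps]
      congr 1
      fin_cases κ <;> simp [P, K]
    L := Dual.coeff ∘ₗ Dual.coeff ∘ₗ Dual.coeff ∘ₗ Dual.coeff ∘ₗ Dual.coeff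
    -- Peeling off `z₃`, `z₂`, `s` adds the momenta `-(P + K)`, `K` and `P` to the zero derivation:
    -- the total momentum vanishes, which is invariance of the integral under translations.
    L_E := fun κ x => by
      simp only [LinearMap.comp_apply, Dual.coeff_der, map_add, Dual.coeff_incl_mul,
        Derivation.zero_apply, zero_add]
      simp only [← map_add]
      rw [show ∀ x, P κ * x + K κ * x + -(P κ + K κ) * x = 0 from fun x => by ring, map_zero,
        map_zero]
    L_top := by
      simp only [LinearMap.comp_apply, e₁, e₂, mul_assoc, ← map_mul, Dual.coeff_incl_mul,
        Dual.coeff_mul_incl, Dual.coeff_eps, one_mul, mul_one] }⟩⟩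

/-! # The test fields -/

namespace TestRing
variable {B : Type} [CommRing B] [Algebra ℝ B] (t : TestRing B)

/-- The momentum of the ghost. -/
def P : Fin 5 → B := ![0, 0, t.e₂, t.e₁, 0]

/-- The polarization of the ghost. -/
def A : Fin 5 → B := ![0, t.s, t.e₂, -t.e₁, 0]

/-- The momentum of the first field. -/
def K : Fin 5 → B := ![0, 1, 0, 0, 0]

/-- The momentum of the second field. -/
def R (μ : Fin 5) : B := -(t.P μ + K μ)

/-- The polarization of the first field. -/
def U : Fin 5 → B := ![1, 0, 0, 0, 1]

/-- The polarization of the second field. -/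
def V : Fin 5 → B := ![1, 0, 0, 0, -1]

theorem A_eq (μ : Fin 5) : ∃ x y z : B, t.A μ = x * t.s + y * t.e₂ - z * t.e₁ ∧
    t.P μ = y * t.e₂ + z * t.e₁ ∧ ∀ κ, t.E κ (t.A μ) = x * (t.P κ * t.s) := by
  have hs : ∀ κ, t.E κ t.s = t.P κ * t.s := t.E_s
  fin_cases μ
  · exact ⟨0, 0, 0, by simp [A], by simp [P], by simp [A]⟩
  · exact ⟨1, 0, 0, by simp [A], by simp [P], by simp [A, hs]⟩
  · exact ⟨0, 1, 0, by simp [A], by simp [P], by simp [A, t.E_e₂]⟩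
  · exact ⟨0, 0, 1, by simp [A], by simp [P], by simp [A, t.E_e₁]⟩
  · exact ⟨0, 0, 0, by simp [A], by simp [P], by simp [A]⟩

theorem A_mul (μ ν : Fin 5) : ∃ x y z : B,
    t.A μ * t.A ν = x * (t.s * t.e₂) + y * (t.s * t.e₁) + z * (t.e₁ * t.e₂) := by
  obtain ⟨a, b, c, h, -⟩ := t.A_eq μ
  obtain ⟨a', b', c', h', -⟩ := t.A_eq ν
  have h1 := t.e₁_sq
  have h2 := t.e₂_sq
  have h3 := t.s_sq
  refine ⟨a * b' + b * a', -(a * c' + c * a'), -(b * c' + c * b'), ?_⟩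
  rw [h, h']
  linear_combination (a * a') * h3 + (b * b') * h2 + (c * c') * h1

/-- Four factors linear in only three square-zero elements. Products of two ghosts thus evaluate to
zero, which reconciles anticommuting ghosts with a commutative target ring. -/
theorem A_mul₄ (μ ν ρ σ : Fin 5) : t.A μ * t.A ν * (t.A ρ * t.A σ) = 0 := by
  obtain ⟨a, b, c, h⟩ := t.A_mul μ ν
  obtain ⟨a', b', c', h'⟩ := t.A_mul ρ σ
  have h1 := t.e₁_sq
  have h2 := t.e₂_sq
  have h3 := t.s_sq
  rw [h, h']
  linear_combination ((a * t.e₂ + b * t.e₁) * (a' * t.e₂ + b' * t.e₁)) * h3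
    + (c * t.e₁ * t.s * a' + c' * t.e₁ * t.s * a) * h2
    + (c * t.e₂ * t.s * b' + c' * t.e₂ * t.s * b + c * c' * t.e₂ * t.e₂) * h1

/-- The ghost `exp(P·x) A_μ A_ν` is a Killing tensor. Its coefficient of `s e₁ e₂` has nonzero
components `C_{12} = x^3` and `C_{13} = -x^2`: the symmetrized product of a translation along
direction `1` and a rotation in the plane `2 3`. -/
theorem killing (μ ν ρ : Fin 5) :
    t.P μ * (t.A ν * t.A ρ) + t.P ν * (t.A μ * t.A ρ) + t.P ρ * (t.A μ * t.A ν) = 0 := by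
  obtain ⟨a, b, c, h, hp, -⟩ := t.A_eq μ
  obtain ⟨a', b', c', h', hp', -⟩ := t.A_eq ν
  obtain ⟨a'', b'', c'', h'', hp'', -⟩ := t.A_eq ρ
  have h1 := t.e₁_sq
  have h2 := t.e₂_sq
  have h3 := t.s_sq
  rw [h, h', h'', hp, hp', hp'']
  generalize t.e₁ = x at *
  generalize t.e₂ = y at *
  generalize t.s = z at *
  clear h h' h'' hp hp' hp''
  grind

theorem E_P (κ μ : Fin 5) : t.E κ (t.P μ) = 0 := by
  fin_cases μ <;> simp [P, t.E_e₁, t.E_e₂]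

theorem E_K (κ μ : Fin 5) : t.E κ (K μ) = 0 := by
  fin_cases μ <;> simp [K]

theorem E_R (κ μ : Fin 5) : t.E κ (t.R μ) = 0 := by
  simp [R, t.E_P, t.E_K]

theorem E_U (κ μ : Fin 5) : t.E κ (U μ) = 0 := by
  fin_cases μ <;> simp [U]

theorem E_V (κ μ : Fin 5) : t.E κ (V μ) = 0 := by
  fin_cases μ <;> simp [V]

/-- Only `s` carries the momentum `P`. The part of `A_μ A_ν` without `s` is a multiple of `e₁ e₂`,
which `E κ` kills and which multiplication by `P κ` kills too. -/
theorem E_A_mul (κ μ ν : Fin 5) : t.E κ (t.A μ * t.A ν) = t.P κ * (t.A μ * t.A ν) := by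
  obtain ⟨a, b, c, h, -, hE⟩ := t.A_eq μ
  obtain ⟨a', b', c', h', -, hE'⟩ := t.A_eq ν
  obtain ⟨-, b'', c'', -, hp, -⟩ := t.A_eq κ
  have h1 := t.e₁_sq
  have h2 := t.e₂_sq
  have h3 := t.s_sq
  rw [Derivation.leibniz, hE, hE', h, h', hp, smul_eq_mul, smul_eq_mul]
  generalize t.e₁ = x at *
  generalize t.e₂ = y at *
  generalize t.s = z at *
  clear h h' hE hE' hp
  grind

theorem E_prod {p : Fin 5 → B} (hp : ∀ κ μ, t.E κ (p μ) = 0) (κ : Fin 5)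
    (m : Multiset (Fin 5)) : t.E κ (m.map p).prod = 0 := by
  induction m using Multiset.induction with
  | empty => simp
  | cons μ m ih => rw [Multiset.map_cons, Multiset.prod_cons, Derivation.leibniz, ih, hp]; simp

theorem dot_A : dot t.A t.A = 0 := by
  have h1 := t.e₁_sq
  have h2 := t.e₂_sq
  have h3 := t.s_sq
  simp [dot, Fin.sum_univ_five, A, sgn, h1, h2, h3]

/-- Values of the jets on the test fields. -/
def value (a b c : Fin N) : Jet N → B
  | (m, .h d μ ν ρ) => (if d = a then (1 : ℝ) else 0) • (t.z₂ * (m.map K).prod * (U μ * U ν * U ρ))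
      + (if d = c then (1 : ℝ) else 0) • (t.z₃ * (m.map t.R).prod * (V μ * V ν * V ρ))
  | (m, .C d μ ν) => (if d = b then (1 : ℝ) else 0) • ((m.map t.P).prod * (t.A μ * t.A ν))
  | (_, .hs _ _ _ _) => 0
  | (_, .Cs _ _ _) => 0

theorem value_respects (a b c : Fin N) : Respects (t.value a b c) where
  h₁₂ m d μ ν ρ := by simp only [value, mul_comm (U μ) (U ν), mul_comm (V μ) (V ν)]
  h₂₃ m d μ ν ρ := by
    simp only [value, mul_assoc, mul_comm (U ν) (U ρ), mul_comm (V ν) (V ρ)]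
  hs₁₂ _ _ _ _ _ := rfl
  hs₂₃ _ _ _ _ _ := rfl
  C₁₂ m d μ ν := by simp only [value, mul_comm (t.A μ) (t.A ν)]
  Cs₁₂ _ _ _ _ := rfl
  C_trace m d := by
    have h := t.dot_A
    rw [dot] at h
    have e : ∀ (r : ℝ) (y : B), ∑ μ, sgn μ • (r • (y * (t.A μ * t.A μ))) =
        r • (y * ∑ μ, sgn μ • (t.A μ * t.A μ)) := fun r y => by
      rw [Finset.mul_sum, Finset.smul_sum]
      exact Finset.sum_congr rfl fun μ _ => by algebra
    simp only [value, e, h, mul_zero, smul_zero]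
  Cs_trace _ _ := by simp [value]

/-- Evaluation of local functions on the test fields. -/
def eval (a b c : Fin N) : BRST N →ₐ[ℝ] B :=
  liftHom (t.value a b c) (t.value_respects a b c) (by
    rintro ⟨m, x⟩ ⟨n, y⟩
    cases x <;> cases y <;> simp only [Var.odd, koszul, value, Bool.and_self, Bool.and_true,
      Bool.and_false, Bool.true_and, Bool.false_and, Bool.false_eq_true, if_false, if_true,
      one_smul, mul_zero, zero_mul, smul_zero, neg_smul, neg_zero]
    any_goals exact mul_comm _ _
    rename_i d μ ν d' μ' ν'
    have h : ∀ (x y : B) (r r' : ℝ) (μ ν μ' ν' : Fin 5),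
        r • (x * (t.A μ * t.A ν)) * r' • (y * (t.A μ' * t.A ν')) = 0 := by
      intro x y r r' μ ν μ' ν'
      rw [smul_mul_smul_comm, mul_mul_mul_comm, t.A_mul₄, mul_zero, smul_zero]
    -- Only ghost with ghost requires a sign, and there both products vanish.
    rw [h, h, neg_zero])

theorem eval_gen (a b c : Fin N) (x : Jet N) : t.eval a b c (gen x) = t.value a b c x :=
  liftHom_gen _ _ _ _

/-- Each test field is an exponential with its own momentum, so the total derivative acts on it as
the derivation `E κ`; the Leibniz rule extends this to all local functions. -/
theorem E_eval (a b c : Fin N) (κ : Fin 5) (y : BRST N) :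
    t.E κ (t.eval a b c y) = t.eval a b c (totalDeriv κ y) := by
  induction y using BRST.induction with
  | hc r =>
    have h : totalDeriv κ (algebraMap ℝ (BRST N) r) = 0 := by
      have h1 : totalDeriv κ (1 : BRST N) = 0 := by
        have := totalDeriv_mul κ (1 : BRST N) 1
        simpa using this
      rw [Algebra.algebraMap_eq_smul_one, map_smul, h1, smul_zero]
    rw [h, AlgHom.commutes, Derivation.map_algebraMap, map_zero]
  | hg x =>
    rw [totalDeriv_gen, eval_gen, eval_gen]
    obtain ⟨m, x⟩ := x
    cases x with
    | h d μ ν ρ =>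
      have hz₂ : t.E κ t.z₂ = K κ * t.z₂ := t.E_z₂ κ
      have hz₃ : t.E κ t.z₃ = t.R κ * t.z₃ := t.E_z₃ κ
      simp only [value, map_add, Derivation.map_smul, Derivation.leibniz, E_U, E_V, hz₂, hz₃,
        t.E_prod t.E_K, t.E_prod t.E_R, smul_zero, zero_add, add_zero, smul_eq_mul,
        Multiset.map_cons, Multiset.prod_cons, mul_zero]
      congr 2 <;> ring
    | C d μ ν =>
      simp only [value, Derivation.map_smul]
      rw [Derivation.leibniz, t.E_prod t.E_P, smul_zero, add_zero, E_A_mul, Multiset.map_cons,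
        Multiset.prod_cons, smul_eq_mul]
      congr 1; ring
    | hs => exact map_zero _
    | Cs => exact map_zero _
  | hm u v hu hv =>
    rw [totalDeriv_mul, map_mul (t.eval a b c), Derivation.leibniz, map_add, map_mul, map_mul, hu,
      hv]
    simp only [smul_eq_mul]; ring
  | ha u v hu hv => simp only [map_add, hu, hv]

theorem L_eval_totalDiv (a b c : Fin N) {x : BRST N} (hx : IsTotalDiv x) :
    t.L (t.eval a b c x) = 0 := by
  obtain ⟨j, rfl⟩ := hx
  simp only [map_sum, ← E_eval, t.L_E, Finset.sum_const_zero]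

/-- On a field, `γ` gives the symmetrized derivative of the ghost, which is zero for a Killing
tensor; products follow from the Leibniz rule. An unknown vertex thus drops out of the test. -/
theorem eval_gamma (a b c : Fin N) {x : BRST N} (hx : x ∈ localFunctions N) :
    t.eval a b c (gamma x) = 0 := by
  induction hx using Algebra.adjoin_induction with
  | mem x hx =>
    obtain ⟨m, d, μ, ν, ρ, rfl⟩ := hx
    have hC : ∀ μ ν ρ, t.eval a b c (CJet (μ ::ₘ m) d ν ρ) = (if d = b then (1 : ℝ) else 0) •
        ((m.map t.P).prod * (t.P μ * (t.A ν * t.A ρ))) := by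
      intro μ ν ρ
      rw [CJet, eval_gen, value, Multiset.map_cons, Multiset.prod_cons]
      congr 1; ring
    have hk := t.killing μ ν ρ
    simp only [gamma_hJet, sym3, map_smul, map_add, hC]
    rw [mul_comm (t.A ρ) (t.A ν), mul_comm (t.A ρ) (t.A μ), mul_comm (t.A ν) (t.A μ)]
    have h2 : ∀ X Y Z : B, X + Y + Z = 0 → ∀ (r : ℝ) (m : B),
        (3 : ℝ) • (1 / 6 : ℝ) • (r • (m * X) + r • (m * X) + r • (m * Y) + r • (m * Y)
          + r • (m * Z) + r • (m * Z)) = 0 := by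
      intro X Y Z h r m
      have : (3 : ℝ) • (1 / 6 : ℝ) • (r • (m * X) + r • (m * X) + r • (m * Y) + r • (m * Y)
          + r • (m * Z) + r • (m * Z)) = r • (m * (X + Y + Z)) := by algebra
      rw [this, h, mul_zero, smul_zero]
    exact h2 _ _ _ hk _ _
  | algebraMap r =>
    have h1 : gamma (1 : BRST N) = 0 := by
      have := gamma_mul (1 : BRST N) 1
      simpa using this
    rw [Algebra.algebraMap_eq_smul_one, map_smul, h1, smul_zero, map_zero]
  | add x y _ _ hx hy => rw [map_add, map_add, hx, hy, add_zero]
  | mul x y _ _ hx hy => rw [gamma_mul, map_add, map_mul, map_mul, hx, hy, zero_mul, mul_zero, add_zero]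

/-! ### Evaluation of `δ a₁` on the test fields -/

theorem eval_hJet₂ (a b c d : Fin N) (k l μ ν ρ : Fin 5) :
    t.eval a b c (hJet {k, l} d μ ν ρ) =
      (if d = a then (1 : ℝ) else 0) • (t.z₂ * (K k * K l * (U μ * U ν * U ρ)))
      + (if d = c then (1 : ℝ) else 0) • (t.z₃ * (t.R k * t.R l * (V μ * V ν * V ρ))) := by
  rw [hJet, eval_gen, value]
  simp [Multiset.insert_eq_cons, mul_assoc]

theorem eval_curlC (a b c d : Fin N) (ν ρ l : Fin 5) : t.eval a b c (curlC 0 d ν ρ l) =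
    (if d = b then (1 : ℝ) else 0) • curlSymbol t.P t.A ν ρ l := by
  have h : ∀ k μ ν, t.eval a b c (CJet (k ::ₘ 0) d μ ν) =
      (if d = b then (1 : ℝ) else 0) • (t.P k * (t.A μ * t.A ν)) := fun k μ ν => by
    rw [CJet, eval_gen, value]; simp
  simp only [curlC, curlSymbol, map_smul, map_sub, h]
  module

theorem eval_conn (a b c d : Fin N) (l σ τ α β : Fin 5) : t.eval a b c (conn d l σ τ α β) =
    (if d = a then (1 : ℝ) else 0) • (t.z₂ * connSymbol K U l σ τ α β)
      + (if d = c then (1 : ℝ) else 0) • (t.z₃ * connSymbol t.R V l σ τ α β) := by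
  simp only [conn, connSymbol, sym3, map_smul, map_sub, map_add, eval_hJet₂]
  generalize (if d = a then (1 : ℝ) else 0) = r
  generalize (if d = c then (1 : ℝ) else 0) = r'
  simp only [mul_add, mul_sub, mul_smul_comm, ← mul_assoc]
  module

theorem eval_fronsdal (a b c d : Fin N) (μ ν ρ : Fin 5) : t.eval a b c (fronsdal 0 d μ ν ρ) =
    (if d = a then (1 : ℝ) else 0) • (t.z₂ * fronsdalSymbol K U μ ν ρ)
      + (if d = c then (1 : ℝ) else 0) • (t.z₃ * fronsdalSymbol t.R V μ ν ρ) := by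
  have h : ∀ k l μ ν ρ, t.eval a b c (hJet (k ::ₘ l ::ₘ 0) d μ ν ρ) = _ := fun k l μ ν ρ =>
    t.eval_hJet₂ a b c d k l μ ν ρ
  have hs : ∀ (f f' : Fin 5 → B) (r r' : ℝ) (y y' : B),
      ∑ σ, sgn σ • (r • (y * f σ) + r' • (y' * f' σ)) =
      r • (y * ∑ σ, sgn σ • f σ) + r' • (y' * ∑ σ, sgn σ • f' σ) := by
    intro f f' r r' y y'
    rw [Finset.mul_sum, Finset.mul_sum, Finset.smul_sum, Finset.smul_sum,
      ← Finset.sum_add_distrib]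
    exact Finset.sum_congr rfl fun σ _ => by algebra
  simp only [fronsdal, fronsdalSymbol, hTr, sym3, map_smul, map_sub, map_add, map_sum, h, hs]
  algebra

theorem sym3_pair (w : Fin 5 → Fin 5 → ℝ) (r r' : ℝ) (y y' : B) (F F' : Fin 5 → B)
    (μ ν ρ : Fin 5) : sym3 (fun μ ν ρ => w μ ν • (r • (y * F ρ) + r' • (y' * F' ρ))) μ ν ρ =
      r • (y * sym3 (fun μ ν ρ => w μ ν • F ρ) μ ν ρ)
        + r' • (y' * sym3 (fun μ ν ρ => w μ ν • F' ρ) μ ν ρ) := by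
  simp only [sym3, mul_add, mul_smul_comm]
  module

theorem eval_eom (a b c d : Fin N) (μ ν ρ : Fin 5) : t.eval a b c (eom 0 d μ ν ρ) =
    (if d = a then (1 : ℝ) else 0) • (t.z₂ * eomSymbol K U μ ν ρ)
      + (if d = c then (1 : ℝ) else 0) • (t.z₃ * eomSymbol t.R V μ ν ρ) := by
  have hs : ∀ (f f' : Fin 5 → B) (r r' : ℝ) (y y' : B),
      ∑ σ, sgn σ • (r • (y * f σ) + r' • (y' * f' σ)) =
      r • (y * ∑ σ, sgn σ • f σ) + r' • (y' * ∑ σ, sgn σ • f' σ) := by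
    intro f f' r r' y y'
    rw [Finset.mul_sum, Finset.mul_sum, Finset.smul_sum, Finset.smul_sum,
      ← Finset.sum_add_distrib]
    exact Finset.sum_congr rfl fun σ _ => by algebra
  rw [eom, map_sub, map_smul, eval_fronsdal]
  have h : t.eval a b c (sym3 (fun μ ν ρ => eta μ ν • ∑ α, sgn α • fronsdal 0 d ρ α α) μ ν ρ) = _ :=
    map_sym3 (t.eval a b c).toLinearMap _ μ ν ρ
  rw [h]
  simp only [AlgHom.toLinearMap_apply, map_smul, map_sum, eval_fronsdal, hs, sym3_pair]
  rw [eomSymbol, eomSymbol, mul_sub, mul_sub, mul_smul_comm, mul_smul_comm]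
  generalize sym3 (fun μ ν ρ => eta μ ν • ∑ α, sgn α • fronsdalSymbol (K (B := B)) U ρ α α) μ ν ρ = X
  generalize sym3 (fun μ ν ρ => eta μ ν • ∑ α, sgn α • fronsdalSymbol t.R V ρ α α) μ ν ρ = Y
  generalize fronsdalSymbol (K (B := B)) U μ ν ρ = X'
  generalize fronsdalSymbol t.R V μ ν ρ = Y'
  module

/-- Of the four products of two superposed waves, those using the same wave twice contain `y²` or
`z²` and vanish. Only the mixed terms remain. -/
theorem mul_nilpotent {y z : B} (hy : y * y = 0) (hz : z * z = 0) (r x₁ x₂ x₃ x₄ : ℝ)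
    (C G G' H H' H'' H''' : B) :
    (x₁ • (y * G) + x₂ • (z * G')) * r • C *
      ((1 / 2 : ℝ) • (x₃ • (y * H) + x₄ • (z * H') - (x₃ • (y * H'') + x₄ • (z * H''')))) =
    (r * (x₁ * x₄)) • (y * z * (C * G * ((1 / 2 : ℝ) • (H' - H'''))))
      + (r * (x₂ * x₃)) • (y * z * (C * G' * ((1 / 2 : ℝ) • (H - H'')))) := by
  have e : (x₁ • (y * G) + x₂ • (z * G')) * r • C *
      ((1 / 2 : ℝ) • (x₃ • (y * H) + x₄ • (z * H') - (x₃ • (y * H'') + x₄ • (z * H''')))) =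
    (r * (x₁ * x₄)) • (y * z * (C * G * ((1 / 2 : ℝ) • (H' - H'''))))
      + (r * (x₂ * x₃)) • (y * z * (C * G' * ((1 / 2 : ℝ) • (H - H''))))
      + (y * y) * ((r * (x₁ * x₃)) • (C * G * ((1 / 2 : ℝ) • (H - H''))))
      + (z * z) * ((r * (x₂ * x₄)) • (C * G' * ((1 / 2 : ℝ) • (H' - H''')))) := by
    algebra
  rw [e, hy, hz, zero_mul, zero_mul, add_zero, add_zero]

/-- The field equations can see the wave with label `a` and the connection the one with label `c`,
or conversely. This gives the coefficients `g a b c` and `g c b a`. -/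
theorem eval_delta_a1 (g : Fin N → Fin N → Fin N → ℝ) (a b c : Fin N) :
    t.eval a b c (delta (a1 g)) = g a b c • (t.z₂ * t.z₃ * sourceSymbol t.P t.A K U t.R V)
      + g c b a • (t.z₂ * t.z₃ * sourceSymbol t.P t.A t.R V K U) := by
  let Z : B →ₗ[ℝ] B := LinearMap.mulLeft ℝ (t.z₂ * t.z₃)
  have h : t.eval a b c (delta (a1 g)) = ∑ a', ∑ b', ∑ c', g a' b' c' •
      ((((if b' = b then (1 : ℝ) else 0) *
        ((if a' = a then (1 : ℝ) else 0) * (if c' = c then (1 : ℝ) else 0))) • Z)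
        (sourceSymbol t.P t.A K U t.R V)
      + (((if b' = b then (1 : ℝ) else 0) *
        ((if a' = c then (1 : ℝ) else 0) * (if c' = a then (1 : ℝ) else 0))) • Z)
        (sourceSymbol t.P t.A t.R V K U)) := by
    rw [a1]
    iterate 3 (rw [map_sum, map_sum]; refine Finset.sum_congr rfl fun _ _ => ?_)
    rw [LinearMap.map_smul, map_smul, map_sourceSymbol, map_sourceSymbol]
    refine congrArg (_ • ·) ?_
    iterate 5
      (rw [map_sum, map_sum, ← Finset.sum_add_distrib]; refine Finset.sum_congr rfl fun _ _ => ?_)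
    rw [LinearMap.map_smul, map_smul, ← smul_add]
    refine congrArg (_ • ·) ?_
    iterate 3
      (rw [map_sum, map_sum, ← Finset.sum_add_distrib]; refine Finset.sum_congr rfl fun _ _ => ?_)
    rw [LinearMap.map_smul, map_smul, ← smul_add]
    refine congrArg (_ • ·) ?_
    rw [delta_source_term, map_mul, map_mul, map_smul, map_sub, eval_eom, eval_curlC, eval_conn,
      eval_conn]
    exact mul_nilpotent t.z₂_sq t.z₃_sq _ _ _ _ _ _ _ _ _ _ _ _
  have h1 : ∀ (a b c : Fin N) (X : B), ∑ a', ∑ b', ∑ c', g a' b' c' •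
      ((((if b' = b then (1 : ℝ) else 0) *
        ((if a' = a then (1 : ℝ) else 0) * (if c' = c then (1 : ℝ) else 0))) • Z) X) =
      g a b c • Z X := by
    intro a b c X
    rw [Finset.sum_eq_single a, Finset.sum_eq_single b, Finset.sum_eq_single c]
    · simp
    · intro c' _ hc; simp [hc]
    · simp
    · intro b' _ hb; simp [hb]
    · simp
    · intro a' _ ha; simp [ha]
    · simp
  rw [h]
  simp only [smul_add, Finset.sum_add_distrib, h1]
  rfl

theorem eps5_values : eps5 U t.P t.A K V = 4 * (t.e₁ * t.e₂) := by
  rw [eps5_eq_det]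
  -- Column positions of the minors that occur in the cofactor expansion.
  have f₁ : Fin.succAbove (1 : Fin 4) (2 : Fin 3) = 3 := rfl
  have f₂ : Fin.succAbove (2 : Fin 4) (2 : Fin 3) = 3 := rfl
  have f₃ : Fin.succAbove (3 : Fin 4) (2 : Fin 3) = 2 := rfl
  have f₄ : Fin.succAbove (4 : Fin 5) (2 : Fin 4) = 2 := rfl
  have f₅ : Fin.succAbove (4 : Fin 5) (3 : Fin 4) = 3 := rfl
  simp [Matrix.det_succ_row_zero, Fin.sum_univ_succ, U, V, P, A, K, f₁, f₂, f₃, f₄, f₅]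
  ring

/-- `U` and `V` are null, orthogonal to `A`, and satisfy `U·V = -2`; moreover `K·K = 1` and `K·U =
0`. In `sourceSymbol_eq` only `(a·r)(q·q)(b·c)²` survives, giving `(3/2)(-4)(-1)(4) = 24`. -/
theorem sourceSymbol_value₁ : sourceSymbol t.P t.A K U t.R V = 24 * (t.s * t.e₁ * t.e₂) := by
  have h1 := t.e₁_sq
  have h2 := t.e₂_sq
  have hR : t.R = -(t.P + K) := rfl
  have he : ∀ x, eps5 x t.P t.A t.R V = -eps5 x t.P t.A K V := fun x => by
    rw [← eps5_rotate, ← eps5_rotate, hR, eps5_neg₁, eps5_add₁, eps5_eq₁₄, zero_add,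
      eps5_rotate, eps5_rotate]
  rw [sourceSymbol_eq, he, eps5_values]
  · have d1 : dot t.A t.R = -t.s := by
      simp [dot, Fin.sum_univ_five, A, R, P, K, sgn, h1, h2]
    have d2 : dot t.A V = 0 := by simp [dot, Fin.sum_univ_five, A, V, sgn]
    have d3 : dot (K : Fin 5 → B) K = 1 := by simp [dot, Fin.sum_univ_five, K, sgn]
    have d4 : dot (K : Fin 5 → B) U = 0 := by simp [dot, Fin.sum_univ_five, K, U, sgn]
    have d5 : dot (U : Fin 5 → B) U = 0 := by simp [dot, Fin.sum_univ_five, U, sgn]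
    have d6 : dot (V : Fin 5 → B) V = 0 := by simp [dot, Fin.sum_univ_five, V, sgn]
    have d7 : dot (U : Fin 5 → B) V = -2 := by
      simp [dot, Fin.sum_univ_five, U, V, sgn]; norm_num
    rw [d1, d2, d3, d4, d5, d6, d7]
    algebra
  · rw [eps5_rotate, eps5_rotate, eps5_rotate, hR, eps5_neg₁, eps5_add₁, eps5_eq₁₄, eps5_eq₁₃,
      add_zero, neg_zero]

/-- The determinant and the other factors are the same as before, but `A·K = s` replaces `A·R = -s`.
This relative sign is what detects the antisymmetric part of `g`. -/
theorem sourceSymbol_value₂ : sourceSymbol t.P t.A t.R V K U = -24 * (t.s * t.e₁ * t.e₂) := by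
  have h1 := t.e₁_sq
  have h2 := t.e₂_sq
  have he : eps5 V t.P t.A K U = -eps5 U t.P t.A K V := by
    rw [eps5_swap₁₂, eps5_swap₂₃, eps5_swap₃₄, eps5_swap₄₅, eps5_swap₃₄, eps5_swap₂₃, eps5_swap₁₂]
    ring
  rw [sourceSymbol_eq, he, eps5_values]
  · have d1 : dot t.A K = t.s := by simp [dot, Fin.sum_univ_five, A, K, sgn]
    have d2 : dot t.A U = 0 := by simp [dot, Fin.sum_univ_five, A, U, sgn]
    have d3 : dot t.R t.R = 1 := by simp [dot, Fin.sum_univ_five, R, P, K, sgn, h1, h2]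
    have d4 : dot t.R V = 0 := by simp [dot, Fin.sum_univ_five, R, P, K, V, sgn]
    have d5 : dot (U : Fin 5 → B) U = 0 := by simp [dot, Fin.sum_univ_five, U, sgn]
    have d6 : dot (V : Fin 5 → B) V = 0 := by simp [dot, Fin.sum_univ_five, V, sgn]
    have d7 : dot (V : Fin 5 → B) U = -2 := by
      simp [dot, Fin.sum_univ_five, U, V, sgn]; norm_num
    rw [d1, d2, d3, d4, d5, d6, d7]
    algebra
  · rw [show t.R = -(t.P + K) from rfl, eps5_neg₁, eps5_add₁, eps5_eq₁₂, eps5_eq₁₄, add_zero,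
      neg_zero]

end TestRing

/-- Evaluating the consistency condition on the test fields and applying `L` gives `24 (g_{abc} -
g_{cba}) = 0`. Exchange of the outer indices and of the last two generates all permutations. -/
theorem totallySymmetric_of_vertex (g : Fin N → Fin N → Fin N → ℝ)
    (hg : ∀ a b c, g a b c = g a c b) {x : BRST N} (hx : x ∈ localFunctions N)
    (h : IsTotalDiv (gamma x + delta (a1 g))) : TotallySymmetric g := by
  obtain ⟨B, _, _, ⟨t⟩⟩ := exists_testRing
  have key : ∀ a b c, g a b c = g c b a := by
    intro a b c
    have h1 := t.L_eval_totalDiv a b c h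
    rw [map_add, t.eval_gamma a b c hx, zero_add, t.eval_delta_a1, t.sourceSymbol_value₁,
      t.sourceSymbol_value₂] at h1
    have e : g a b c • (t.z₂ * t.z₃ * (24 * (t.s * t.e₁ * t.e₂)))
        + g c b a • (t.z₂ * t.z₃ * (-24 * (t.s * t.e₁ * t.e₂))) =
        (24 * (g a b c - g c b a)) • (t.z₂ * t.z₃ * (t.s * t.e₁ * t.e₂)) := by algebra
    rw [e, map_smul, t.L_top, smul_eq_mul] at h1
    linarith
  exact fun a b c => ⟨by rw [hg a b c, key a c b, hg b c a], hg a b c⟩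

end Spin3

end

theorem mainTheorem5 (N : ℕ) (g : Fin N → Fin N → Fin N → ℝ)
    (hg : ∀ a b c, g a b c = g a c b) :
    -- `a_2` is `γ`-closed and lifts to `a_1`
    (Spin3.gamma (Spin3.a2 g) = 0 ∧
      Spin3.IsTotalDiv (Spin3.gamma (Spin3.a1 g) + Spin3.delta (Spin3.a2 g))) ∧
    -- gauge variation of the second de Wit–Freedman connection
    (∀ (c : Fin N) (ρ σ τ α β : Fin 5), Spin3.gamma (Spin3.conn c ρ σ τ α β) =
      (3 : ℝ) • Spin3.CJet {τ, α, β} c ρ σ) ∧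
    -- the deformed gauge transformations
    (∀ κ : ℝ, Spin3.GeneratesGauge (Spin3.w1 N + κ • Spin3.a1 g) (Spin3.gaugeTransf g κ)) ∧
    -- a consistent cubic four-derivative vertex exists iff `g_{abc}` is totally symmetric
    ((∃ x : Spin3.BRST N, x ∈ Spin3.cubicFour N ∧ Spin3.IsPoincareInvariantParityOdd x ∧
        Spin3.IsTotalDiv (Spin3.gamma x + Spin3.delta (Spin3.a1 g))) ↔
      Spin3.TotallySymmetric g) ∧
    -- the same for arbitrary local functions of the fields
    ((∃ x ∈ Spin3.localFunctions N,
        Spin3.IsTotalDiv (Spin3.gamma x + Spin3.delta (Spin3.a1 g))) ↔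
      Spin3.TotallySymmetric g) ∧
    (Spin3.TotallySymmetric g ↔ Spin3.HasInvariantNorm g) ∧
    -- the explicit vertex
    (Spin3.TotallySymmetric g →
      Spin3.a0 g ∈ Spin3.cubicFour N ∧ Spin3.IsPoincareInvariantParityOdd (Spin3.a0 g) ∧
      Spin3.IsTotalDiv (Spin3.gamma (Spin3.a0 g) + Spin3.delta (Spin3.a1 g))) := by
  have nec : ∀ x ∈ Spin3.localFunctions N,
      Spin3.IsTotalDiv (Spin3.gamma x + Spin3.delta (Spin3.a1 g)) → Spin3.TotallySymmetric g :=
    fun _ hx h => Spin3.totallySymmetric_of_vertex g hg hx h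
  have suf : Spin3.TotallySymmetric g →
      Spin3.a0 g ∈ Spin3.cubicFour N ∧ Spin3.IsPoincareInvariantParityOdd (Spin3.a0 g) ∧
      Spin3.IsTotalDiv (Spin3.gamma (Spin3.a0 g) + Spin3.delta (Spin3.a1 g)) := fun h =>
    ⟨Spin3.a0_mem_cubicFour g, ⟨Spin3.lorentz_a0 g, Spin3.reflection_a0 g⟩,
      Spin3.variation_mem_totalDivs g h⟩
  refine ⟨⟨Spin3.gamma_a2 g, Spin3.lift_mem_totalDivs g hg⟩, Spin3.gamma_conn,
    Spin3.generatesGauge g hg, ⟨?_, fun h => ⟨_, suf h⟩⟩, ⟨?_, fun h => ?_⟩,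
    Spin3.totallySymmetric_iff_invariant g hg, suf⟩
  · rintro ⟨x, hx, -, h⟩
    exact nec x (Spin3.cubicFour_le_localFunctions hx) h
  · rintro ⟨x, hx, h⟩
    exact nec x hx h
  · exact ⟨_, Spin3.cubicFour_le_localFunctions (suf h).1, (suf h).2.2⟩
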